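/- For integers $\ell\ge 0$ let $\bar F(\ell,t)=\frac{\ell}{t}e^{-t}I_\ell(t)$ be the first-passage density (at the site $\ell$) of the symmetric continuous-time random walk on $\mathbb Z$ started at $0$ with unit jump rate, where $I_\ell$ is the modified Bessel function of the first kind, and for integers $\ell_A\ge1$, $\ell_B\ge0$ let $$P(\ell_A,\ell_B)=\int_0^\infty \bar F(\ell_A,t_A)\int_{t_A}^\infty \bar F(\ell_B,t_B)\,dt_B\,dt_A ,$$ which for $\ell_B\ge1$ is the probability that walker $A$ reaches $\ell_A$ before the independent walker $B$ reaches $\ell_B$. Put $p=2-\cos\theta$ and, for real $a>0$ and real $b$, $$\mathcal P(a,b)=\frac1\pi\int_0^\pi\cot\tfrac\theta2\,\sin(b\theta)\,\bigl(p+\sqrt{p^2-1}\bigr)^{-a}d\theta,\qquad \psi(\theta)=ib\theta-a\ln\bigl(p+\sqrt{p^2-1}\bigr),$$ $$f(\theta)=\tfrac\theta2\cot\tfrac\theta2\ (f(0)=1),\qquad Q(a,b)=\int_0^\pi f(\theta)e^{\psi(\theta)}d\theta .$$ On $(0,\pi)$ one has $\psi'(\theta)=ib-a\cos\frac\theta2\big/\sqrt{1+\sin^2\frac\theta2}$;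 extend $\psi'$ by this formula. Define $$f_0=f,\quad f_{k+1}=-\frac{d}{d\theta}\frac{f_k}{\psi'},\quad d_k(a,b)=-\frac{f_k(0)}{\psi'(0)},\quad e_{k}(a,b)=\int_0^{b}\operatorname{Re}d_{k}(a,b')\,db'.$$ Then the following hold. 1. $P(\ell_A,\ell_B)=\mathcal P(\ell_A,\ell_B)$ for all integers $\ell_A\ge1$, $\ell_B\ge0$, and $\partial\mathcal P/\partial b=\frac2\pi\operatorname{Re}Q$ for all real $a>0$ and $b$. 2. $P\sim\frac2\pi(e_0+e_2+e_4+\cdots)$ for $\ell_A+\ell_B$ large: for every $K\ge0$ there is a constant $C$ such that for all integers $\ell_A\ge1$, $\ell_B\ge0$ $$\Bigl|P(\ell_A,\ell_B)-\frac2\pi\sum_{k<K}e_{2k}(\ell_A,\ell_B)\Bigr|\le \frac{C}{(\ell_A+\ell_B)^{2K}} .$$ For real parameters the expansion is uniform in the ratio $\lambda=b/a\ge0$: for every $K\ge0$ there is $C$ such that for all real $a\ge1$, $\lambda\ge0$ $$\Bigl|\mathcal P(a,\lambda a)-\frac2\pi\sum_{k<K}e_{2k}(a,\lambda a)\Bigr|\le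 C a^{-2K}.$$ 3. For real $a>0$, $b\ge0$: $$e_0=\arctan\frac ba,\qquad e_2=\frac{ab(a^2-b^2)}{3(a^2+b^2)^3},\qquad e_4=\frac{ab(a^2-b^2)(23a^4-354a^2b^2+23b^4)}{60(a^2+b^2)^6},$$ $$e_6=\frac{ab(a^2-b^2)(249a^8-10796a^6b^2+40630a^4b^4-10796a^2b^6+249b^8)}{126(a^2+b^2)^9}.$$ For every $k\ge1$, $e_{2k}$ is a rational function: $e_{2k}=N_k(a,b)/(a^2+b^2)^{3k}$ for all real $a>0$, $b\ge0$, with $N_k\in\mathbb Q[X,Y]$ homogeneous of degree $4k$. All $d_k$ with odd $k$ vanish for $a>0$, $b\ge0$. 4. For every $k\ge0$ there is $C$ such that $|d_{2k}(a,\lambda a)|\le Ca^{-2k}$ for all $a\ge1$, $\lambda\ge0$. For every $k\ge0$ and $\delta>0$ there is $C$ such that, for $b=\lambda a$, $|f_{2k}(\theta)|\le Ca^{-2k}$ for all $a\ge1$, $\lambda\ge0$ and $\theta\in[0,\pi]$ with $\theta\le\pi-\delta$ or $\lambda\ge\delta$. 5. For every $k\ge0$ and $\theta_0\in(0,\pi)$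 there is $C$ such that for all $a\ge1$, $\lambda\ge0$, with $b=\lambda a$, $$\Bigl|Q-\Bigl(d_0+d_2+\cdots+d_{2k-2}+\int_0^{\theta_0}f_{2k}(\theta)e^{\psi(\theta)}d\theta\Bigr)\Bigr|\le C\bigl(p(\theta_0)+\sqrt{p(\theta_0)^2-1}\bigr)^{-a},\qquad p(\theta_0)=2-\cos\theta_0 .$$ -/

import Mathlib

noncomputable section

namespace FirstPassage

/-- The modified Bessel function of the first kind `I_n(z)` of integer order `n ≥ 0`. -/
def besselI (n : ℕ) (z : ℝ) : ℝ :=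
  ∑' m : ℕ, (z / 2) ^ (n + 2 * m) / ((m.factorial : ℝ) * ((n + m).factorial : ℝ))

/-- The first-passage density `(ℓ / t) e^{-t} I_ℓ(t)` at the site `ℓ`, for the symmetric
continuous-time walk on the integers that starts at `0` and jumps at unit rate. -/
def passageDensity (l : ℕ) (t : ℝ) : ℝ :=
  (l : ℝ) / t * Real.exp (-t) * besselI l t

/-- `P(ℓ_A, ℓ_B)`: the probability that walker `A` reaches `ℓ_A` before the independent
walker `B` reaches `ℓ_B`, as the double integral of the product of the densities. -/
def P (lA lB : ℕ) : ℝ :=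
  ∫ tA in Set.Ioi (0 : ℝ), passageDensity lA tA * ∫ tB in Set.Ioi tA, passageDensity lB tB

/-- `p = 2 - cos θ`. -/
def p (θ : ℝ) : ℝ := 2 - Real.cos θ

/-- `p + √(p² - 1)`. -/
def w (θ : ℝ) : ℝ := p θ + Real.sqrt (p θ ^ 2 - 1)

/-- The single-integral form of `P`, which makes sense for real parameters. -/
def PInt (a b : ℝ) : ℝ :=
  1 / Real.pi * ∫ θ in (0 : ℝ)..Real.pi,
    Real.cot (θ / 2) * Real.sin (b * θ) * w θ ^ (-a)

/-- The phase `ψ(θ) = i b θ - a ln (p + √(p² - 1))`. -/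
def psi (a b θ : ℝ) : ℂ := Complex.I * b * θ - a * (Real.log (w θ) : ℂ)

/-- `ψ'(θ) = i b - a cos(θ/2) / √(1 + sin²(θ/2))`: the derivative of `ψ` on `(0, π)`
(see `hasDerivAt_psi`), extended smoothly to the end points. -/
def dpsi (a b θ : ℝ) : ℂ :=
  Complex.I * b -
    a * ((Real.cos (θ / 2) / Real.sqrt (1 + Real.sin (θ / 2) ^ 2) : ℝ) : ℂ)

/-- `f(θ) = (θ/2) cot (θ/2)` with its removable singularity at `0` filled in, `f(0) = 1`
(see `amp_eq`). -/
def amp (θ : ℝ) : ℝ := Real.cos (θ / 2) / Real.sinc (θ / 2)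

/-- `f_0 = f` and `f_{k+1} = - (f_k / ψ')'`. -/
def fSeq (a b : ℝ) : ℕ → ℝ → ℂ
  | 0 => fun θ => (amp θ : ℂ)
  | k + 1 => fun θ => - deriv (fun x : ℝ => fSeq a b k x / dpsi a b x) θ

/-- `Q = ∫_0^π f(θ) e^{ψ(θ)} dθ`. -/
def Q (a b : ℝ) : ℂ :=
  ∫ θ in (0 : ℝ)..Real.pi, (amp θ : ℂ) * Complex.exp (psi a b θ)

/-- `d_k = - f_k(0) / ψ'(0)`. -/
def d (k : ℕ) (a b : ℝ) : ℂ := - fSeq a b k 0 / dpsi a b 0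

/-- `e_k = ∫_0^b Re d_k(a, b') db'` (used for even `k`). -/
def e (k : ℕ) (a b : ℝ) : ℝ := ∫ t in (0 : ℝ)..b, (d k a t).re

theorem amp_zero : amp 0 = 1 := by simp [amp]

theorem amp_eq {θ : ℝ} (h : θ ≠ 0) : amp θ = θ / 2 * Real.cot (θ / 2) := by
  have h2 : θ / 2 ≠ 0 := by simpa using h
  rw [amp, Real.sinc_of_ne_zero h2, Real.cot_eq_cos_div_sin, div_div_eq_mul_div]
  ring

theorem hasDerivAt_psi (a b : ℝ) {θ : ℝ} (h0 : 0 < θ) (hpi : θ < Real.pi) :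
    HasDerivAt (psi a b) (dpsi a b θ) θ := by
  have hs : 0 < Real.sin (θ / 2) := Real.sin_pos_of_pos_of_lt_pi (by linarith) (by linarith)
  set s := Real.sin (θ / 2) with hsd
  set c := Real.cos (θ / 2) with hcd
  have hsc : s ^ 2 + c ^ 2 = 1 := Real.sin_sq_add_cos_sq _
  have hcos : Real.cos θ = 1 - 2 * s ^ 2 := by
    have := Real.cos_two_mul (θ / 2)
    rw [show 2 * (θ / 2) = θ by ring] at this
    rw [this, ← hcd]; linarith
  have hsin : Real.sin θ = 2 * s * c := by
    have := Real.sin_two_mul (θ / 2)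
    rwa [show 2 * (θ / 2) = θ by ring] at this
  have hp2 : p θ ^ 2 - 1 = (2 * s) ^ 2 * (1 + s ^ 2) := by rw [p, hcos]; ring
  have hr : Real.sqrt (p θ ^ 2 - 1) = 2 * s * Real.sqrt (1 + s ^ 2) := by
    rw [hp2, Real.sqrt_mul (by positivity), Real.sqrt_sq (by positivity)]
  have hq : 0 < Real.sqrt (1 + s ^ 2) := Real.sqrt_pos.mpr (by positivity)
  have hrpos : 0 < Real.sqrt (p θ ^ 2 - 1) := by rw [hr]; positivity
  have hppos : 0 < p θ := by rw [p, hcos]; nlinarith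
  have hw : 0 < w θ := by rw [w]; positivity
  have hdp : HasDerivAt p (Real.sin θ) θ := by
    have h1 := (Real.hasDerivAt_cos θ).const_sub 2
    rw [neg_neg] at h1
    exact h1
  have hne : p θ ^ 2 - 1 ≠ 0 := by
    intro h
    rw [h, Real.sqrt_zero] at hrpos
    exact lt_irrefl _ hrpos
  have hdw : HasDerivAt w (Real.sin θ + 2 * p θ * Real.sin θ /
      (2 * Real.sqrt (p θ ^ 2 - 1))) θ := by
    have h1 : HasDerivAt (fun x => p x ^ 2 - 1) (2 * p θ * Real.sin θ) θ := by
      simpa using (hdp.pow 2).sub_const 1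
    exact hdp.add (h1.sqrt hne)
  have hlog : HasDerivAt (fun x => Real.log (w x)) (c / Real.sqrt (1 + s ^ 2)) θ := by
    have h1 := hdw.log hw.ne'
    have h2 : (Real.sin θ + 2 * p θ * Real.sin θ / (2 * Real.sqrt (p θ ^ 2 - 1))) / w θ
        = c / Real.sqrt (1 + s ^ 2) := by
      have h3 : Real.sin θ + 2 * p θ * Real.sin θ / (2 * Real.sqrt (p θ ^ 2 - 1))
          = Real.sin θ / Real.sqrt (p θ ^ 2 - 1) * w θ := by
        rw [w]; field_simp; ring
      rw [h3, mul_div_assoc, div_self hw.ne', mul_one, hr, hsin]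
      field_simp
    rwa [h2] at h1
  have h1 : HasDerivAt (fun x : ℝ => Complex.I * b * (x : ℂ)) (Complex.I * b) θ := by
    simpa using (Complex.ofRealCLM.hasDerivAt (x := θ)).const_mul (Complex.I * (b : ℂ))
  exact h1.sub (hlog.ofReal_comp.const_mul (a : ℂ))

end FirstPassage

end

/-!
Write `w θ = p + √(p² - 1)` and `ψ = i b θ - a log w`.

*From two random walks to one integral.* The generating function of the Bessel functions gives
`I_l` as a Fourier coefficient of `exp (t cos φ)`, and so the first-passage density as
`π⁻¹ ∫ e^{-t (1 - cos φ)} sin φ sin (l φ) dφ` (`passageDensity_eq_integral`). Its integral over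
`[T, ∞)` is elementary (`integral_Ioi_passageDensity`), its Laplace transform at `1 - cos θ` is
`w θ ^ (-l)` for `l ≥ 1` (`laplace_passageDensity`), and Fubini's theorem turns the double integral into
`PInt` (`P_eq_PInt`). Differentiation under the integral sign relates `PInt` to `Q`.

*Integration by parts.* Iterating `F ↦ -(F / ψ')'` gives
`∑ m ≤ k, ibpCoeff F k m * a ^ m / ψ' ^ (m + k)` with real functions `ibpCoeff F k m` that do not
depend on `a` and `b`. All bounds for `d_k`, for the remainders and for `Q` are read off from this
form, because `|ψ'|` is comparable to `a + b` away from `θ = π` (`exists_le_norm_dpsi`), and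
because `|e^ψ| = w^{-a}` decreases on `[0, π]`.

*The terms `e_{2k}`.* As the amplitude is even, the odd `d_k` vanish. The functions
`ibpCoeff amp k m` have Taylor series at `0` with rational coefficients, and vanish there to the
order `2 m - k` (`coeff_taylorGerm_ibpCoeff_eq_zero`). So `d_{2k}` only contains the powers
`(i b - a) ^ {-(m + 2 k + 1)}` with `m ≤ k`, and for `k ≥ 1` its integral in `b` is a rational
function with denominator `(a² + b²) ^ (3 k)`. The first terms come from running the recursion for
the Taylor coefficients.

*The error of the expansion.* A cutoff splits the integral into a part near `θ = 0` and a tail.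
For the part near `0`, the error of the expansion has a derivative in `b` of order
`(a + b) ^ {-(2 K + 1)}`, by integration by parts without boundary terms at the far end. The error
tends to `0` as `b → ∞` through the integers, by the Dirichlet integral, the Riemann–Lebesgue
lemma and `arctan (b / a) → π / 2`; so it is of order `(a + b) ^ {-2 K}`
(`exists_abs_sineInt_localAmp_sub_le`). The tail is exponentially small in `a`, uniformly in `b`.
This settles the bound in terms of `a` alone. For integer `b` the tail is also small in `b`: the
tail amplitude is odd about `π`, hence the boundary terms at `π` of its integrations by parts are
real, while only the imaginary part enters (`boundary_tail_im`).
-/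

noncomputable section

open Set Filter Topology
open scoped ContDiff

namespace FirstPassage

/-! ### The phase -/

/-- The derivative of `log w` on `(0, π)`, in the closed form that is smooth on all of `ℝ`. -/
def phaseSlope (θ : ℝ) : ℝ := Real.cos (θ / 2) / Real.sqrt (1 + Real.sin (θ / 2) ^ 2)

theorem dpsi_eq (a b θ : ℝ) : dpsi a b θ = Complex.I * b - a * (phaseSlope θ : ℂ) := rfl

theorem contDiff_phaseSlope : ContDiff ℝ ∞ phaseSlope := by
  have h : ∀ θ : ℝ, 1 + Real.sin (θ / 2) ^ 2 ≠ 0 := fun θ => by positivity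
  have h' : ∀ θ : ℝ, Real.sqrt (1 + Real.sin (θ / 2) ^ 2) ≠ 0 := fun θ => by positivity
  have h1 : ContDiff ℝ ∞ fun θ : ℝ => θ / 2 := contDiff_id.div_const 2
  exact (Real.contDiff_cos.comp h1).div
    ((contDiff_const.add ((Real.contDiff_sin.comp h1).pow 2)).sqrt h) h'

theorem phaseSlope_zero : phaseSlope 0 = 1 := by simp [phaseSlope]

theorem phaseSlope_pi : phaseSlope Real.pi = 0 := by simp [phaseSlope]

theorem phaseSlope_neg (θ : ℝ) : phaseSlope (-θ) = phaseSlope θ := by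
  simp [phaseSlope, neg_div]

theorem phaseSlope_reflect (θ : ℝ) : phaseSlope (2 * Real.pi - θ) = -phaseSlope θ := by
  have : (2 * Real.pi - θ) / 2 = Real.pi - θ / 2 := by ring
  simp [phaseSlope, this, Real.cos_pi_sub, Real.sin_pi_sub, neg_div]

theorem half_cos_le_phaseSlope {θ : ℝ} (h0 : 0 ≤ θ) (hπ : θ ≤ Real.pi) :
    Real.cos (θ / 2) / 2 ≤ phaseSlope θ := by
  have hc : 0 ≤ Real.cos (θ / 2) :=
    Real.cos_nonneg_of_mem_Icc ⟨by linarith [Real.pi_pos], by linarith⟩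
  refine div_le_div_of_nonneg_left hc (by positivity) ?_
  rw [Real.sqrt_le_left (by norm_num)]
  nlinarith [Real.sin_sq_le_one (θ / 2)]

theorem phaseSlope_le_one (θ : ℝ) : phaseSlope θ ≤ 1 := by
  have h : (1 : ℝ) ≤ Real.sqrt (1 + Real.sin (θ / 2) ^ 2) := by
    rw [Real.one_le_sqrt]; nlinarith [sq_nonneg (Real.sin (θ / 2))]
  exact (div_le_one (by linarith)).2 ((Real.cos_le_one _).trans h)

theorem dpsi_im (a b θ : ℝ) : (dpsi a b θ).im = b := by simp [dpsi_eq]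

theorem dpsi_re (a b θ : ℝ) : (dpsi a b θ).re = -(a * phaseSlope θ) := by simp [dpsi_eq]

theorem le_norm_dpsi (a b θ : ℝ) : b ≤ ‖dpsi a b θ‖ := by
  have := Complex.abs_im_le_norm (dpsi a b θ)
  rw [dpsi_im] at this
  exact (le_abs_self b).trans this

theorem mul_phaseSlope_le_norm_dpsi (a b θ : ℝ) : a * phaseSlope θ ≤ ‖dpsi a b θ‖ := by
  have := Complex.abs_re_le_norm (dpsi a b θ)
  rw [dpsi_re, abs_neg] at this
  exact (le_abs_self _).trans this

theorem contDiff_dpsi (a b : ℝ) : ContDiff ℝ ∞ (dpsi a b) := by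
  have h : ContDiff ℝ ∞ fun θ => (phaseSlope θ : ℂ) :=
    Complex.ofRealCLM.contDiff.comp contDiff_phaseSlope
  exact contDiff_const.sub (contDiff_const.mul h)

theorem hasDerivAt_dpsi (a b θ : ℝ) :
    HasDerivAt (dpsi a b) (-(a * ((deriv phaseSlope θ : ℝ) : ℂ))) θ := by
  have h := ((contDiff_phaseSlope.differentiable (by simp)) θ).hasDerivAt.ofReal_comp
  exact (h.const_mul (a : ℂ)).const_sub (Complex.I * b)

theorem one_le_p (θ : ℝ) : 1 ≤ p θ := by rw [p]; linarith [Real.cos_le_one θ]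

theorem one_le_w (θ : ℝ) : 1 ≤ w θ := by
  rw [w]; linarith [one_le_p θ, Real.sqrt_nonneg (p θ ^ 2 - 1)]

theorem w_pos (θ : ℝ) : 0 < w θ := lt_of_lt_of_le one_pos (one_le_w θ)

theorem continuous_p : Continuous p := continuous_const.sub Real.continuous_cos

theorem continuous_w : Continuous w :=
  continuous_p.add (((continuous_p.pow 2).sub continuous_const).sqrt)

theorem w_zero : w 0 = 1 := by norm_num [w, p]

theorem psi_zero (a b : ℝ) : psi a b 0 = 0 := by simp [psi, w_zero]

theorem continuous_psi (a b : ℝ) : Continuous (psi a b) := by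
  have h : Continuous fun θ => (Real.log (w θ) : ℂ) :=
    Complex.continuous_ofReal.comp (continuous_w.log fun θ => (w_pos θ).ne')
  exact (continuous_const.mul Complex.continuous_ofReal).sub (continuous_const.mul h)

theorem psi_re (a b θ : ℝ) : (psi a b θ).re = -a * Real.log (w θ) := by
  simp [psi]

theorem psi_im (a b θ : ℝ) : (psi a b θ).im = b * θ := by
  simp [psi]

theorem norm_exp_psi (a b θ : ℝ) :
    ‖Complex.exp (psi a b θ)‖ = Real.exp (-a * Real.log (w θ)) := by
  rw [Complex.norm_exp, psi_re]

theorem norm_exp_psi_le_one {a : ℝ} (ha : 0 ≤ a) (b θ : ℝ) : ‖Complex.exp (psi a b θ)‖ ≤ 1 := by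
  rw [norm_exp_psi, Real.exp_le_one_iff]
  nlinarith [Real.log_nonneg (one_le_w θ)]

theorem w_rpow_neg (a θ : ℝ) : w θ ^ (-a) = Real.exp (-a * Real.log (w θ)) := by
  rw [Real.rpow_def_of_pos (w_pos θ), mul_comm]

theorem exp_psi_re (a b θ : ℝ) :
    (Complex.exp (psi a b θ)).re = Real.cos (b * θ) * w θ ^ (-a) := by
  rw [Complex.exp_re, psi_re, psi_im, w_rpow_neg, mul_comm]

theorem exp_psi_im (a b θ : ℝ) :
    (Complex.exp (psi a b θ)).im = Real.sin (b * θ) * w θ ^ (-a) := by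
  rw [Complex.exp_im, psi_re, psi_im, w_rpow_neg, mul_comm]

theorem w_mono {x y : ℝ} (hx : 0 ≤ x) (hxy : x ≤ y) (hy : y ≤ Real.pi) : w x ≤ w y := by
  have hp : p x ≤ p y := by
    rw [p, p]; linarith [Real.cos_le_cos_of_nonneg_of_le_pi hx hy hxy]
  have := one_le_p x
  exact add_le_add hp (Real.sqrt_le_sqrt (by nlinarith))

theorem one_lt_w {θ : ℝ} (h0 : 0 < θ) (hπ : θ ≤ Real.pi) : 1 < w θ := by
  have : Real.cos θ < Real.cos 0 := Real.cos_lt_cos_of_nonneg_of_le_pi le_rfl hπ h0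
  rw [Real.cos_zero] at this
  rw [w, p]
  linarith [Real.sqrt_nonneg (p θ ^ 2 - 1), Real.sqrt_nonneg ((2 - Real.cos θ) ^ 2 - 1)]

theorem exp_neg_mul_log_w_le {a x y : ℝ} (ha : 0 ≤ a) (hx : 0 ≤ x) (hxy : x ≤ y)
    (hy : y ≤ Real.pi) :
    Real.exp (-a * Real.log (w y)) ≤ Real.exp (-a * Real.log (w x)) := by
  rw [Real.exp_le_exp]
  nlinarith [Real.log_le_log (w_pos x) (w_mono hx hxy hy)]

/-! ### The coefficients of the terms of the integration by parts -/

/-- Repeated application of `F ↦ -(F / ψ')'` to a real function `F` gives at the `k`-th step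
`∑ m ≤ k, ibpCoeff F k m * a ^ m / ψ' ^ (m + k)`, where the coefficients do not depend on
the parameters `a` and `b`. -/
def ibpCoeff (F : ℝ → ℝ) : ℕ → ℕ → ℝ → ℝ
  | 0, 0 => F
  | 0, _ + 1 => 0
  | k + 1, 0 => fun θ => -deriv (ibpCoeff F k 0) θ
  | k + 1, m + 1 => fun θ => -deriv (ibpCoeff F k (m + 1)) θ
      - (m + 1 + k) * deriv phaseSlope θ * ibpCoeff F k m θ

theorem contDiffOn_ibpCoeff {F : ℝ → ℝ} {U : Set ℝ} (hU : IsOpen U) (hF : ContDiffOn ℝ ∞ F U)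
    (k m : ℕ) : ContDiffOn ℝ ∞ (ibpCoeff F k m) U := by
  have hd : ∀ {G : ℝ → ℝ}, ContDiffOn ℝ ∞ G U → ContDiffOn ℝ ∞ (deriv G) U :=
    fun hG => hG.deriv_of_isOpen hU (by simp)
  induction k generalizing m with
  | zero => cases m with
    | zero => exact hF
    | succ m => exact contDiffOn_const
  | succ k ih => cases m with
    | zero => exact (hd (ih 0)).neg
    | succ m =>
      exact (hd (ih (m + 1))).neg.sub
        ((contDiffOn_const.mul (hd contDiff_phaseSlope.contDiffOn)).mul (ih m))

theorem ibpCoeff_eq_zero (F : ℝ → ℝ) {k m : ℕ} (h : k < m) : ibpCoeff F k m = 0 := by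
  induction k generalizing m with
  | zero => obtain ⟨m, rfl⟩ : ∃ n, m = n + 1 := ⟨m - 1, by omega⟩; rfl
  | succ k ih =>
    obtain ⟨m, rfl⟩ : ∃ n, m = n + 1 := ⟨m - 1, by omega⟩
    funext θ
    have h1 := ih (m := m + 1) (by omega)
    have h2 := ih (m := m) (by omega)
    simp [ibpCoeff, h1, h2]

theorem ibpCoeff_congr {F G : ℝ → ℝ} {x : ℝ} (h : F =ᶠ[𝓝 x] G) (k m : ℕ) :
    ibpCoeff F k m =ᶠ[𝓝 x] ibpCoeff G k m := by
  induction k generalizing m with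
  | zero => cases m with
    | zero => exact h
    | succ m => exact EventuallyEq.rfl
  | succ k ih => cases m with
    | zero => exact (ih 0).deriv.neg
    | succ m =>
      filter_upwards [(ih (m + 1)).deriv, ih m] with y h1 h2
      simp only [ibpCoeff, h1, h2]

theorem ibpCoeff_zero_fun (k m : ℕ) : ibpCoeff 0 k m = 0 := by
  induction k generalizing m with
  | zero => cases m <;> rfl
  | succ k ih => cases m with
    | zero => funext θ; simp [ibpCoeff, ih 0]
    | succ m => funext θ; simp [ibpCoeff, ih (m + 1), ih m]

theorem deriv_phaseSlope_neg (θ : ℝ) : deriv phaseSlope (-θ) = -deriv phaseSlope θ := by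
  have h := deriv_comp_neg phaseSlope θ
  rw [show (fun x => phaseSlope (-x)) = phaseSlope from funext phaseSlope_neg] at h
  linarith

theorem deriv_phaseSlope_reflect (θ : ℝ) :
    deriv phaseSlope (2 * Real.pi - θ) = deriv phaseSlope θ := by
  have h := deriv_comp_const_sub phaseSlope (2 * Real.pi) θ
  rw [show (fun x => phaseSlope (2 * Real.pi - x)) = fun x => -phaseSlope x from
    funext phaseSlope_reflect, deriv.fun_neg] at h
  linarith

/-- For even `F`, each integration by parts changes the parity about `0`. -/
theorem ibpCoeff_neg {F : ℝ → ℝ} (hF : ∀ θ, F (-θ) = F θ) (k m : ℕ) (θ : ℝ) :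
    ibpCoeff F k m (-θ) = (-1) ^ k * ibpCoeff F k m θ := by
  have hd : ∀ (k m : ℕ), (∀ θ, ibpCoeff F k m (-θ) = (-1) ^ k * ibpCoeff F k m θ) →
      ∀ θ, deriv (ibpCoeff F k m) (-θ) = -((-1) ^ k * deriv (ibpCoeff F k m) θ) := by
    intro k m h θ
    have h1 := deriv_comp_neg (ibpCoeff F k m) θ
    rw [show (fun x => ibpCoeff F k m (-x)) = fun x => (-1) ^ k * ibpCoeff F k m x from funext h,
      deriv_const_mul_field] at h1
    linarith
  induction k generalizing m θ with
  | zero => cases m with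
    | zero => simp [ibpCoeff, hF]
    | succ m => simp [ibpCoeff]
  | succ k ih => cases m with
    | zero =>
      simp only [ibpCoeff, hd k 0 (ih 0)]; ring
    | succ m =>
      simp only [ibpCoeff, hd k (m + 1) (ih (m + 1)), ih m, deriv_phaseSlope_neg]; ring

/-- For `F` odd about `π`, the parity about `π` of the coefficients: a derivative changes it, a
factor `phaseSlope'` does not. -/
theorem ibpCoeff_reflect {F : ℝ → ℝ} (hF : ∀ θ, F (2 * Real.pi - θ) = -F θ) (k m : ℕ) (θ : ℝ) :
    ibpCoeff F k m (2 * Real.pi - θ) = (-1) ^ (k + m + 1) * ibpCoeff F k m θ := by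
  have hd : ∀ (k m : ℕ),
      (∀ θ, ibpCoeff F k m (2 * Real.pi - θ) = (-1) ^ (k + m + 1) * ibpCoeff F k m θ) →
      ∀ θ, deriv (ibpCoeff F k m) (2 * Real.pi - θ)
        = -((-1) ^ (k + m + 1) * deriv (ibpCoeff F k m) θ) := by
    intro k m h θ
    have h1 := deriv_comp_const_sub (ibpCoeff F k m) (2 * Real.pi) θ
    rw [show (fun x => ibpCoeff F k m (2 * Real.pi - x))
        = fun x => (-1) ^ (k + m + 1) * ibpCoeff F k m x from funext h,
      deriv_const_mul_field] at h1
    linarith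
  induction k generalizing m θ with
  | zero => cases m with
    | zero => simp [ibpCoeff, hF]
    | succ m => simp [ibpCoeff]
  | succ k ih => cases m with
    | zero =>
      simp only [ibpCoeff, hd k 0 (ih 0)]; ring
    | succ m =>
      simp only [ibpCoeff, hd k (m + 1) (ih (m + 1)), ih m, deriv_phaseSlope_reflect]; ring

/-- The `k`-th iterate of `F ↦ -(F / ψ')'`, in expanded form. -/
def ibpTerm (F : ℝ → ℝ) (a b : ℝ) (k : ℕ) (θ : ℝ) : ℂ :=
  ∑ m ∈ Finset.range (k + 1), (ibpCoeff F k m θ : ℂ) * (a : ℂ) ^ m / dpsi a b θ ^ (m + k)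

theorem ibpTerm_zero (F : ℝ → ℝ) (a b θ : ℝ) : ibpTerm F a b 0 θ = F θ := by
  simp [ibpTerm, ibpCoeff]

theorem hasDerivAt_ibpTerm_div {F : ℝ → ℝ} {U : Set ℝ} (hU : IsOpen U)
    (hF : ContDiffOn ℝ ∞ F U) {a b θ : ℝ} (hθ : θ ∈ U) (h0 : dpsi a b θ ≠ 0) (k : ℕ) :
    HasDerivAt (fun x => ibpTerm F a b k x / dpsi a b x) (-ibpTerm F a b (k + 1) θ) θ := by
  have hA : ∀ m, HasDerivAt (fun x => (ibpCoeff F k m x : ℂ))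
      ((deriv (ibpCoeff F k m) θ : ℝ) : ℂ) θ := by
    intro m
    exact (((contDiffOn_ibpCoeff hU hF k m).differentiableOn (by simp)).differentiableAt
      (hU.mem_nhds hθ)).hasDerivAt.ofReal_comp
  have hterm : ∀ m, HasDerivAt
      (fun x => (ibpCoeff F k m x : ℂ) * (a : ℂ) ^ m / dpsi a b x ^ (m + k + 1))
      (((deriv (ibpCoeff F k m) θ : ℝ) : ℂ) * (a : ℂ) ^ m / dpsi a b θ ^ (m + k + 1)
        + (m + k + 1) * (deriv phaseSlope θ : ℝ) * ibpCoeff F k m θ * (a : ℂ) ^ (m + 1)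
          / dpsi a b θ ^ (m + 1 + (k + 1))) θ := by
    intro m
    have h1 := ((hA m).mul_const ((a : ℂ) ^ m)).div ((hasDerivAt_dpsi a b θ).pow (m + k + 1))
      (pow_ne_zero _ h0)
    refine h1.congr_deriv ?_
    simp only [Pi.pow_apply]
    have e1 : dpsi a b θ ^ (m + 1 + (k + 1)) = dpsi a b θ ^ (m + k) * dpsi a b θ * dpsi a b θ := by
      ring
    have e2 : dpsi a b θ ^ (m + k + 1) = dpsi a b θ ^ (m + k) * dpsi a b θ := by ring
    have e3 : dpsi a b θ ^ (m + k) ≠ 0 := pow_ne_zero _ h0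
    rw [e1, e2, Nat.add_sub_cancel]
    push_cast
    field_simp
    ring
  have hsum := HasDerivAt.fun_sum (u := Finset.range (k + 1)) fun m _ => hterm m
  have hfun : (fun x => ibpTerm F a b k x / dpsi a b x) = fun x => ∑ m ∈ Finset.range (k + 1),
      (ibpCoeff F k m x : ℂ) * (a : ℂ) ^ m / dpsi a b x ^ (m + k + 1) := by
    funext x
    rw [ibpTerm, Finset.sum_div]
    refine Finset.sum_congr rfl fun m _ => ?_
    rw [div_div, pow_succ]
  rw [hfun]
  refine hsum.congr_deriv ?_
  rw [Finset.sum_add_distrib, ibpTerm, Finset.sum_range_succ' _ (k + 1),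
    Finset.sum_range_succ' (fun m => ((deriv (ibpCoeff F k m) θ : ℝ) : ℂ) * (a : ℂ) ^ m
      / dpsi a b θ ^ (m + k + 1)) k]
  -- the coefficient of index `k + 1` is zero
  have hlast : (∑ m ∈ Finset.range k,
      ((deriv (ibpCoeff F k (m + 1)) θ : ℝ) : ℂ) * (a : ℂ) ^ (m + 1)
      / dpsi a b θ ^ (m + 1 + k + 1)) = ∑ m ∈ Finset.range (k + 1),
      ((deriv (ibpCoeff F k (m + 1)) θ : ℝ) : ℂ) * (a : ℂ) ^ (m + 1)
      / dpsi a b θ ^ (m + 1 + k + 1) := by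
    rw [Finset.sum_range_succ (n := k), ibpCoeff_eq_zero F (Nat.lt_succ_self k)]
    simp
  rw [hlast, neg_add, ← Finset.sum_neg_distrib, add_right_comm, ← Finset.sum_add_distrib]
  congr 1
  · refine Finset.sum_congr rfl fun m _ => ?_
    rw [show m + 1 + k + 1 = m + 1 + (k + 1) by ring]
    simp only [ibpCoeff]
    push_cast
    ring
  · simp only [ibpCoeff]
    push_cast
    rw [show 0 + k + 1 = 0 + (k + 1) by ring]
    ring

theorem fSeq_eq_ibpTerm {U : Set ℝ} (hU : IsOpen U) (hF : ContDiffOn ℝ ∞ amp U) {a b θ : ℝ}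
    (hθ : θ ∈ U) (h0 : dpsi a b θ ≠ 0) (k : ℕ) : fSeq a b k θ = ibpTerm amp a b k θ := by
  induction k generalizing θ with
  | zero => simp [fSeq, ibpTerm_zero]
  | succ k ih =>
    have hev : (fun x => fSeq a b k x / dpsi a b x) =ᶠ[𝓝 θ]
        fun x => ibpTerm amp a b k x / dpsi a b x := by
      filter_upwards [hU.mem_nhds hθ, (contDiff_dpsi a b).continuous.continuousAt.eventually_ne h0]
        with x hx hx0
      rw [ih hx hx0]
    simp only [fSeq]
    rw [hev.deriv_eq, (hasDerivAt_ibpTerm_div hU hF hθ h0 k).deriv, neg_neg]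

theorem continuousOn_ibpTerm {F : ℝ → ℝ} {U : Set ℝ} (hU : IsOpen U)
    (hF : ContDiffOn ℝ ∞ F U) {a b : ℝ} {s : Set ℝ} (hs : s ⊆ U)
    (h0 : ∀ θ ∈ s, dpsi a b θ ≠ 0) (k : ℕ) : ContinuousOn (ibpTerm F a b k) s := by
  refine continuousOn_finsetSum _ fun m _ => ?_
  refine ContinuousOn.div (ContinuousOn.mul ?_ continuousOn_const) ?_
    fun θ hθ => pow_ne_zero _ (h0 θ hθ)
  · exact Complex.continuous_ofReal.comp_continuousOn
      ((contDiffOn_ibpCoeff hU hF k m).continuousOn.mono hs)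
  · exact ((contDiff_dpsi a b).continuous.pow _).continuousOn

/-- `n` integrations by parts of `∫ F e^ψ` over `[0, c]`. -/
theorem integral_mul_exp_psi {F : ℝ → ℝ} {U : Set ℝ} (hU : IsOpen U)
    (hF : ContDiffOn ℝ ∞ F U) {a b c : ℝ} (hc : 0 ≤ c) (hcπ : c ≤ Real.pi) (hs : Icc 0 c ⊆ U)
    (h0 : ∀ θ ∈ Icc 0 c, dpsi a b θ ≠ 0) (n : ℕ) :
    ∫ θ in (0 : ℝ)..c, (F θ : ℂ) * Complex.exp (psi a b θ) =
      ∑ j ∈ Finset.range n, (ibpTerm F a b j c / dpsi a b c * Complex.exp (psi a b c)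
        - ibpTerm F a b j 0 / dpsi a b 0) +
      ∫ θ in (0 : ℝ)..c, ibpTerm F a b n θ * Complex.exp (psi a b θ) := by
  have hcont : ∀ n, ContinuousOn (fun θ => ibpTerm F a b n θ * Complex.exp (psi a b θ)) (Icc 0 c) :=
    fun n => (continuousOn_ibpTerm hU hF hs h0 n).mul
      (Complex.continuous_exp.comp (continuous_psi a b)).continuousOn
  have hint : ∀ n, IntervalIntegrable (fun θ => ibpTerm F a b n θ * Complex.exp (psi a b θ))
      MeasureTheory.volume 0 c := fun n => (hcont n).intervalIntegrable_of_Icc hc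
  induction n with
  | zero => simp [ibpTerm_zero]
  | succ n ih =>
    rw [ih, Finset.sum_range_succ, add_assoc, add_right_inj]
    have hder : ∀ θ ∈ Ioo 0 c, HasDerivAt
        (fun x => ibpTerm F a b n x / dpsi a b x * Complex.exp (psi a b x))
        (ibpTerm F a b n θ * Complex.exp (psi a b θ)
          - ibpTerm F a b (n + 1) θ * Complex.exp (psi a b θ)) θ := by
      intro θ hθ
      have hθ' : θ ∈ Icc 0 c := Ioo_subset_Icc_self hθ
      have h1 := (hasDerivAt_ibpTerm_div hU hF (hs hθ') (h0 θ hθ') n).mul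
        (hasDerivAt_psi a b hθ.1 (hθ.2.trans_le hcπ)).cexp
      refine h1.congr_deriv ?_
      have := h0 θ hθ'
      field_simp
      ring
    have hcb : ContinuousOn (fun x => ibpTerm F a b n x / dpsi a b x * Complex.exp (psi a b x))
        (Icc 0 c) :=
      ((continuousOn_ibpTerm hU hF hs h0 n).div (contDiff_dpsi a b).continuous.continuousOn h0).mul
        (Complex.continuous_exp.comp (continuous_psi a b)).continuousOn
    have h2 := intervalIntegral.integral_eq_sub_of_hasDerivAt_of_le hc hcb hder
      ((hint n).sub (hint (n + 1)))
    rw [intervalIntegral.integral_sub (hint n) (hint (n + 1)), psi_zero, Complex.exp_zero,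
      mul_one] at h2
    rw [← h2]; ring

/-- Where `|ψ'|` is comparable to `a + b`, the `k`-th term is of order `(a + b)^{-k}`. -/
theorem exists_norm_ibpTerm_le {F : ℝ → ℝ} {U : Set ℝ} (hU : IsOpen U)
    (hF : ContDiffOn ℝ ∞ F U) (hs : Icc 0 Real.pi ⊆ U) (k : ℕ) {c : ℝ} (hc : 0 < c) :
    ∃ C, 0 ≤ C ∧ ∀ a b θ : ℝ, 0 < a → 0 ≤ b → θ ∈ Icc 0 Real.pi → c * (a + b) ≤ ‖dpsi a b θ‖ →
      ‖ibpTerm F a b k θ‖ ≤ C / (a + b) ^ k := by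
  have hA : ∀ m, ∃ C, ∀ θ ∈ Icc 0 Real.pi, ‖ibpCoeff F k m θ‖ ≤ C := fun m =>
    isCompact_Icc.exists_bound_of_continuousOn
      ((contDiffOn_ibpCoeff hU hF k m).continuousOn.mono hs)
  choose B hB using hA
  have hB0 : ∀ m, 0 ≤ B m := fun m =>
    (norm_nonneg _).trans (hB m 0 ⟨le_rfl, Real.pi_pos.le⟩)
  refine ⟨∑ m ∈ Finset.range (k + 1), B m / c ^ (m + k),
    Finset.sum_nonneg fun m _ => div_nonneg (hB0 m) (by positivity), ?_⟩
  intro a b θ ha hb hθ h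
  have hab : 0 < a + b := by linarith
  rw [ibpTerm, Finset.sum_div]
  refine (norm_sum_le _ _).trans (Finset.sum_le_sum fun m _ => ?_)
  rw [norm_div, norm_mul, norm_pow, norm_pow, Complex.norm_real, Complex.norm_real,
    Real.norm_of_nonneg ha.le, div_div]
  have h1 : c ^ (m + k) * (a + b) ^ (m + k) ≤ ‖dpsi a b θ‖ ^ (m + k) := by
    rw [← mul_pow]; exact pow_le_pow_left₀ (by positivity) h _
  calc ‖ibpCoeff F k m θ‖ * a ^ m / ‖dpsi a b θ‖ ^ (m + k)
      ≤ B m * (a + b) ^ m / (c ^ (m + k) * (a + b) ^ (m + k)) := by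
        refine div_le_div₀ (mul_nonneg (hB0 m) (by positivity)) ?_ (by positivity) h1
        exact mul_le_mul (hB m θ hθ) (pow_le_pow_left₀ ha.le (by linarith) _) (by positivity)
          (hB0 m)
    _ = B m / (c ^ (m + k) * (a + b) ^ k) := by
        rw [pow_add (a + b) m k]; field_simp

/-! ### The amplitude, the terms `d_k` and the remainders -/

theorem contDiff_sinc : ContDiff ℝ ∞ Real.sinc := by
  rw [contDiff_iff_contDiffAt]
  intro x
  rcases eq_or_ne x 0 with rfl | hx
  · obtain ⟨q, hq⟩ := (Real.analyticAt_sin (x := 0))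
    rw [Real.sinc_eq_dslope]
    exact (hq.has_fpower_series_dslope_fslope.analyticAt).contDiffAt
  · have h : Real.sinc =ᶠ[𝓝 x] fun y => Real.sin y / y := by
      filter_upwards [eventually_ne_nhds hx] with y hy using Real.sinc_of_ne_zero hy
    exact (Real.contDiff_sin.contDiffAt.div contDiffAt_id hx).congr_of_eventuallyEq h

theorem sinc_half_pos {θ : ℝ} (hθ : θ ∈ Ioo (-(2 * Real.pi)) (2 * Real.pi)) :
    0 < Real.sinc (θ / 2) := by
  rcases lt_trichotomy θ 0 with h | rfl | h
  · rw [← Real.sinc_neg, Real.sinc_of_ne_zero (by linarith)]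
    exact div_pos (Real.sin_pos_of_pos_of_lt_pi (by linarith) (by linarith [hθ.1])) (by linarith)
  · simp
  · rw [Real.sinc_of_ne_zero (by linarith)]
    exact div_pos (Real.sin_pos_of_pos_of_lt_pi (by linarith) (by linarith [hθ.2])) (by linarith)

theorem contDiffOn_amp : ContDiffOn ℝ ∞ amp (Ioo (-(2 * Real.pi)) (2 * Real.pi)) := by
  have h1 : ContDiff ℝ ∞ fun θ : ℝ => θ / 2 := contDiff_id.div_const 2
  exact (Real.contDiff_cos.comp h1).contDiffOn.div (contDiff_sinc.comp h1).contDiffOn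
    fun θ hθ => (sinc_half_pos hθ).ne'

theorem amp_neg (θ : ℝ) : amp (-θ) = amp θ := by simp [amp, neg_div, Real.sinc_neg]

theorem Icc_zero_pi_subset : Icc 0 Real.pi ⊆ Ioo (-(2 * Real.pi)) (2 * Real.pi) := fun θ hθ =>
  ⟨by linarith [hθ.1, Real.pi_pos], by linarith [hθ.2, Real.pi_pos]⟩

theorem zero_mem_Ioo_two_pi : (0 : ℝ) ∈ Ioo (-(2 * Real.pi)) (2 * Real.pi) :=
  Icc_zero_pi_subset ⟨le_rfl, Real.pi_pos.le⟩

theorem dpsi_zero (a b : ℝ) : dpsi a b 0 = Complex.I * b - a := by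
  rw [dpsi_eq, phaseSlope_zero]; simp

theorem dpsi_zero_ne {a : ℝ} (ha : 0 < a) (b : ℝ) : dpsi a b 0 ≠ 0 := by
  intro h
  have := congrArg Complex.re h
  rw [dpsi_re, phaseSlope_zero] at this
  simp at this
  exact ha.ne' this

theorem fSeq_zero_eq {a : ℝ} (ha : 0 < a) (b : ℝ) (k : ℕ) :
    fSeq a b k 0 = ibpTerm amp a b k 0 :=
  fSeq_eq_ibpTerm isOpen_Ioo contDiffOn_amp zero_mem_Ioo_two_pi (dpsi_zero_ne ha b) k

theorem d_eq_neg_ibpTerm {a : ℝ} (ha : 0 < a) (b : ℝ) (k : ℕ) :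
    d k a b = -(ibpTerm amp a b k 0 / dpsi a b 0) := by
  rw [d, fSeq_zero_eq ha, neg_div]

theorem d_eq_sum {a : ℝ} (ha : 0 < a) (b : ℝ) (k : ℕ) :
    d k a b = -∑ m ∈ Finset.range (k + 1),
      (ibpCoeff amp k m 0 : ℂ) * (a : ℂ) ^ m / (Complex.I * b - a) ^ (m + k + 1) := by
  rw [d_eq_neg_ibpTerm ha, ibpTerm, Finset.sum_div]
  refine congrArg _ (Finset.sum_congr rfl fun m _ => ?_)
  rw [div_div, ← pow_succ, dpsi_zero]

theorem ibpCoeff_amp_odd_zero (k m : ℕ) : ibpCoeff amp (2 * k + 1) m 0 = 0 := by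
  have h := ibpCoeff_neg amp_neg (2 * k + 1) m 0
  rw [neg_zero, pow_succ, pow_mul] at h
  norm_num at h
  linarith

/-- The amplitude is even, so every odd number of integrations by parts gives an odd function. -/
theorem d_odd {a : ℝ} (ha : 0 < a) (b : ℝ) (k : ℕ) : d (2 * k + 1) a b = 0 := by
  rw [d_eq_sum ha]
  simp [ibpCoeff_amp_odd_zero]

theorem sum_d_two_mul {a : ℝ} (ha : 0 < a) (b : ℝ) (n : ℕ) :
    ∑ j ∈ Finset.range (2 * n), d j a b = ∑ j ∈ Finset.range n, d (2 * j) a b := by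
  induction n with
  | zero => simp
  | succ n ih =>
    rw [show 2 * (n + 1) = 2 * n + 1 + 1 by ring, Finset.sum_range_succ, Finset.sum_range_succ,
      d_odd ha, add_zero, ih, Finset.sum_range_succ]

/-- Away from `θ = π` the two parts of `ψ'` together control `a + b`. -/
theorem exists_le_norm_dpsi {θ₁ : ℝ} (h : θ₁ < Real.pi) : ∃ c, 0 < c ∧ ∀ a b θ : ℝ, 0 < a →
    0 ≤ b → 0 ≤ θ → θ ≤ θ₁ → c * (a + b) ≤ ‖dpsi a b θ‖ := by
  rcases lt_or_ge θ₁ 0 with h0 | h0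
  · exact ⟨1, one_pos, fun a b θ _ _ h1 h2 => absurd (h1.trans h2) (not_le.2 h0)⟩
  have hc : 0 < Real.cos (θ₁ / 2) :=
    Real.cos_pos_of_mem_Ioo ⟨by linarith [Real.pi_pos], by linarith⟩
  have hc1 := Real.cos_le_one (θ₁ / 2)
  refine ⟨Real.cos (θ₁ / 2) / 4, by positivity, fun a b θ ha hb hθ hθ₁ => ?_⟩
  have h1 := le_norm_dpsi a b θ
  have h2 := mul_phaseSlope_le_norm_dpsi a b θ
  have h3 := half_cos_le_phaseSlope hθ (hθ₁.trans h.le)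
  have h4 : Real.cos (θ₁ / 2) ≤ Real.cos (θ / 2) :=
    Real.cos_le_cos_of_nonneg_of_le_pi (by linarith) (by linarith [Real.pi_pos]) (by linarith)
  have h5 : a * (Real.cos (θ₁ / 2) / 2) ≤ a * phaseSlope θ :=
    mul_le_mul_of_nonneg_left (by linarith) ha.le
  nlinarith [mul_le_mul_of_nonneg_right hc1 hb]

theorem dpsi_ne_zero_of_le {a b θ c : ℝ} (hc : 0 < c) (ha : 0 < a) (hb : 0 ≤ b)
    (h : c * (a + b) ≤ ‖dpsi a b θ‖) : dpsi a b θ ≠ 0 := by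
  intro h0
  rw [h0, norm_zero] at h
  nlinarith [mul_pos hc ha, mul_nonneg hc.le hb]

theorem exists_norm_d_le (k : ℕ) : ∃ C, 0 ≤ C ∧ ∀ a b : ℝ, 0 < a → 0 ≤ b →
    ‖d k a b‖ ≤ C / (a + b) ^ (k + 1) := by
  obtain ⟨c, hc, h⟩ := exists_le_norm_dpsi Real.pi_pos
  obtain ⟨C, hC0, hC⟩ := exists_norm_ibpTerm_le isOpen_Ioo contDiffOn_amp Icc_zero_pi_subset k hc
  refine ⟨C / c, by positivity, fun a b ha hb => ?_⟩
  have h1 := h a b 0 ha hb le_rfl le_rfl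
  have hab : 0 < a + b := by linarith
  rw [d_eq_neg_ibpTerm ha, norm_neg, norm_div]
  refine (div_le_div₀ (by positivity) (hC a b 0 ha hb ⟨le_rfl, Real.pi_pos.le⟩ h1)
    (by positivity) h1).trans (le_of_eq ?_)
  rw [pow_succ]; field_simp

theorem exists_norm_d_two_mul_le (k : ℕ) : ∃ C : ℝ, ∀ a lam : ℝ, 1 ≤ a → 0 ≤ lam →
    ‖d (2 * k) a (lam * a)‖ ≤ C / a ^ (2 * k) := by
  obtain ⟨C, hC0, hC⟩ := exists_norm_d_le (2 * k)
  refine ⟨C, fun a lam ha hl => ?_⟩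
  have h0 : 0 ≤ lam * a := by positivity
  refine (hC a (lam * a) (by linarith) h0).trans ?_
  refine div_le_div_of_nonneg_left hC0 (by positivity) ?_
  calc a ^ (2 * k) ≤ a ^ (2 * k + 1) := pow_le_pow_right₀ ha (by omega)
    _ ≤ (a + lam * a) ^ (2 * k + 1) := pow_le_pow_left₀ (by linarith) (by linarith) _

theorem exists_norm_fSeq_le_of_le_norm_dpsi (k : ℕ) {c : ℝ} (hc : 0 < c) :
    ∃ C, 0 ≤ C ∧ ∀ a b θ : ℝ, 0 < a → 0 ≤ b → θ ∈ Icc 0 Real.pi → c * (a + b) ≤ ‖dpsi a b θ‖ →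
      ‖fSeq a b k θ‖ ≤ C / a ^ k := by
  obtain ⟨C, hC0, hC⟩ := exists_norm_ibpTerm_le isOpen_Ioo contDiffOn_amp Icc_zero_pi_subset k hc
  refine ⟨C, hC0, fun a b θ ha hb hθ h => ?_⟩
  rw [fSeq_eq_ibpTerm isOpen_Ioo contDiffOn_amp (Icc_zero_pi_subset hθ)
    (dpsi_ne_zero_of_le hc ha hb h)]
  exact (hC a b θ ha hb hθ h).trans
    (div_le_div_of_nonneg_left hC0 (by positivity) (pow_le_pow_left₀ ha.le (by linarith) _))

theorem exists_norm_fSeq_le (k : ℕ) (δ : ℝ) (hδ : 0 < δ) : ∃ C : ℝ, ∀ a lam θ : ℝ, 1 ≤ a →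
    0 ≤ lam → 0 ≤ θ → θ ≤ Real.pi → (θ ≤ Real.pi - δ ∨ δ ≤ lam) →
      ‖fSeq a (lam * a) (2 * k) θ‖ ≤ C / a ^ (2 * k) := by
  obtain ⟨c₁, hc₁, h₁⟩ := exists_le_norm_dpsi (θ₁ := Real.pi - δ) (by linarith)
  obtain ⟨C₁, _, hC₁⟩ := exists_norm_fSeq_le_of_le_norm_dpsi (2 * k) hc₁
  obtain ⟨C₂, _, hC₂⟩ := exists_norm_fSeq_le_of_le_norm_dpsi (2 * k)
    (c := δ / (1 + δ)) (by positivity)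
  refine ⟨max C₁ C₂, fun a lam θ ha hl hθ hθπ h => ?_⟩
  have ha0 : 0 < a := by linarith
  have hb : 0 ≤ lam * a := by positivity
  rcases h with h | h
  · exact (hC₁ a _ θ ha0 hb ⟨hθ, hθπ⟩ (h₁ a _ θ ha0 hb hθ h)).trans
      (div_le_div_of_nonneg_right (le_max_left _ _) (by positivity))
  -- for `b ≥ δ a` the imaginary part `b` of `ψ'` is comparable to `a + b`, even near `π`
  · refine (hC₂ a _ θ ha0 hb ⟨hθ, hθπ⟩ (le_trans ?_ (le_norm_dpsi a (lam * a) θ))).trans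
      (div_le_div_of_nonneg_right (le_max_right _ _) (by positivity))
    rw [div_mul_eq_mul_div, div_le_iff₀ (by positivity)]
    nlinarith [mul_le_mul_of_nonneg_right h ha0.le]

theorem continuousOn_amp : ContinuousOn amp (Icc 0 Real.pi) :=
  contDiffOn_amp.continuousOn.mono Icc_zero_pi_subset

theorem continuousOn_mul_exp_psi {F : ℝ → ℝ} (hF : ContinuousOn F (Icc 0 Real.pi)) (a b : ℝ) :
    ContinuousOn (fun θ => (F θ : ℂ) * Complex.exp (psi a b θ)) (Icc 0 Real.pi) :=
  (Complex.continuous_ofReal.comp_continuousOn hF).mul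
    (Complex.continuous_exp.comp (continuous_psi a b)).continuousOn

/-- The boundary terms at `θ₀` of the integrations by parts over `[0, θ₀]`, and the integral over
`[θ₀, π]`, are both bounded by multiples of `|e^{ψ(θ₀)}|`. -/
theorem exists_norm_Q_sub_le (k : ℕ) (θ₀ : ℝ) (h0 : 0 < θ₀) (hπ : θ₀ < Real.pi) :
    ∃ C : ℝ, ∀ a lam : ℝ, 1 ≤ a → 0 ≤ lam →
      ‖Q a (lam * a) - ((∑ j ∈ Finset.range k, d (2 * j) a (lam * a)) +
            ∫ θ in (0 : ℝ)..θ₀, fSeq a (lam * a) (2 * k) θ * Complex.exp (psi a (lam * a) θ))‖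
        ≤ C * Real.exp (-a * Real.log (w θ₀)) := by
  obtain ⟨c, hc, hψ⟩ := exists_le_norm_dpsi hπ
  choose B hB0 hB using fun j =>
    exists_norm_ibpTerm_le isOpen_Ioo contDiffOn_amp Icc_zero_pi_subset j hc
  obtain ⟨M, hM⟩ := isCompact_Icc.exists_bound_of_continuousOn continuousOn_amp
  refine ⟨∑ j ∈ Finset.range (2 * k), B j / c + M * |Real.pi - θ₀|, fun a lam ha hl => ?_⟩
  have ha0 : 0 < a := by linarith
  have hb : 0 ≤ lam * a := by positivity
  set b := lam * a
  have hne : ∀ θ ∈ Icc 0 θ₀, dpsi a b θ ≠ 0 := fun θ hθ =>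
    dpsi_ne_zero_of_le hc ha0 hb (hψ a b θ ha0 hb hθ.1 hθ.2)
  have hsub : Icc 0 θ₀ ⊆ Ioo (-(2 * Real.pi)) (2 * Real.pi) := fun θ hθ =>
    Icc_zero_pi_subset ⟨hθ.1, hθ.2.trans hπ.le⟩
  have hsplit : Q a b = (∫ θ in (0 : ℝ)..θ₀, (amp θ : ℂ) * Complex.exp (psi a b θ))
      + ∫ θ in θ₀..Real.pi, (amp θ : ℂ) * Complex.exp (psi a b θ) := by
    have hc := continuousOn_mul_exp_psi continuousOn_amp a b
    refine (intervalIntegral.integral_add_adjacent_intervals ?_ ?_).symm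
    · exact (hc.mono (Icc_subset_Icc_right hπ.le)).intervalIntegrable_of_Icc h0.le
    · exact (hc.mono (Icc_subset_Icc_left h0.le)).intervalIntegrable_of_Icc hπ.le
  have hrem : ∫ θ in (0 : ℝ)..θ₀, fSeq a b (2 * k) θ * Complex.exp (psi a b θ)
      = ∫ θ in (0 : ℝ)..θ₀, ibpTerm amp a b (2 * k) θ * Complex.exp (psi a b θ) := by
    refine intervalIntegral.integral_congr fun θ hθ => ?_
    rw [uIcc_of_le h0.le] at hθ
    rw [fSeq_eq_ibpTerm isOpen_Ioo contDiffOn_amp (hsub hθ) (hne θ hθ)]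
  have hd : ∑ j ∈ Finset.range k, d (2 * j) a b
      = -∑ j ∈ Finset.range (2 * k), ibpTerm amp a b j 0 / dpsi a b 0 := by
    rw [← sum_d_two_mul ha0, ← Finset.sum_neg_distrib]
    exact Finset.sum_congr rfl fun j _ => d_eq_neg_ibpTerm ha0 b j
  have hkey : Q a b - ((∑ j ∈ Finset.range k, d (2 * j) a b) +
      ∫ θ in (0 : ℝ)..θ₀, fSeq a b (2 * k) θ * Complex.exp (psi a b θ))
      = (∑ j ∈ Finset.range (2 * k), ibpTerm amp a b j θ₀ / dpsi a b θ₀ * Complex.exp (psi a b θ₀))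
        + ∫ θ in θ₀..Real.pi, (amp θ : ℂ) * Complex.exp (psi a b θ) := by
    rw [hsplit, hrem, hd, integral_mul_exp_psi isOpen_Ioo contDiffOn_amp h0.le hπ.le hsub hne
      (2 * k), Finset.sum_sub_distrib]
    ring
  rw [hkey, add_mul, Finset.sum_mul]
  refine (norm_add_le _ _).trans (add_le_add ?_ ?_)
  · refine (norm_sum_le _ _).trans (Finset.sum_le_sum fun j _ => ?_)
    rw [norm_mul, norm_exp_psi, norm_div]
    refine mul_le_mul_of_nonneg_right ?_ (Real.exp_pos _).le
    have h1 := hψ a b θ₀ ha0 hb h0.le le_rfl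
    have hab : 1 ≤ a + b := by linarith
    refine div_le_div₀ (hB0 j) ?_ hc (le_trans (by nlinarith) h1)
    exact (hB j a b θ₀ ha0 hb ⟨h0.le, hπ.le⟩ h1).trans
      (div_le_self (hB0 j) (one_le_pow₀ hab))
  · have h2 := intervalIntegral.norm_integral_le_of_norm_le_const (a := θ₀) (b := Real.pi)
      (f := fun θ => (amp θ : ℂ) * Complex.exp (psi a b θ))
      (C := M * Real.exp (-a * Real.log (w θ₀))) fun θ hθ => by
        rw [uIoc_of_le hπ.le] at hθ
        have hθ' : θ ∈ Icc 0 Real.pi := ⟨by linarith [hθ.1], hθ.2⟩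
        rw [norm_mul, norm_exp_psi, Complex.norm_real]
        exact mul_le_mul (hM θ hθ') (exp_neg_mul_log_w_le ha0.le h0.le hθ.1.le hθ.2)
          (Real.exp_pos _).le ((norm_nonneg _).trans (hM θ hθ'))
    refine h2.trans (le_of_eq (by ring))

/-! ### Taylor series at `0` of the coefficients -/

/-- The formal Taylor series of `F` at `0`. -/
def taylorGerm (F : ℝ → ℝ) : PowerSeries ℝ :=
  PowerSeries.mk fun n => iteratedDeriv n F 0 / n.factorial

theorem coeff_taylorGerm (F : ℝ → ℝ) (n : ℕ) :
    PowerSeries.coeff n (taylorGerm F) = iteratedDeriv n F 0 / n.factorial := by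
  simp [taylorGerm]

theorem coeff_zero_taylorGerm (F : ℝ → ℝ) : PowerSeries.coeff 0 (taylorGerm F) = F 0 := by
  simp [coeff_taylorGerm]

theorem taylorGerm_congr {F G : ℝ → ℝ} (h : F =ᶠ[𝓝 0] G) : taylorGerm F = taylorGerm G := by
  ext n
  rw [coeff_taylorGerm, coeff_taylorGerm, h.iteratedDeriv_eq]

theorem taylorGerm_neg (F : ℝ → ℝ) : taylorGerm (fun x => -F x) = -taylorGerm F := by
  ext n
  rw [map_neg, coeff_taylorGerm, coeff_taylorGerm, iteratedDeriv_fun_neg, neg_div]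

theorem taylorGerm_const_mul (c : ℝ) (F : ℝ → ℝ) :
    taylorGerm (fun x => c * F x) = PowerSeries.C c * taylorGerm F := by
  ext n
  rw [PowerSeries.coeff_C_mul, coeff_taylorGerm, coeff_taylorGerm, iteratedDeriv_const_mul_field,
    mul_div_assoc]

theorem taylorGerm_const (c : ℝ) : taylorGerm (fun _ => c) = PowerSeries.C c := by
  ext n
  rw [coeff_taylorGerm, iteratedDeriv_const, PowerSeries.coeff_C]
  split_ifs with h <;> simp [h]

theorem taylorGerm_sub {F G : ℝ → ℝ} (hF : ContDiffAt ℝ ∞ F 0) (hG : ContDiffAt ℝ ∞ G 0) :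
    taylorGerm (fun x => F x - G x) = taylorGerm F - taylorGerm G := by
  ext n
  rw [map_sub, coeff_taylorGerm, coeff_taylorGerm, coeff_taylorGerm,
    iteratedDeriv_fun_sub (hF.of_le (by exact_mod_cast le_top))
      (hG.of_le (by exact_mod_cast le_top)), sub_div]

theorem taylorGerm_mul {F G : ℝ → ℝ} (hF : ContDiffAt ℝ ∞ F 0) (hG : ContDiffAt ℝ ∞ G 0) :
    taylorGerm (fun x => F x * G x) = taylorGerm F * taylorGerm G := by
  ext n
  rw [PowerSeries.coeff_mul, coeff_taylorGerm,
    iteratedDeriv_fun_mul (hF.of_le (by exact_mod_cast le_top))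
      (hG.of_le (by exact_mod_cast le_top)),
    Finset.Nat.sum_antidiagonal_eq_sum_range_succ_mk, Finset.sum_div]
  refine Finset.sum_congr rfl fun i hi => ?_
  have hi' : i ≤ n := Nat.lt_succ_iff.1 (Finset.mem_range.1 hi)
  rw [coeff_taylorGerm, coeff_taylorGerm, Nat.cast_choose ℝ hi']
  have h1 : (i.factorial : ℝ) ≠ 0 := by positivity
  have h2 : ((n - i).factorial : ℝ) ≠ 0 := by positivity
  have h3 : (n.factorial : ℝ) ≠ 0 := by positivity
  field_simp

theorem taylorGerm_deriv (F : ℝ → ℝ) :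
    taylorGerm (deriv F) = PowerSeries.derivative ℝ (taylorGerm F) := by
  ext n
  rw [PowerSeries.coeff_derivative, coeff_taylorGerm, coeff_taylorGerm, iteratedDeriv_succ',
    Nat.factorial_succ]
  have h3 : (n.factorial : ℝ) ≠ 0 := by positivity
  push_cast
  field_simp

theorem taylorGerm_comp_half {F : ℝ → ℝ} (hF : ContDiff ℝ ∞ F) (n : ℕ) :
    PowerSeries.coeff n (taylorGerm fun θ => F (θ / 2)) =
      (1 / 2) ^ n * PowerSeries.coeff n (taylorGerm F) := by
  have h := iteratedDeriv_comp_const_mul (n := n) (hF.of_le (by exact_mod_cast le_top)) (1 / 2)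
  have h' : (fun θ : ℝ => F (θ / 2)) = fun θ => F (1 / 2 * θ) := by
    funext θ; congr 1; ring
  rw [coeff_taylorGerm, coeff_taylorGerm, h', h]
  simp [mul_div_assoc]

theorem contDiffAt_ibpCoeff_amp (k m : ℕ) : ContDiffAt ℝ ∞ (ibpCoeff amp k m) 0 :=
  (contDiffOn_ibpCoeff isOpen_Ioo contDiffOn_amp k m).contDiffAt
    (isOpen_Ioo.mem_nhds zero_mem_Ioo_two_pi)

theorem contDiffAt_deriv {F : ℝ → ℝ} (hF : ContDiffOn ℝ ∞ F (Ioo (-(2 * Real.pi)) (2 * Real.pi))) :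
    ContDiffAt ℝ ∞ (deriv F) 0 :=
  (hF.deriv_of_isOpen isOpen_Ioo (by simp)).contDiffAt (isOpen_Ioo.mem_nhds zero_mem_Ioo_two_pi)

theorem taylorGerm_ibpCoeff_succ_zero (k : ℕ) : taylorGerm (ibpCoeff amp (k + 1) 0) =
    -PowerSeries.derivative ℝ (taylorGerm (ibpCoeff amp k 0)) := by
  rw [← taylorGerm_deriv, ← taylorGerm_neg]; rfl

theorem taylorGerm_ibpCoeff_succ_succ (k m : ℕ) : taylorGerm (ibpCoeff amp (k + 1) (m + 1)) =
    -PowerSeries.derivative ℝ (taylorGerm (ibpCoeff amp k (m + 1)))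
      - PowerSeries.C (m + 1 + k : ℝ) * (PowerSeries.derivative ℝ (taylorGerm phaseSlope)
        * taylorGerm (ibpCoeff amp k m)) := by
  have h1 : ContDiffAt ℝ ∞ (deriv phaseSlope) 0 := contDiffAt_deriv contDiff_phaseSlope.contDiffOn
  have h2 := contDiffAt_ibpCoeff_amp k m
  have h3 : ContDiffAt ℝ ∞ (deriv (ibpCoeff amp k (m + 1))) 0 :=
    contDiffAt_deriv (contDiffOn_ibpCoeff isOpen_Ioo contDiffOn_amp k (m + 1))
  rw [← taylorGerm_deriv, ← taylorGerm_deriv, ← taylorGerm_neg, ← taylorGerm_mul h1 h2,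
    ← taylorGerm_const_mul, ← taylorGerm_sub h3.neg (contDiffAt_const.mul (h1.mul h2))]
  congr 1
  funext θ
  simp only [ibpCoeff]
  ring

/-- Each factor `phaseSlope'` vanishes at `0`, each derivative lowers the order of vanishing by
one: the coefficient of `a ^ m` vanishes at `0` at least to the order `2 * m - k`. -/
theorem coeff_taylorGerm_ibpCoeff_eq_zero (k m i : ℕ) (h : i + k < 2 * m) :
    PowerSeries.coeff i (taylorGerm (ibpCoeff amp k m)) = 0 := by
  have hd : deriv phaseSlope 0 = 0 := by
    have := deriv_phaseSlope_neg 0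
    rw [neg_zero] at this
    linarith
  induction k generalizing m i with
  | zero =>
    rw [ibpCoeff_eq_zero amp (by omega : 0 < m)]
    simp [coeff_taylorGerm, Pi.zero_def]
  | succ k ih =>
    obtain ⟨m, rfl⟩ : ∃ n, m = n + 1 := ⟨m - 1, by omega⟩
    rw [taylorGerm_ibpCoeff_succ_succ, map_sub, map_neg, PowerSeries.coeff_derivative,
      PowerSeries.coeff_C_mul, ih (m + 1) (i + 1) (by omega), PowerSeries.coeff_mul,
      Finset.sum_eq_zero]
    · simp
    · rintro ⟨p, q⟩ hpq
      have hpq' : p + q = i := Finset.HasAntidiagonal.mem_antidiagonal.1 hpq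
      rcases Nat.eq_zero_or_pos p with rfl | hp
      · simp only
        rw [← taylorGerm_deriv, coeff_zero_taylorGerm, hd, zero_mul]
      · simp only
        rw [ih m q (by omega), mul_zero]

theorem ibpCoeff_two_mul_zero {k m : ℕ} (h : k < m) : ibpCoeff amp (2 * k) m 0 = 0 := by
  rw [← coeff_zero_taylorGerm (ibpCoeff amp (2 * k) m)]
  exact coeff_taylorGerm_ibpCoeff_eq_zero _ _ _ (by omega)

/-! ### Rationality of the Taylor coefficients -/

/-- The real power series with rational coefficients. -/
def ratSeries : Subring (PowerSeries ℝ) := (PowerSeries.map (algebraMap ℚ ℝ)).range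

theorem mem_ratSeries {φ : PowerSeries ℝ} :
    φ ∈ ratSeries ↔ ∀ n, ∃ q : ℚ, PowerSeries.coeff n φ = q := by
  constructor
  · rintro ⟨ψ, rfl⟩ n
    exact ⟨PowerSeries.coeff n ψ, by simp⟩
  · intro h
    choose q hq using h
    exact ⟨PowerSeries.mk q, by ext n; simp [hq]⟩

theorem derivative_mem_ratSeries {φ : PowerSeries ℝ} (h : φ ∈ ratSeries) :
    PowerSeries.derivative ℝ φ ∈ ratSeries := by
  rw [mem_ratSeries] at h ⊢
  intro n
  obtain ⟨q, hq⟩ := h (n + 1)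
  exact ⟨q * (n + 1), by rw [PowerSeries.coeff_derivative, hq]; push_cast; ring⟩

theorem C_mem_ratSeries (q : ℚ) : PowerSeries.C (q : ℝ) ∈ ratSeries :=
  ⟨PowerSeries.C q, by simp⟩

/-- A quotient of series with rational coefficients has rational coefficients. -/
theorem mem_ratSeries_of_mul {φ ψ : PowerSeries ℝ} (h : φ * ψ ∈ ratSeries) (hψ : ψ ∈ ratSeries)
    (h0 : PowerSeries.coeff 0 ψ ≠ 0) : φ ∈ ratSeries := by
  obtain ⟨ψ', rfl⟩ := hψ
  obtain ⟨χ, hχ⟩ := h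
  have h0' : PowerSeries.constantCoeff ψ' ≠ 0 := by
    intro h; apply h0; simp [h]
  refine ⟨χ * ψ'⁻¹, ?_⟩
  rw [map_mul, hχ, mul_assoc, ← map_mul, PowerSeries.mul_inv_cancel _ h0', map_one, mul_one]

/-- A square root of a series with rational coefficients has rational coefficients, if its
constant term is `1`: it solves the linear equation `2 φ² φ' = (φ²)' φ`. -/
theorem mem_ratSeries_of_sq {φ : PowerSeries ℝ} (h : φ * φ ∈ ratSeries)
    (h0 : PowerSeries.coeff 0 φ = 1) : φ ∈ ratSeries := by
  have h00 : PowerSeries.constantCoeff φ = 1 := by simpa using h0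
  set u := PowerSeries.derivative ℝ φ * φ⁻¹ with hu
  have hinv : φ * φ⁻¹ = 1 := PowerSeries.mul_inv_cancel φ (by rw [h00]; exact one_ne_zero)
  have hode : PowerSeries.derivative ℝ φ = u * φ := by
    rw [hu, mul_assoc, mul_comm φ⁻¹, hinv, mul_one]
  have hu_mem : u ∈ ratSeries := by
    refine mem_ratSeries_of_mul (ψ := 2 * (φ * φ)) ?_ (ratSeries.mul_mem (ofNat_mem _ 2) h) ?_
    · have : u * (2 * (φ * φ)) = PowerSeries.derivative ℝ (φ * φ) := by
        rw [Derivation.leibniz, hode, smul_eq_mul]; ring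
      rw [this]; exact derivative_mem_ratSeries h
    · rw [PowerSeries.coeff_zero_eq_constantCoeff_apply, map_mul, map_mul, h00,
        map_ofNat]
      norm_num
  rw [mem_ratSeries] at hu_mem ⊢
  intro n
  induction n using Nat.strong_induction_on with
  | _ n ih =>
    cases n with
    | zero => exact ⟨1, by simp [h00]⟩
    | succ n =>
      choose q hq using hu_mem
      have hr : ∀ m, ∃ r : ℚ, m < n + 1 → PowerSeries.coeff m φ = r := fun m => by
        by_cases hm : m < n + 1
        · obtain ⟨r, hr⟩ := ih m hm; exact ⟨r, fun _ => hr⟩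
        · exact ⟨0, fun h => absurd h hm⟩
      choose r hr using hr
      have h1 := congrArg (PowerSeries.coeff n) hode
      rw [PowerSeries.coeff_derivative, PowerSeries.coeff_mul] at h1
      refine ⟨(∑ x ∈ Finset.HasAntidiagonal.antidiagonal n, q x.1 * r x.2) / (n + 1), ?_⟩
      have h2 : ((n : ℝ) + 1) ≠ 0 := by positivity
      push_cast
      rw [eq_div_iff h2, h1]
      refine Finset.sum_congr rfl fun x hx => ?_
      have := Finset.HasAntidiagonal.mem_antidiagonal.1 hx
      rw [hq, hr x.2 (by omega)]

theorem coeff_taylorGerm_sin (n : ℕ) : PowerSeries.coeff (2 * n) (taylorGerm Real.sin) = 0 ∧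
    PowerSeries.coeff (2 * n + 1) (taylorGerm Real.sin) = (-1) ^ n / (2 * n + 1).factorial := by
  rw [coeff_taylorGerm, coeff_taylorGerm, Real.iteratedDeriv_even_sin, Real.iteratedDeriv_odd_sin]
  simp

theorem coeff_taylorGerm_cos (n : ℕ) :
    PowerSeries.coeff (2 * n) (taylorGerm Real.cos) = (-1) ^ n / (2 * n).factorial ∧
    PowerSeries.coeff (2 * n + 1) (taylorGerm Real.cos) = 0 := by
  rw [coeff_taylorGerm, coeff_taylorGerm, Real.iteratedDeriv_even_cos, Real.iteratedDeriv_odd_cos]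
  simp

theorem taylorGerm_sin_mem : taylorGerm Real.sin ∈ ratSeries := by
  rw [mem_ratSeries]
  intro n
  obtain ⟨k, rfl | rfl⟩ := Nat.even_or_odd' n
  · exact ⟨0, by rw [(coeff_taylorGerm_sin k).1]; simp⟩
  · exact ⟨(-1) ^ k / (2 * k + 1).factorial, by rw [(coeff_taylorGerm_sin k).2]; push_cast; rfl⟩

theorem taylorGerm_cos_mem : taylorGerm Real.cos ∈ ratSeries := by
  rw [mem_ratSeries]
  intro n
  obtain ⟨k, rfl | rfl⟩ := Nat.even_or_odd' n
  · exact ⟨(-1) ^ k / (2 * k).factorial, by rw [(coeff_taylorGerm_cos k).1]; push_cast; rfl⟩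
  · exact ⟨0, by rw [(coeff_taylorGerm_cos k).2]; simp⟩

theorem taylorGerm_comp_half_mem {F : ℝ → ℝ} (hF : ContDiff ℝ ∞ F) (h : taylorGerm F ∈ ratSeries) :
    taylorGerm (fun θ => F (θ / 2)) ∈ ratSeries := by
  rw [mem_ratSeries] at h ⊢
  intro n
  obtain ⟨q, hq⟩ := h n
  exact ⟨(1 / 2) ^ n * q, by rw [taylorGerm_comp_half hF, hq]; push_cast; ring⟩

theorem contDiff_half : ContDiff ℝ ∞ fun θ : ℝ => θ / 2 := contDiff_id.div_const 2

theorem contDiffAt_amp : ContDiffAt ℝ ∞ amp 0 := contDiffAt_ibpCoeff_amp 0 0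

theorem coeff_succ_taylorGerm_sin (n : ℕ) : PowerSeries.coeff (n + 1) (taylorGerm Real.sin) =
    PowerSeries.coeff n (taylorGerm Real.sinc) := by
  have h : (fun x : ℝ => x * Real.sinc x) = Real.sin := by
    funext x
    rcases eq_or_ne x 0 with rfl | hx
    · simp
    · rw [Real.sinc_of_ne_zero hx]; field_simp
  have hX : taylorGerm (fun x : ℝ => x) = PowerSeries.X := by
    ext n
    rw [coeff_taylorGerm, PowerSeries.coeff_X]
    rcases n with _ | _ | n
    · simp
    · simp [iteratedDeriv_succ']
    · simp [iteratedDeriv_succ', Function.const_def]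
  rw [← h, taylorGerm_mul (F := fun x : ℝ => x) contDiffAt_id contDiff_sinc.contDiffAt, hX,
    PowerSeries.coeff_succ_X_mul]

theorem taylorGerm_sinc_mem : taylorGerm Real.sinc ∈ ratSeries := by
  rw [mem_ratSeries]
  intro n
  obtain ⟨q, hq⟩ := mem_ratSeries.1 taylorGerm_sin_mem (n + 1)
  exact ⟨q, by rw [← coeff_succ_taylorGerm_sin, hq]⟩

theorem taylorGerm_amp_mul : taylorGerm amp * taylorGerm (fun θ => Real.sinc (θ / 2)) =
    taylorGerm (fun θ => Real.cos (θ / 2)) := by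
  rw [← taylorGerm_mul (G := fun θ => Real.sinc (θ / 2)) contDiffAt_amp
    (contDiff_sinc.comp contDiff_half).contDiffAt]
  refine taylorGerm_congr ?_
  filter_upwards [isOpen_Ioo.mem_nhds zero_mem_Ioo_two_pi] with θ hθ
  rw [amp, div_mul_cancel₀ _ (sinc_half_pos hθ).ne']

theorem taylorGerm_amp_mem : taylorGerm amp ∈ ratSeries := by
  refine mem_ratSeries_of_mul (ψ := taylorGerm (fun θ => Real.sinc (θ / 2))) ?_
    (taylorGerm_comp_half_mem contDiff_sinc taylorGerm_sinc_mem) ?_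
  · rw [taylorGerm_amp_mul]
    exact taylorGerm_comp_half_mem Real.contDiff_cos taylorGerm_cos_mem
  · rw [coeff_zero_taylorGerm]; simp

/-- `phaseSlope²` is the quotient of `cos² (θ/2) = (1 + cos θ)/2` and
`1 + sin² (θ/2) = (3 - cos θ)/2`. -/
theorem taylorGerm_phaseSlope_sq_mul : taylorGerm phaseSlope * taylorGerm phaseSlope *
    (PowerSeries.C 3 - taylorGerm Real.cos) = PowerSeries.C 1 + taylorGerm Real.cos := by
  have hg : ContDiffAt ℝ ∞ phaseSlope 0 := contDiff_phaseSlope.contDiffAt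
  have hc : ContDiffAt ℝ ∞ Real.cos 0 := Real.contDiff_cos.contDiffAt
  rw [← taylorGerm_mul hg hg, ← taylorGerm_const 3, ← taylorGerm_sub contDiffAt_const hc,
    ← taylorGerm_mul (hg.mul hg) (contDiffAt_const.sub hc), ← sub_neg_eq_add (PowerSeries.C 1),
    ← taylorGerm_neg, ← taylorGerm_const, ← taylorGerm_sub contDiffAt_const hc.neg]
  congr 1
  funext θ
  have h1 : Real.cos θ = 2 * Real.cos (θ / 2) ^ 2 - 1 := by
    rw [← Real.cos_two_mul]; congr 1; ring
  have h2 := Real.sin_sq_add_cos_sq (θ / 2)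
  have h3 : Real.sin (θ / 2) ^ 2 = 1 - Real.cos (θ / 2) ^ 2 := by linarith
  have h4 : 0 < 1 + Real.sin (θ / 2) ^ 2 := by positivity
  rw [phaseSlope, div_mul_div_comm, Real.mul_self_sqrt h4.le, h1, div_mul_eq_mul_div,
    div_eq_iff h4.ne', h3]
  ring

theorem taylorGerm_phaseSlope_mem : taylorGerm phaseSlope ∈ ratSeries := by
  have h3 : PowerSeries.C (3 : ℝ) ∈ ratSeries := by exact_mod_cast C_mem_ratSeries 3
  have h1 : PowerSeries.C (1 : ℝ) ∈ ratSeries := by exact_mod_cast C_mem_ratSeries 1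
  refine mem_ratSeries_of_sq (mem_ratSeries_of_mul
    (ψ := PowerSeries.C 3 - taylorGerm Real.cos) ?_
    (ratSeries.sub_mem h3 taylorGerm_cos_mem) ?_) ?_
  · rw [taylorGerm_phaseSlope_sq_mul]
    exact ratSeries.add_mem h1 taylorGerm_cos_mem
  · rw [map_sub, coeff_zero_taylorGerm]; simp; norm_num
  · rw [coeff_zero_taylorGerm, phaseSlope_zero]

theorem taylorGerm_ibpCoeff_mem (k m : ℕ) : taylorGerm (ibpCoeff amp k m) ∈ ratSeries := by
  induction k generalizing m with
  | zero => cases m with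
    | zero => exact taylorGerm_amp_mem
    | succ m =>
      rw [ibpCoeff_eq_zero amp (Nat.succ_pos m), Pi.zero_def, taylorGerm_const, map_zero]
      exact ratSeries.zero_mem
  | succ k ih => cases m with
    | zero =>
      rw [taylorGerm_ibpCoeff_succ_zero]
      exact ratSeries.neg_mem (derivative_mem_ratSeries (ih 0))
    | succ m =>
      rw [taylorGerm_ibpCoeff_succ_succ]
      refine ratSeries.sub_mem (ratSeries.neg_mem (derivative_mem_ratSeries (ih (m + 1))))
        (ratSeries.mul_mem ?_ (ratSeries.mul_mem
          (derivative_mem_ratSeries taylorGerm_phaseSlope_mem) (ih m)))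
      exact_mod_cast C_mem_ratSeries (m + 1 + k)

theorem exists_rat_ibpCoeff_zero (k m : ℕ) : ∃ q : ℚ, ibpCoeff amp k m 0 = q := by
  rw [← coeff_zero_taylorGerm (ibpCoeff amp k m)]
  exact mem_ratSeries.1 (taylorGerm_ibpCoeff_mem k m) 0

/-! ### The first coefficients -/

theorem coeff_mul_range (φ ψ : PowerSeries ℝ) (n : ℕ) : PowerSeries.coeff n (φ * ψ) =
    ∑ i ∈ Finset.range (n + 1), PowerSeries.coeff i φ * PowerSeries.coeff (n - i) ψ := by
  rw [PowerSeries.coeff_mul, Finset.Nat.sum_antidiagonal_eq_sum_range_succ_mk]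

theorem coeff_taylorGerm_phaseSlope :
    PowerSeries.coeff 0 (taylorGerm phaseSlope) = 1 ∧
    PowerSeries.coeff 1 (taylorGerm phaseSlope) = 0 ∧
    PowerSeries.coeff 2 (taylorGerm phaseSlope) = -1 / 4 ∧
    PowerSeries.coeff 3 (taylorGerm phaseSlope) = 0 ∧
    PowerSeries.coeff 4 (taylorGerm phaseSlope) = 5 / 96 ∧
    PowerSeries.coeff 5 (taylorGerm phaseSlope) = 0 ∧
    PowerSeries.coeff 6 (taylorGerm phaseSlope) = -79 / 5760 := by
  have k := coeff_taylorGerm_cos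
  obtain ⟨k0, k1⟩ := k 0
  obtain ⟨k2, k3⟩ := k 1
  obtain ⟨k4, k5⟩ := k 2
  obtain ⟨k6, k7⟩ := k 3
  simp only [mul_zero, zero_add, mul_one, Nat.reduceMul, Nat.reduceAdd] at k0 k1 k2 k3 k4 k5 k6
  have hc : ∀ (c : ℝ) (n : ℕ), PowerSeries.coeff n (PowerSeries.C c) = if n = 0 then c else 0 :=
    fun c n => PowerSeries.coeff_C n c
  have h := fun n => congrArg (PowerSeries.coeff n) taylorGerm_phaseSlope_sq_mul
  set H := taylorGerm phaseSlope * taylorGerm phaseSlope with hH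
  simp only [coeff_mul_range, map_add, map_sub, hc] at h
  have g0 : PowerSeries.coeff 0 (taylorGerm phaseSlope) = 1 := by
    rw [coeff_zero_taylorGerm, phaseSlope_zero]
  have e0 := h 0
  have e1 := h 1
  have e2 := h 2
  have e3 := h 3
  have e4 := h 4
  have e5 := h 5
  have e6 := h 6
  clear h
  norm_num [Finset.sum_range_succ, -PowerSeries.coeff_zero_eq_constantCoeff, k0, k1, k2, k3, k4,
    k5, k6, Nat.factorial] at e0 e1 e2 e3 e4 e5 e6
  have q1 : PowerSeries.coeff 1 H = 0 := by linarith
  have q2 : PowerSeries.coeff 2 H = -1 / 2 := by linarith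
  have q3 : PowerSeries.coeff 3 H = 0 := by linarith
  have q4 : PowerSeries.coeff 4 H = 1 / 6 := by linarith
  have q5 : PowerSeries.coeff 5 H = 0 := by linarith
  have q6 : PowerSeries.coeff 6 H = -77 / 1440 := by linarith
  rw [hH, coeff_mul_range] at q1 q2 q3 q4 q5 q6
  simp only [Finset.sum_range_succ, Finset.sum_range_zero, Nat.reduceSub, Nat.sub_zero, g0]
    at q1 q2 q3 q4 q5 q6
  have g1 : PowerSeries.coeff 1 (taylorGerm phaseSlope) = 0 := by linarith
  have g2 : PowerSeries.coeff 2 (taylorGerm phaseSlope) = -1 / 4 := by rw [g1] at q2; linarith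
  have g3 : PowerSeries.coeff 3 (taylorGerm phaseSlope) = 0 := by rw [g1] at q3; linarith
  have g4 : PowerSeries.coeff 4 (taylorGerm phaseSlope) = 5 / 96 := by
    rw [g1, g2] at q4; linarith
  have g5 : PowerSeries.coeff 5 (taylorGerm phaseSlope) = 0 := by rw [g1, g3] at q5; linarith
  have g6 : PowerSeries.coeff 6 (taylorGerm phaseSlope) = -79 / 5760 := by
    rw [g1, g2, g3, g4] at q6; linarith
  exact ⟨g0, g1, g2, g3, g4, g5, g6⟩

theorem coeff_taylorGerm_amp :
    PowerSeries.coeff 0 (taylorGerm amp) = 1 ∧ PowerSeries.coeff 1 (taylorGerm amp) = 0 ∧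
    PowerSeries.coeff 2 (taylorGerm amp) = -1 / 12 ∧ PowerSeries.coeff 3 (taylorGerm amp) = 0 ∧
    PowerSeries.coeff 4 (taylorGerm amp) = -1 / 720 ∧ PowerSeries.coeff 5 (taylorGerm amp) = 0 ∧
    PowerSeries.coeff 6 (taylorGerm amp) = -1 / 30240 := by
  have k := coeff_taylorGerm_cos
  obtain ⟨k0, k1⟩ := k 0
  obtain ⟨k2, k3⟩ := k 1
  obtain ⟨k4, k5⟩ := k 2
  obtain ⟨k6, k7⟩ := k 3
  have s := coeff_taylorGerm_sin
  obtain ⟨s0, s1⟩ := s 0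
  obtain ⟨s2, s3⟩ := s 1
  obtain ⟨s4, s5⟩ := s 2
  obtain ⟨s6, s7⟩ := s 3
  simp only [mul_zero, zero_add, mul_one, Nat.reduceMul, Nat.reduceAdd] at k0 k1 k2 k3 k4 k5 k6
  simp only [mul_zero, zero_add, mul_one, Nat.reduceMul, Nat.reduceAdd] at s1 s2 s3 s4 s5 s6 s7
  have h := fun n => congrArg (PowerSeries.coeff n) taylorGerm_amp_mul
  simp only [coeff_mul_range, taylorGerm_comp_half contDiff_sinc,
    taylorGerm_comp_half Real.contDiff_cos, ← coeff_succ_taylorGerm_sin] at h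
  have a0 : PowerSeries.coeff 0 (taylorGerm amp) = 1 := by
    rw [coeff_zero_taylorGerm, amp_zero]
  have e1 := h 1
  have e2 := h 2
  have e3 := h 3
  have e4 := h 4
  have e5 := h 5
  have e6 := h 6
  clear h
  norm_num [Finset.sum_range_succ, -PowerSeries.coeff_zero_eq_constantCoeff, k0, k1, k2, k3, k4,
    k5, k6, s1, s2, s3, s4, s5, s6, s7, a0, Nat.factorial] at e1 e2 e3 e4 e5 e6
  have a2 : PowerSeries.coeff 2 (taylorGerm amp) = -1 / 12 := by linarith
  have a3 : PowerSeries.coeff 3 (taylorGerm amp) = 0 := by rw [e1] at e3; linarith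
  have a4 : PowerSeries.coeff 4 (taylorGerm amp) = -1 / 720 := by linarith
  have a5 : PowerSeries.coeff 5 (taylorGerm amp) = 0 := by rw [e1, a3] at e5; linarith
  have a6 : PowerSeries.coeff 6 (taylorGerm amp) = -1 / 30240 := by linarith
  exact ⟨a0, e1, a2, a3, a4, a5, a6⟩

theorem coeff_taylorGerm_ibpCoeff_succ_zero (k i : ℕ) :
    PowerSeries.coeff i (taylorGerm (ibpCoeff amp (k + 1) 0)) =
      -(PowerSeries.coeff (i + 1) (taylorGerm (ibpCoeff amp k 0)) * (i + 1)) := by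
  rw [taylorGerm_ibpCoeff_succ_zero, map_neg, PowerSeries.coeff_derivative]

theorem coeff_taylorGerm_ibpCoeff_succ_succ (k m i : ℕ) :
    PowerSeries.coeff i (taylorGerm (ibpCoeff amp (k + 1) (m + 1))) =
      -(PowerSeries.coeff (i + 1) (taylorGerm (ibpCoeff amp k (m + 1))) * (i + 1))
      - (m + 1 + k) * ∑ j ∈ Finset.range (i + 1),
        PowerSeries.coeff (j + 1) (taylorGerm phaseSlope) * (j + 1)
          * PowerSeries.coeff (i - j) (taylorGerm (ibpCoeff amp k m)) := by
  rw [taylorGerm_ibpCoeff_succ_succ, map_sub, map_neg, PowerSeries.coeff_derivative,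
    PowerSeries.coeff_C_mul, coeff_mul_range]
  simp only [PowerSeries.coeff_derivative]

/-- The recursion for the Taylor coefficients, carried out up to the sixth integration by
parts. -/
theorem recursion_values {c : ℕ → ℕ → ℕ → ℝ} {g : ℕ → ℝ}
    (g1 : g 1 = 0) (g2 : g 2 = -1 / 4) (g3 : g 3 = 0) (g4 : g 4 = 5 / 96) (g5 : g 5 = 0)
    (g6 : g 6 = -79 / 5760)
    (c0 : c 0 0 0 = 1) (c2 : c 0 0 2 = -1 / 12) (c4 : c 0 0 4 = -1 / 720)
    (c6 : c 0 0 6 = -1 / 30240) (hz : ∀ k m i, k < m → c k m i = 0)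
    (h0 : ∀ k i : ℕ, c (k + 1) 0 i = -(c k 0 (i + 1) * (i + 1)))
    (hs : ∀ k m i : ℕ, c (k + 1) (m + 1) i = -(c k (m + 1) (i + 1) * (i + 1))
      - (m + 1 + k) * ∑ j ∈ Finset.range (i + 1), g (j + 1) * (j + 1) * c k m (i - j)) :
    (c 2 0 0 = -1 / 6 ∧ c 2 1 0 = -1 / 2) ∧
    (c 4 0 0 = -1 / 30 ∧ c 4 1 0 = 25 / 12 ∧ c 4 2 0 = 5 / 2) ∧
    (c 6 0 0 = -1 / 42 ∧ c 6 1 0 = -41 / 3 ∧ c 6 2 0 = -140 / 3 ∧ c 6 3 0 = -35) := by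
  have c101 : c 1 0 1 = 1 / 6 := by rw [h0]; norm_num [c2]
  have c103 : c 1 0 3 = 1 / 180 := by rw [h0]; norm_num [c4]
  have c105 : c 1 0 5 = 1 / 5040 := by rw [h0]; norm_num [c6]
  have c111 : c 1 1 1 = 1 / 2 := by
    rw [hs]; norm_num [Finset.sum_range_succ, g1, g2, hz, c0]
  have c113 : c 1 1 3 = -1 / 4 := by
    rw [hs]; norm_num [Finset.sum_range_succ, g1, g2, g3, g4, hz, c2, c0]
  have c115 : c 1 1 5 = 19 / 192 := by
    rw [hs]; norm_num [Finset.sum_range_succ, g1, g2, g3, g4, g5, g6, hz, c4, c2, c0]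
  have c200 : c 2 0 0 = -1 / 6 := by rw [h0]; norm_num [c101]
  have c202 : c 2 0 2 = -1 / 60 := by rw [h0]; norm_num [c103]
  have c204 : c 2 0 4 = -1 / 1008 := by rw [h0]; norm_num [c105]
  have c210 : c 2 1 0 = -1 / 2 := by
    rw [hs]; norm_num [Finset.sum_range_succ, g1, c111]
  have c212 : c 2 1 2 = 11 / 12 := by
    rw [hs]; norm_num [Finset.sum_range_succ, g1, g2, g3, c113, c101]
  have c214 : c 2 1 4 = -1609 / 2880 := by
    rw [hs]; norm_num [Finset.sum_range_succ, g1, g2, g3, g4, g5, c115, c103, c101]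
  have c220 : c 2 2 0 = 0 := by
    rw [hs]; norm_num [Finset.sum_range_succ, g1, hz]
  have c222 : c 2 2 2 = 3 / 4 := by
    rw [hs]; norm_num [Finset.sum_range_succ, g1, g2, g3, hz, c111]
  have c224 : c 2 2 4 = -11 / 16 := by
    rw [hs]; norm_num [Finset.sum_range_succ, g1, g2, g3, g4, g5, hz, c113, c111]
  have c301 : c 3 0 1 = 1 / 30 := by rw [h0]; norm_num [c202]
  have c303 : c 3 0 3 = 1 / 252 := by rw [h0]; norm_num [c204]
  have c311 : c 3 1 1 = -25 / 12 := by
    rw [hs]; norm_num [Finset.sum_range_succ, g1, g2, c212, c200]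
  have c313 : c 3 1 3 = 833 / 360 := by
    rw [hs]; norm_num [Finset.sum_range_succ, g1, g2, g3, g4, c214, c202, c200]
  have c321 : c 3 2 1 = -5 / 2 := by
    rw [hs]; norm_num [Finset.sum_range_succ, g1, g2, c222, c210]
  have c323 : c 3 2 3 = 5 := by
    rw [hs]; norm_num [Finset.sum_range_succ, g1, g2, g3, g4, c224, c212, c210]
  have c333 : c 3 3 3 = 15 / 8 := by
    rw [hs]; norm_num [Finset.sum_range_succ, g1, g2, g3, g4, hz, c222, c220]
  have c400 : c 4 0 0 = -1 / 30 := by rw [h0]; norm_num [c301]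
  have c402 : c 4 0 2 = -1 / 84 := by rw [h0]; norm_num [c303]
  have c410 : c 4 1 0 = 25 / 12 := by
    rw [hs]; norm_num [Finset.sum_range_succ, g1, c311]
  have c412 : c 4 1 2 = -55 / 8 := by
    rw [hs]; norm_num [Finset.sum_range_succ, g1, g2, g3, c313, c301]
  have c420 : c 4 2 0 = 5 / 2 := by
    rw [hs]; norm_num [Finset.sum_range_succ, g1, c321]
  have c422 : c 4 2 2 = -485 / 24 := by
    rw [hs]; norm_num [Finset.sum_range_succ, g1, g2, g3, c323, c311]
  have c432 : c 4 3 2 = -105 / 8 := by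
    rw [hs]; norm_num [Finset.sum_range_succ, g1, g2, g3, c333, c321]
  have c501 : c 5 0 1 = 1 / 42 := by rw [h0]; norm_num [c402]
  have c511 : c 5 1 1 = 41 / 3 := by
    rw [hs]; norm_num [Finset.sum_range_succ, g1, g2, c412, c400]
  have c521 : c 5 2 1 = 140 / 3 := by
    rw [hs]; norm_num [Finset.sum_range_succ, g1, g2, c422, c410]
  have c531 : c 5 3 1 = 35 := by
    rw [hs]; norm_num [Finset.sum_range_succ, g1, g2, c432, c420]
  have c600 : c 6 0 0 = -1 / 42 := by rw [h0]; norm_num [c501]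
  have c610 : c 6 1 0 = -41 / 3 := by
    rw [hs]; norm_num [Finset.sum_range_succ, g1, c511]
  have c620 : c 6 2 0 = -140 / 3 := by
    rw [hs]; norm_num [Finset.sum_range_succ, g1, c521]
  have c630 : c 6 3 0 = -35 := by
    rw [hs]; norm_num [Finset.sum_range_succ, g1, c531]
  exact ⟨⟨c200, c210⟩, ⟨c400, c410, c420⟩, c600, c610, c620, c630⟩

theorem ibpCoeff_amp_values :
    (ibpCoeff amp 2 0 0 = -1 / 6 ∧ ibpCoeff amp 2 1 0 = -1 / 2) ∧
    (ibpCoeff amp 4 0 0 = -1 / 30 ∧ ibpCoeff amp 4 1 0 = 25 / 12 ∧ ibpCoeff amp 4 2 0 = 5 / 2) ∧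
    (ibpCoeff amp 6 0 0 = -1 / 42 ∧ ibpCoeff amp 6 1 0 = -41 / 3 ∧
      ibpCoeff amp 6 2 0 = -140 / 3 ∧ ibpCoeff amp 6 3 0 = -35) := by
  obtain ⟨_, g1, g2, g3, g4, g5, g6⟩ := coeff_taylorGerm_phaseSlope
  obtain ⟨c0, -, c2, -, c4, -, c6⟩ := coeff_taylorGerm_amp
  have h := recursion_values
    (c := fun k m i => PowerSeries.coeff i (taylorGerm (ibpCoeff amp k m)))
    (g := fun i => PowerSeries.coeff i (taylorGerm phaseSlope)) g1 g2 g3 g4 g5 g6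
    c0 c2 c4 c6
    (fun k m i h => by
      rw [ibpCoeff_eq_zero amp h, Pi.zero_def, taylorGerm_const, map_zero, map_zero])
    coeff_taylorGerm_ibpCoeff_succ_zero coeff_taylorGerm_ibpCoeff_succ_succ
  simpa only [coeff_zero_taylorGerm] using h

/-! ### The integrated terms `e_k` -/

theorem I_mul_sub_ne_zero {a : ℝ} (ha : 0 < a) (t : ℝ) : Complex.I * (t : ℂ) - a ≠ 0 := by
  rw [← dpsi_zero]; exact dpsi_zero_ne ha t

theorem continuous_re_d {a : ℝ} (ha : 0 < a) (k : ℕ) : Continuous fun t : ℝ => (d k a t).re := by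
  simp only [d_eq_sum ha]
  refine Complex.continuous_re.comp (continuous_finsetSum _ fun m _ => ?_).neg
  refine continuous_const.div (Continuous.pow ?_ _) fun t =>
    pow_ne_zero _ (I_mul_sub_ne_zero ha t)
  exact (continuous_const.mul Complex.continuous_ofReal).sub continuous_const

/-- For `k ≥ 1` the powers of `1 / (i b - a)` in `d_k` have exponents at least `2`, so that the
antiderivative is rational. -/
theorem e_eq_sum {a : ℝ} (ha : 0 < a) (b : ℝ) {k : ℕ} (hk : 1 ≤ k) :
    e k a b = -∑ m ∈ Finset.range (k + 1), ibpCoeff amp k m 0 * a ^ m / (m + k) *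
      (Complex.I * ((Complex.I * b - a) ^ (m + k))⁻¹).re := by
  have hne : ∀ t : ℝ, Complex.I * (t : ℂ) - a ≠ 0 := I_mul_sub_ne_zero ha
  have hcont := continuous_re_d ha k
  have hder : ∀ t : ℝ, HasDerivAt (fun t : ℝ => -∑ m ∈ Finset.range (k + 1),
      ibpCoeff amp k m 0 * a ^ m / (m + k) *
      (Complex.I * ((Complex.I * t - a) ^ (m + k))⁻¹).re) (d k a t).re t := by
    intro t
    have h1 : ∀ m ∈ Finset.range (k + 1), HasDerivAt (fun t : ℝ =>
        ibpCoeff amp k m 0 * a ^ m / (m + k) * (Complex.I * ((Complex.I * t - a) ^ (m + k))⁻¹).re)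
        (((ibpCoeff amp k m 0 : ℂ) * (a : ℂ) ^ m / (Complex.I * t - a) ^ (m + k + 1)).re) t := by
      intro m _
      have h2 : HasDerivAt (fun t : ℝ => Complex.I * (t : ℂ) - a) Complex.I t := by
        simpa using ((Complex.ofRealCLM.hasDerivAt (x := t)).const_mul Complex.I).sub_const (a : ℂ)
      have h3 := ((h2.pow (m + k)).inv (pow_ne_zero _ (hne t))).const_mul Complex.I
      have h4 := (Complex.reCLM.hasFDerivAt.comp_hasDerivAt t h3).const_mul
        (ibpCoeff amp k m 0 * a ^ m / (m + k))
      refine h4.congr_deriv ?_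
      rw [Complex.reCLM_apply, ← Complex.re_ofReal_mul]
      congr 1
      obtain ⟨n, hn⟩ : ∃ n, m + k = n + 1 := ⟨m + k - 1, by omega⟩
      have hmk : ((m : ℂ) + k) ≠ 0 := by
        have : ((m + k : ℕ) : ℂ) ≠ 0 := Nat.cast_ne_zero.2 (by omega)
        exact_mod_cast this
      have hmk' : ((m + k : ℕ) : ℂ) = (m : ℂ) + k := by push_cast; ring
      simp only [Pi.pow_apply]
      rw [hmk', hn, Nat.add_sub_cancel]
      push_cast
      have := hne t
      field_simp
      rw [Complex.I_sq]
      ring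
    have h5 := (HasDerivAt.fun_sum h1).neg
    refine h5.congr_deriv ?_
    rw [d_eq_sum ha, Complex.neg_re, Complex.re_sum]
  have h := intervalIntegral.integral_eq_sub_of_hasDerivAt (a := 0) (b := b) (fun t _ => hder t)
    (hcont.intervalIntegrable _ _)
  rw [e, h, sub_eq_self, neg_eq_zero]
  refine Finset.sum_eq_zero fun m _ => ?_
  have : (Complex.I * ((Complex.I * ((0 : ℝ) : ℂ) - a) ^ (m + k))⁻¹)
      = Complex.I * ((((-a) ^ (m + k))⁻¹ : ℝ) : ℂ) := by push_cast; simp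
  rw [this, Complex.re_mul_ofReal, Complex.I_re]
  simp

theorem hasDerivAt_e {a : ℝ} (ha : 0 < a) (k : ℕ) (b : ℝ) :
    HasDerivAt (fun t => e k a t) (d k a b).re b := by
  have hcont := continuous_re_d ha k
  exact intervalIntegral.integral_hasDerivAt_right (hcont.intervalIntegrable _ _)
    (hcont.stronglyMeasurableAtFilter _ _) hcont.continuousAt

theorem e_zero_eq {a : ℝ} (ha : 0 < a) (b : ℝ) : e 0 a b = Real.arctan (b / a) := by
  have hd : ∀ t : ℝ, (d 0 a t).re = 1 / (1 + (t / a) ^ 2) * (1 / a) := by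
    intro t
    rw [d_eq_sum ha]
    simp [ibpCoeff, amp_zero, Complex.normSq_apply]
    field_simp
  have hder : ∀ t : ℝ, HasDerivAt (fun t => Real.arctan (t / a)) (d 0 a t).re t := fun t => by
    rw [hd]; exact ((hasDerivAt_id t).div_const a).arctan
  have hcont : Continuous fun t : ℝ => (d 0 a t).re := by
    simp only [hd]
    refine (continuous_const.div ?_ fun t => by positivity).mul continuous_const
    exact continuous_const.add ((continuous_id.div_const a).pow 2)
  rw [e, intervalIntegral.integral_eq_sub_of_hasDerivAt (fun t _ => hder t)
    (hcont.intervalIntegrable _ _)]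
  simp

theorem e_two_mul_eq_sum {a : ℝ} (ha : 0 < a) (b : ℝ) {k : ℕ} (hk : 1 ≤ k) :
    e (2 * k) a b = -∑ m ∈ Finset.range (k + 1), ibpCoeff amp (2 * k) m 0 * a ^ m / (m + 2 * k) *
      (Complex.I * ((Complex.I * b - a) ^ (m + 2 * k))⁻¹).re := by
  rw [e_eq_sum ha b (by omega)]
  congr 1
  symm
  push_cast
  refine Finset.sum_subset (Finset.range_mono (by omega)) fun m _ hm => ?_
  rw [ibpCoeff_two_mul_zero (by simpa using hm)]
  simp

theorem I_mul_inv_pow_re (a b : ℝ) (n : ℕ) : (Complex.I * ((Complex.I * b - a) ^ n)⁻¹).re =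
    (-1) ^ (n + 1) * ((a + b * Complex.I) ^ n : ℂ).im / (a ^ 2 + b ^ 2) ^ n := by
  have h1 : (Complex.I * b - a)⁻¹ = ((-1 / (a ^ 2 + b ^ 2) : ℝ) : ℂ) * (a + b * Complex.I) := by
    apply Complex.ext
    · rw [Complex.re_ofReal_mul, Complex.inv_re, Complex.normSq_apply]; simp; ring
    · rw [Complex.im_ofReal_mul, Complex.inv_im, Complex.normSq_apply]; simp; ring
  rw [← inv_pow, h1, mul_pow, ← Complex.ofReal_pow, mul_left_comm, Complex.re_ofReal_mul, div_pow]
  simp only [Complex.mul_re, Complex.I_re, Complex.I_im]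
  ring

/-- The imaginary part of `(a + i b) ^ n` is a homogeneous polynomial of degree `n`. -/
theorem exists_homogeneous_im_pow (n : ℕ) : ∃ V : MvPolynomial (Fin 2) ℚ, V.IsHomogeneous n ∧
    ∀ a b : ℝ, MvPolynomial.aeval ![a, b] V = ((a + b * Complex.I) ^ n : ℂ).im := by
  suffices h : ∃ U V : MvPolynomial (Fin 2) ℚ, U.IsHomogeneous n ∧ V.IsHomogeneous n ∧
      ∀ a b : ℝ, MvPolynomial.aeval ![a, b] U = ((a + b * Complex.I) ^ n : ℂ).re ∧
        MvPolynomial.aeval ![a, b] V = ((a + b * Complex.I) ^ n : ℂ).im by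
    obtain ⟨U, V, _, hV, h⟩ := h
    exact ⟨V, hV, fun a b => (h a b).2⟩
  induction n with
  | zero => exact ⟨1, 0, MvPolynomial.isHomogeneous_one _ _, MvPolynomial.isHomogeneous_zero _ _ _,
      fun a b => by simp⟩
  | succ n ih =>
    obtain ⟨U, V, hU, hV, h⟩ := ih
    have x := MvPolynomial.isHomogeneous_X ℚ (0 : Fin 2)
    have y := MvPolynomial.isHomogeneous_X ℚ (1 : Fin 2)
    refine ⟨U * MvPolynomial.X 0 - V * MvPolynomial.X 1,
      U * MvPolynomial.X 1 + V * MvPolynomial.X 0,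
      (hU.mul x).sub (hV.mul y), (hU.mul y).add (hV.mul x), fun a b => ?_⟩
    obtain ⟨h1, h2⟩ := h a b
    constructor
    · simp [pow_succ, h1, h2]
    · simp [pow_succ, h1, h2]

/-- `(i b - a)⁻¹ = -(a + i b) / (a² + b²)`, so the term with `m` has the denominator
`(a² + b²) ^ (m + 2 k)`, where `m ≤ k`. -/
theorem exists_homogeneous_e (k : ℕ) (hk : 1 ≤ k) : ∃ N : MvPolynomial (Fin 2) ℚ,
    N.IsHomogeneous (4 * k) ∧ ∀ a b : ℝ, 0 < a → 0 ≤ b →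
      e (2 * k) a b = MvPolynomial.aeval ![a, b] N / (a ^ 2 + b ^ 2) ^ (3 * k) := by
  choose V hV hVe using exists_homogeneous_im_pow
  choose q hq using fun m => exists_rat_ibpCoeff_zero (2 * k) m
  refine ⟨∑ m ∈ Finset.range (k + 1), MvPolynomial.C (q m / (m + 2 * k) * (-1) ^ (m + 2 * k)) *
    (MvPolynomial.X 0 ^ m * V (m + 2 * k) *
      (MvPolynomial.X 0 ^ 2 + MvPolynomial.X 1 ^ 2) ^ (k - m)), ?_, fun a b ha _ => ?_⟩
  · refine MvPolynomial.IsHomogeneous.sum _ _ _ fun m hm => ?_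
    have hm' : m ≤ k := Nat.lt_succ_iff.1 (Finset.mem_range.1 hm)
    have x := fun i : Fin 2 => MvPolynomial.isHomogeneous_X ℚ i
    have h := (MvPolynomial.isHomogeneous_C (Fin 2)
      (q m / (m + 2 * k) * (-1) ^ (m + 2 * k) : ℚ)).mul ((((x 0).pow m).mul (hV (m + 2 * k))).mul
        ((((x 0).pow 2).add ((x 1).pow 2)).pow (k - m)))
    convert h using 1
    omega
  · rw [e_two_mul_eq_sum ha b hk, map_sum, Finset.sum_div, ← Finset.sum_neg_distrib]
    refine Finset.sum_congr rfl fun m hm => ?_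
    have hm' : m ≤ k := Nat.lt_succ_iff.1 (Finset.mem_range.1 hm)
    have hr : (0 : ℝ) < a ^ 2 + b ^ 2 := by positivity
    have hpow : (a ^ 2 + b ^ 2) ^ (3 * k) = (a ^ 2 + b ^ 2) ^ (m + 2 * k) *
        (a ^ 2 + b ^ 2) ^ (k - m) := by
      rw [← pow_add]; congr 1; omega
    simp only [map_mul, map_pow, map_add, MvPolynomial.aeval_X, hVe, MvPolynomial.aeval_C,
      Matrix.cons_val_zero, Matrix.cons_val_one]
    rw [I_mul_inv_pow_re, hq, hpow]
    have h2 : ((m : ℝ) + 2 * k) ≠ 0 := by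
      have : 0 < (m : ℝ) + 2 * k := by positivity
      exact this.ne'
    simp only [eq_ratCast]
    push_cast
    field_simp
    ring

theorem e_two_eq {a b : ℝ} (ha : 0 < a) :
    e 2 a b = a * b * (a ^ 2 - b ^ 2) / (3 * (a ^ 2 + b ^ 2) ^ 3) := by
  obtain ⟨⟨h0, h1⟩, -, -⟩ := ibpCoeff_amp_values
  have hr : a ^ 2 + b ^ 2 ≠ 0 := by positivity
  have h := e_two_mul_eq_sum ha b (k := 1) le_rfl
  simp only [I_mul_inv_pow_re, Finset.sum_range_succ, Finset.sum_range_zero, Nat.reduceMul,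
    Nat.reduceAdd, h0, h1] at h
  rw [h]
  have i2 : ((a + b * Complex.I) ^ 2 : ℂ).im = 2 * a * b := by simp [pow_succ]; ring
  have i3 : ((a + b * Complex.I) ^ 3 : ℂ).im = 3 * a ^ 2 * b - b ^ 3 := by simp [pow_succ]; ring
  rw [i2, i3]
  field_simp
  push_cast
  ring

theorem e_four_eq {a b : ℝ} (ha : 0 < a) :
    e 4 a b = a * b * (a ^ 2 - b ^ 2) * (23 * a ^ 4 - 354 * a ^ 2 * b ^ 2 + 23 * b ^ 4) /
      (60 * (a ^ 2 + b ^ 2) ^ 6) := by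
  obtain ⟨-, ⟨h0, h1, h2⟩, -⟩ := ibpCoeff_amp_values
  have hr : a ^ 2 + b ^ 2 ≠ 0 := by positivity
  have h := e_two_mul_eq_sum ha b (k := 2) one_le_two
  simp only [I_mul_inv_pow_re, Finset.sum_range_succ, Finset.sum_range_zero, Nat.reduceMul,
    Nat.reduceAdd, h0, h1, h2] at h
  rw [h]
  have i4 : ((a + b * Complex.I) ^ 4 : ℂ).im = 4 * a ^ 3 * b - 4 * a * b ^ 3 := by
    simp [pow_succ]; ring
  have i5 : ((a + b * Complex.I) ^ 5 : ℂ).im = 5 * a ^ 4 * b - 10 * a ^ 2 * b ^ 3 + b ^ 5 := by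
    simp [pow_succ]; ring
  have i6 : ((a + b * Complex.I) ^ 6 : ℂ).im =
      6 * a ^ 5 * b - 20 * a ^ 3 * b ^ 3 + 6 * a * b ^ 5 := by
    simp [pow_succ]; ring
  rw [i4, i5, i6]
  field_simp
  push_cast
  ring

theorem e_six_eq {a b : ℝ} (ha : 0 < a) :
    e 6 a b = a * b * (a ^ 2 - b ^ 2) *
      (249 * a ^ 8 - 10796 * a ^ 6 * b ^ 2 + 40630 * b ^ 4 * a ^ 4
        - 10796 * b ^ 6 * a ^ 2 + 249 * b ^ 8) / (126 * (a ^ 2 + b ^ 2) ^ 9) := by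
  obtain ⟨-, -, h0, h1, h2, h3⟩ := ibpCoeff_amp_values
  have hr : a ^ 2 + b ^ 2 ≠ 0 := by positivity
  have h := e_two_mul_eq_sum ha b (k := 3) (by norm_num)
  simp only [I_mul_inv_pow_re, Finset.sum_range_succ, Finset.sum_range_zero, Nat.reduceMul,
    Nat.reduceAdd, h0, h1, h2, h3] at h
  rw [h]
  have i6 : ((a + b * Complex.I) ^ 6 : ℂ).im =
      6 * a ^ 5 * b - 20 * a ^ 3 * b ^ 3 + 6 * a * b ^ 5 := by
    simp [pow_succ]; ring
  have i7 : ((a + b * Complex.I) ^ 7 : ℂ).im =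
      7 * a ^ 6 * b - 35 * a ^ 4 * b ^ 3 + 21 * a ^ 2 * b ^ 5 - b ^ 7 := by
    simp [pow_succ]; ring
  have i8 : ((a + b * Complex.I) ^ 8 : ℂ).im =
      8 * a ^ 7 * b - 56 * a ^ 5 * b ^ 3 + 56 * a ^ 3 * b ^ 5 - 8 * a * b ^ 7 := by
    simp [pow_succ]; ring
  have i9 : ((a + b * Complex.I) ^ 9 : ℂ).im =
      9 * a ^ 8 * b - 84 * a ^ 6 * b ^ 3 + 126 * a ^ 4 * b ^ 5 - 36 * a ^ 2 * b ^ 7 + b ^ 9 := by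
    simp [pow_succ]; ring
  rw [i6, i7, i8, i9]
  field_simp
  push_cast
  ring

/-- The rational terms vanish in the limit of large `b`. -/
theorem tendsto_e_two_mul {a : ℝ} (ha : 0 < a) {k : ℕ} (hk : 1 ≤ k) :
    Tendsto (fun b => e (2 * k) a b) atTop (𝓝 0) := by
  have h0 : Tendsto (fun b : ℝ => Complex.I * (b : ℂ) - a) atTop (Bornology.cobounded ℂ) := by
    rw [← tendsto_norm_atTop_iff_cobounded]
    refine tendsto_atTop_mono (fun b => ?_) tendsto_id
    rw [← dpsi_zero]; exact le_norm_dpsi a b 0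
  simp only [e_two_mul_eq_sum ha _ hk]
  have hlim : (0 : ℝ) = -∑ m ∈ Finset.range (k + 1), 0 := by simp
  conv => arg 3; rw [hlim]
  refine (tendsto_finsetSum _ fun m _ => ?_).neg
  have h1 : Tendsto (fun b : ℝ => ((Complex.I * (b : ℂ) - a)⁻¹) ^ (m + 2 * k)) atTop (𝓝 0) := by
    have := (tendsto_inv₀_cobounded.comp h0).pow (m + 2 * k)
    rwa [zero_pow (by omega)] at this
  have h2 := (Complex.continuous_re.tendsto _).comp (h1.const_mul Complex.I)
  have h3 := h2.const_mul (ibpCoeff amp (2 * k) m 0 * a ^ m / (m + 2 * k))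
  simp only [mul_zero, Complex.zero_re] at h3
  refine h3.congr fun b => ?_
  simp only [Function.comp, inv_pow]

/-! ### The sine integral and its derivative in the second parameter -/

/-- `∫_0^π (F θ / θ) sin (b θ) w^{-a} dθ`; for `F = amp` it is `π / 2` times `PInt`. -/
def sineInt (F : ℝ → ℝ) (a b : ℝ) : ℝ :=
  ∫ θ in (0 : ℝ)..Real.pi, F θ / θ * (Real.sin (b * θ) * w θ ^ (-a))

theorem PInt_eq_sineInt (a b : ℝ) : PInt a b = 2 / Real.pi * sineInt amp a b := by
  have h : ∀ θ : ℝ, Real.cot (θ / 2) * Real.sin (b * θ) * w θ ^ (-a) =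
      2 * (amp θ / θ * (Real.sin (b * θ) * w θ ^ (-a))) := by
    intro θ
    rcases eq_or_ne θ 0 with rfl | hθ
    · simp [Real.cot_eq_cos_div_sin]
    · rw [amp_eq hθ]; field_simp
  simp only [PInt, sineInt, h]
  rw [intervalIntegral.integral_const_mul]
  ring

theorem w_rpow_neg_le_one {a : ℝ} (ha : 0 ≤ a) (θ : ℝ) : w θ ^ (-a) ≤ 1 :=
  Real.rpow_le_one_of_one_le_of_nonpos (one_le_w θ) (by linarith)

theorem continuous_w_rpow (a : ℝ) : Continuous fun θ => w θ ^ (-a) :=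
  continuous_w.rpow_const fun θ => Or.inl (w_pos θ).ne'

theorem continuousOn_sineInt_integrand {F : ℝ → ℝ} (hF : ContinuousOn F (Icc 0 Real.pi))
    (a b : ℝ) : ContinuousOn (fun θ => F θ / θ * (Real.sin (b * θ) * w θ ^ (-a)))
      (Ioc 0 Real.pi) := by
  refine ((hF.mono Ioc_subset_Icc_self).div continuousOn_id fun θ hθ => hθ.1.ne').mul ?_
  exact ((Real.continuous_sin.comp (continuous_const.mul continuous_id)).mul
    (continuous_w_rpow a)).continuousOn

theorem intervalIntegrable_of_continuousOn_Ioc {G : ℝ → ℝ} {C : ℝ}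
    (hG : ContinuousOn G (Ioc 0 Real.pi)) (hC : ∀ θ ∈ Ioc 0 Real.pi, |G θ| ≤ C) :
    IntervalIntegrable G MeasureTheory.volume 0 Real.pi := by
  rw [intervalIntegrable_iff_integrableOn_Ioc_of_le Real.pi_pos.le]
  refine MeasureTheory.IntegrableOn.of_bound (by simp)
    (hG.aestronglyMeasurable measurableSet_Ioc) C ?_
  exact (MeasureTheory.ae_restrict_iff' measurableSet_Ioc).2 (Eventually.of_forall hC)

theorem intervalIntegrable_sineInt {F : ℝ → ℝ} (hF : ContinuousOn F (Icc 0 Real.pi))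
    {a : ℝ} (ha : 0 ≤ a) (b : ℝ) :
    IntervalIntegrable (fun θ => F θ / θ * (Real.sin (b * θ) * w θ ^ (-a)))
      MeasureTheory.volume 0 Real.pi := by
  obtain ⟨M, hM⟩ := isCompact_Icc.exists_bound_of_continuousOn hF
  refine intervalIntegrable_of_continuousOn_Ioc (C := M * |b|)
    (continuousOn_sineInt_integrand hF a b) fun θ hθ => ?_
  have h1 : |Real.sin (b * θ)| ≤ |b| * θ := by
    have := Real.abs_sin_le_abs (x := b * θ)
    rwa [abs_mul, abs_of_pos hθ.1] at this
  have h2 := hM θ (Ioc_subset_Icc_self hθ)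
  rw [Real.norm_eq_abs] at h2
  rw [abs_mul, abs_div, abs_mul, abs_of_pos hθ.1, abs_of_pos (Real.rpow_pos_of_pos (w_pos θ) _),
    div_mul_eq_mul_div, div_le_iff₀ hθ.1]
  have h3 : |Real.sin (b * θ)| * w θ ^ (-a) ≤ |b| * θ * 1 :=
    mul_le_mul h1 (w_rpow_neg_le_one ha θ) (Real.rpow_pos_of_pos (w_pos θ) _).le
      (mul_nonneg (abs_nonneg b) hθ.1.le)
  calc |F θ| * (|Real.sin (b * θ)| * w θ ^ (-a)) ≤ M * (|b| * θ * 1) :=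
        mul_le_mul h2 h3 (mul_nonneg (abs_nonneg _) (Real.rpow_pos_of_pos (w_pos θ) _).le)
          ((abs_nonneg _).trans h2)
    _ = M * |b| * θ := by ring

theorem hasDerivAt_sineInt {F : ℝ → ℝ} (hF : ContinuousOn F (Icc 0 Real.pi))
    {a : ℝ} (ha : 0 ≤ a) (b : ℝ) : HasDerivAt (fun t => sineInt F a t)
      (∫ θ in (0 : ℝ)..Real.pi, (F θ : ℂ) * Complex.exp (psi a b θ)).re b := by
  obtain ⟨M, hM⟩ := isCompact_Icc.exists_bound_of_continuousOn hF
  have hu : Set.uIoc 0 Real.pi = Ioc 0 Real.pi := uIoc_of_le Real.pi_pos.le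
  have hcos : ContinuousOn (fun θ => F θ * (Real.cos (b * θ) * w θ ^ (-a))) (Icc 0 Real.pi) :=
    hF.mul ((Real.continuous_cos.comp (continuous_const.mul continuous_id)).mul
      (continuous_w_rpow a)).continuousOn
  have h := intervalIntegral.hasDerivAt_integral_of_dominated_loc_of_deriv_le
    (μ := MeasureTheory.volume) (a := 0) (b := Real.pi) (s := univ) (x₀ := b)
    (F := fun t θ => F θ / θ * (Real.sin (t * θ) * w θ ^ (-a)))
    (F' := fun t θ => F θ * (Real.cos (t * θ) * w θ ^ (-a))) (bound := fun _ => M) univ_mem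
    (Eventually.of_forall fun t => by
      rw [hu]
      exact (continuousOn_sineInt_integrand hF a t).aestronglyMeasurable measurableSet_Ioc)
    (intervalIntegrable_sineInt hF ha b)
    (by rw [hu]; exact (hcos.mono Ioc_subset_Icc_self).aestronglyMeasurable measurableSet_Ioc)
    (Eventually.of_forall fun θ hθ t _ => by
      rw [hu] at hθ
      have h2 := hM θ (Ioc_subset_Icc_self hθ)
      rw [norm_mul, norm_mul, Real.norm_of_nonneg (Real.rpow_pos_of_pos (w_pos θ) _).le]
      have h3 : ‖Real.cos (t * θ)‖ * w θ ^ (-a) ≤ 1 * 1 :=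
        mul_le_mul (Real.abs_cos_le_one _) (w_rpow_neg_le_one ha θ)
          (Real.rpow_pos_of_pos (w_pos θ) _).le zero_le_one
      calc ‖F θ‖ * (‖Real.cos (t * θ)‖ * w θ ^ (-a)) ≤ M * (1 * 1) :=
            mul_le_mul h2 h3 (mul_nonneg (norm_nonneg _) (Real.rpow_pos_of_pos (w_pos θ) _).le)
              ((norm_nonneg _).trans h2)
        _ = M := by ring)
    intervalIntegrable_const
    (Eventually.of_forall fun θ hθ t _ => by
      rw [hu] at hθ
      have h1 : HasDerivAt (fun t => Real.sin (t * θ)) (Real.cos (t * θ) * θ) t := by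
        simpa using ((hasDerivAt_id t).mul_const θ).sin
      have h2 := (h1.mul_const (w θ ^ (-a))).const_mul (F θ / θ)
      refine h2.congr_deriv ?_
      have := hθ.1.ne'
      field_simp)
  refine h.2.congr_deriv ?_
  have hint : IntervalIntegrable (fun θ => (F θ : ℂ) * Complex.exp (psi a b θ))
      MeasureTheory.volume 0 Real.pi :=
    (continuousOn_mul_exp_psi hF a b).intervalIntegrable_of_Icc Real.pi_pos.le
  have h3 := Complex.reCLM.intervalIntegral_comp_comm hint
  simp only [Complex.reCLM_apply] at h3
  rw [← h3]
  refine intervalIntegral.integral_congr fun θ _ => ?_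
  simp only [Complex.re_ofReal_mul, exp_psi_re]

theorem hasDerivAt_PInt {a : ℝ} (ha : 0 < a) (b : ℝ) :
    HasDerivAt (fun t => PInt a t) (2 / Real.pi * (Q a b).re) b := by
  simp only [PInt_eq_sineInt]
  exact (hasDerivAt_sineInt continuousOn_amp ha.le b).const_mul _

/-! ### The Dirichlet limit -/

theorem integral_cos_nat_mul (n : ℕ) :
    ∫ θ in (0 : ℝ)..Real.pi, Real.cos ((n + 1 : ℕ) * θ) = 0 := by
  rw [intervalIntegral.integral_comp_mul_left (fun x => Real.cos x) (by positivity)]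
  simp
  right
  exact_mod_cast Real.sin_nat_mul_pi (n + 1)

/-- The integral of the Dirichlet kernel. -/
theorem sineInt_amp_zero_nat (n : ℕ) : sineInt amp 0 (n + 1 : ℕ) = Real.pi / 2 := by
  have hstep : ∀ n : ℕ, sineInt amp 0 (n + 1 : ℕ) - sineInt amp 0 n =
      ∫ θ in (0 : ℝ)..Real.pi, (Real.cos ((n + 1 : ℕ) * θ) + Real.cos (n * θ)) / 2 := by
    intro n
    rw [sineInt, sineInt, ← intervalIntegral.integral_sub
      (intervalIntegrable_sineInt continuousOn_amp le_rfl _)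
      (intervalIntegrable_sineInt continuousOn_amp le_rfl _)]
    refine intervalIntegral.integral_congr_ae (Eventually.of_forall fun θ hθ => ?_)
    rw [uIoc_of_le Real.pi_pos.le] at hθ
    have hs : Real.sin (θ / 2) ≠ 0 :=
      (Real.sin_pos_of_pos_of_lt_pi (by linarith [hθ.1]) (by linarith [hθ.2, Real.pi_pos])).ne'
    have hθ0 := hθ.1.ne'
    have h1 : ((n + 1 : ℕ) : ℝ) * θ = n * θ + 2 * (θ / 2) := by push_cast; ring
    have h2 := Real.sin_sq_add_cos_sq (θ / 2)
    rw [amp_eq hθ0, Real.cot_eq_cos_div_sin, neg_zero, Real.rpow_zero, mul_one, mul_one, h1,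
      Real.sin_add, Real.cos_add, Real.sin_two_mul, Real.cos_two_mul]
    generalize Real.sin (θ / 2) = s at *
    generalize Real.cos (θ / 2) = c at *
    field_simp
    linear_combination (2 * c * Real.sin (θ * n)) * h2
  have hcos := integral_cos_nat_mul
  have hint : ∀ n : ℕ, IntervalIntegrable (fun θ => Real.cos (n * θ)) MeasureTheory.volume 0
      Real.pi := fun n =>
    (Real.continuous_cos.comp (continuous_const.mul continuous_id)).intervalIntegrable _ _
  induction n with
  | zero =>
    have h := hstep 0
    rw [intervalIntegral.integral_div, intervalIntegral.integral_add (hint _) (hint _), hcos] at h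
    simp [sineInt] at h ⊢
    exact h
  | succ n ih =>
    have h := hstep (n + 1)
    rw [intervalIntegral.integral_div, intervalIntegral.integral_add (hint _) (hint _), hcos, hcos,
      ih] at h
    linarith

/-- `log w` has the derivative `phaseSlope ≤ 1` on `(0, π)`. -/
theorem log_w_le {θ : ℝ} (h0 : 0 ≤ θ) (hπ : θ ≤ Real.pi) : Real.log (w θ) ≤ θ := by
  have hder : ∀ x ∈ Ioo 0 Real.pi, HasDerivAt (fun x => Real.log (w x)) (phaseSlope x) x := by
    intro x hx
    have h := (Complex.reCLM.hasFDerivAt.comp_hasDerivAt x (hasDerivAt_psi (-1) 0 hx.1 hx.2))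
    refine (h.congr_deriv ?_).congr_of_eventuallyEq (Eventually.of_forall fun y => ?_)
    · rw [Complex.reCLM_apply, dpsi_re]; ring
    · simp only [Function.comp, Complex.reCLM_apply, psi_re]; ring
  have hcont : ContinuousOn (fun x => Real.log (w x)) (Icc 0 Real.pi) :=
    (continuous_w.log fun θ => (w_pos θ).ne').continuousOn
  have h := (convex_Icc (0 : ℝ) Real.pi).image_sub_le_mul_sub_of_deriv_le hcont
    (fun x hx => by
      rw [interior_Icc] at hx
      exact (hder x hx).differentiableAt.differentiableWithinAt) (C := 1)
    (fun x hx => by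
      rw [interior_Icc] at hx
      rw [(hder x hx).deriv]; exact phaseSlope_le_one x)
    0 ⟨le_rfl, Real.pi_pos.le⟩ θ ⟨h0, hπ⟩ h0
  simpa [w_zero] using h

/-- A form of the Riemann–Lebesgue lemma. -/
theorem tendsto_integral_mul_sin {G : ℝ → ℝ}
    (hG : IntervalIntegrable G MeasureTheory.volume 0 Real.pi) :
    Tendsto (fun n : ℕ => ∫ θ in (0 : ℝ)..Real.pi, G θ * Real.sin (n * θ)) atTop (𝓝 0) := by
  rw [intervalIntegrable_iff_integrableOn_Ioc_of_le Real.pi_pos.le] at hG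
  set f : ℝ → ℂ := indicator (Ioc 0 Real.pi) fun θ => (G θ : ℂ) with hf
  have hfint : MeasureTheory.Integrable f := by
    rw [hf, MeasureTheory.integrable_indicator_iff measurableSet_Ioc]
    exact hG.ofReal
  have hlim : Tendsto (fun n : ℕ => -((n : ℝ) / (2 * Real.pi))) atTop (cocompact ℝ) := by
    refine Tendsto.mono_right ?_ atBot_le_cocompact
    exact tendsto_neg_atTop_atBot.comp
      (tendsto_natCast_atTop_atTop.atTop_div_const (by positivity))
  have h := (Real.tendsto_integral_exp_smul_cocompact f).comp hlim
  have h2 := (Complex.continuous_im.tendsto _).comp h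
  rw [Complex.zero_im] at h2
  refine h2.congr fun n => ?_
  have hexp : ∀ v : ℝ, Real.fourierChar (-(v * -((n : ℝ) / (2 * Real.pi)))) • f v
      = Complex.exp (Complex.I * (n * v : ℝ)) * f v := by
    intro v
    rw [Circle.smul_def, Real.fourierChar_apply, smul_eq_mul]
    congr 2
    push_cast
    have : (Real.pi : ℂ) ≠ 0 := Complex.ofReal_ne_zero.2 Real.pi_ne_zero
    field_simp
  simp only [Function.comp, hexp]
  have hint : MeasureTheory.Integrable fun v : ℝ =>
      Complex.exp (Complex.I * (n * v : ℝ)) * f v := by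
    refine hfint.bdd_mul (c := 1) ?_ ?_
    · exact (Complex.continuous_exp.comp (continuous_const.mul (Complex.continuous_ofReal.comp
        (continuous_const.mul continuous_id)))).aestronglyMeasurable
    · refine Eventually.of_forall fun v => ?_
      rw [mul_comm, Complex.norm_exp_ofReal_mul_I]
  have him := Complex.imCLM.integral_comp_comm hint
  simp only [Complex.imCLM_apply] at him
  rw [← him, intervalIntegral.integral_of_le Real.pi_pos.le,
    ← MeasureTheory.integral_indicator measurableSet_Ioc]
  congr 1
  funext v
  by_cases hv : v ∈ Ioc 0 Real.pi
  · simp only [hf, indicator_of_mem hv]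
    rw [mul_comm, Complex.im_ofReal_mul, mul_comm Complex.I, Complex.exp_ofReal_mul_I_im]
  · simp [hf, indicator_of_notMem hv]

/-- Replacing `w^{-a}` by `1` changes the integral by a Fourier coefficient of an integrable
function, which leaves the Dirichlet integral in the limit. -/
theorem tendsto_sineInt_amp {a : ℝ} (ha : 0 < a) :
    Tendsto (fun n : ℕ => sineInt amp a n) atTop (𝓝 (Real.pi / 2)) := by
  obtain ⟨M, hM⟩ := isCompact_Icc.exists_bound_of_continuousOn continuousOn_amp
  have hG : IntervalIntegrable (fun θ => amp θ / θ * (w θ ^ (-a) - 1)) MeasureTheory.volume 0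
      Real.pi := by
    refine intervalIntegrable_of_continuousOn_Ioc (C := M * a) ?_ fun θ hθ => ?_
    · exact ((continuousOn_amp.mono Ioc_subset_Icc_self).div continuousOn_id
        fun θ hθ => hθ.1.ne').mul ((continuous_w_rpow a).sub continuous_const).continuousOn
    · have h2 := hM θ (Ioc_subset_Icc_self hθ)
      rw [Real.norm_eq_abs] at h2
      have h3 : |w θ ^ (-a) - 1| ≤ a * θ := by
        rw [abs_sub_comm, abs_of_nonneg (by linarith [w_rpow_neg_le_one ha.le θ]), w_rpow_neg]
        have h4 := Real.add_one_le_exp (-a * Real.log (w θ))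
        have h5 := mul_le_mul_of_nonneg_left (log_w_le hθ.1.le hθ.2) ha.le
        linarith
      rw [abs_mul, abs_div, abs_of_pos hθ.1, div_mul_eq_mul_div, div_le_iff₀ hθ.1]
      calc |amp θ| * |w θ ^ (-a) - 1| ≤ M * (a * θ) :=
            mul_le_mul h2 h3 (abs_nonneg _) ((abs_nonneg _).trans h2)
        _ = M * a * θ := by ring
  have h := (tendsto_integral_mul_sin hG).const_add (Real.pi / 2)
  rw [add_zero] at h
  refine h.congr' ?_
  filter_upwards [eventually_ge_atTop 1] with n hn
  obtain ⟨m, rfl⟩ : ∃ m, n = m + 1 := ⟨n - 1, by omega⟩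
  rw [← sineInt_amp_zero_nat m, ← eq_sub_iff_add_eq', sineInt, sineInt,
    ← intervalIntegral.integral_sub (intervalIntegrable_sineInt continuousOn_amp ha.le _)
      (intervalIntegrable_sineInt continuousOn_amp le_rfl _)]
  refine intervalIntegral.integral_congr fun θ _ => ?_
  simp only [neg_zero, Real.rpow_zero]
  ring

/-! ### Localisation at `θ = 0` -/

/-- A smooth cutoff, equal to `1` for `|θ| ≤ π / 3` and to `0` on `[π / 2, π]`. Being a function
of `cos θ` it is even about `0` and about `π`. -/
def cutoff (θ : ℝ) : ℝ := Real.smoothTransition (2 * Real.cos θ)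

theorem contDiff_cutoff : ContDiff ℝ ∞ cutoff :=
  Real.smoothTransition.contDiff.comp (contDiff_const.mul Real.contDiff_cos)

theorem cutoff_eq_one {θ : ℝ} (h : 1 / 2 ≤ Real.cos θ) : cutoff θ = 1 :=
  Real.smoothTransition.one_of_one_le (by linarith)

theorem cutoff_eq_zero {θ : ℝ} (h : Real.cos θ ≤ 0) : cutoff θ = 0 :=
  Real.smoothTransition.zero_of_nonpos (by linarith)

theorem cutoff_eventually_one : cutoff =ᶠ[𝓝 0] fun _ => 1 := by
  have h : ∀ᶠ θ in 𝓝 (0 : ℝ), 1 / 2 < Real.cos θ :=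
    Real.continuous_cos.continuousAt.eventually (lt_mem_nhds (by norm_num [Real.cos_zero]))
  filter_upwards [h] with θ hθ using cutoff_eq_one hθ.le

/-- The amplitude, cut off away from `0`. -/
def localAmp (θ : ℝ) : ℝ := cutoff θ * amp θ

theorem contDiffOn_localAmp : ContDiffOn ℝ ∞ localAmp (Ioo (-(2 * Real.pi)) (2 * Real.pi)) :=
  contDiff_cutoff.contDiffOn.mul contDiffOn_amp

theorem continuousOn_localAmp : ContinuousOn localAmp (Icc 0 Real.pi) :=
  contDiffOn_localAmp.continuousOn.mono Icc_zero_pi_subset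

theorem ibpTerm_localAmp_zero (a b : ℝ) (k : ℕ) :
    ibpTerm localAmp a b k 0 = ibpTerm amp a b k 0 := by
  have h : localAmp =ᶠ[𝓝 0] amp := by
    filter_upwards [cutoff_eventually_one] with θ hθ
    rw [localAmp, hθ, one_mul]
  simp only [ibpTerm, (ibpCoeff_congr h k _).self_of_nhds]

theorem ibpTerm_eq_zero_of_eventually {F : ℝ → ℝ} {x : ℝ} (h : F =ᶠ[𝓝 x] 0) (a b : ℝ) (k : ℕ) :
    ibpTerm F a b k x = 0 := by
  simp [ibpTerm, (ibpCoeff_congr h k _).self_of_nhds, ibpCoeff_zero_fun]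

theorem cos_two_pi_div_three_neg : Real.cos (2 * Real.pi / 3) < 0 :=
  Real.cos_neg_of_pi_div_two_lt_of_lt (by linarith [Real.pi_pos]) (by linarith [Real.pi_pos])

/-- The localised version of `Q` has the asymptotic series `∑ d_{2j}`. -/
theorem exists_norm_integral_localAmp_sub_le (K : ℕ) : ∃ C : ℝ, 0 ≤ C ∧ ∀ a b : ℝ, 1 ≤ a → 0 ≤ b →
    ‖(∫ θ in (0 : ℝ)..Real.pi, (localAmp θ : ℂ) * Complex.exp (psi a b θ)) -
      ∑ j ∈ Finset.range K, d (2 * j) a b‖ ≤ C / (a + b) ^ (2 * K + 1) := by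
  set c₁ := 2 * Real.pi / 3 with hc₁
  have hπ := Real.pi_pos
  have hc0 : 0 ≤ c₁ := by positivity
  have hcπ : c₁ < Real.pi := by rw [hc₁]; linarith
  obtain ⟨c, hc, hψ⟩ := exists_le_norm_dpsi hcπ
  obtain ⟨B, hB0, hB⟩ := exists_norm_ibpTerm_le isOpen_Ioo contDiffOn_localAmp Icc_zero_pi_subset
    (2 * (K + 1)) hc
  obtain ⟨D, hD0, hD⟩ := exists_norm_d_le (2 * K)
  -- `2 K + 2` integrations by parts: the term `d_{2K}` goes into the error, and the last
  -- remainder is of order `(a + b) ^ (-(2 K + 2))`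
  refine ⟨D + B * c₁, by positivity, fun a b ha hb => ?_⟩
  have ha0 : 0 < a := by linarith
  have hab : 1 ≤ a + b := by linarith
  have hne : ∀ θ ∈ Icc 0 c₁, dpsi a b θ ≠ 0 := fun θ hθ =>
    dpsi_ne_zero_of_le hc ha0 hb (hψ a b θ ha0 hb hθ.1 hθ.2)
  have hsub : Icc 0 c₁ ⊆ Ioo (-(2 * Real.pi)) (2 * Real.pi) := fun θ hθ =>
    Icc_zero_pi_subset ⟨hθ.1, hθ.2.trans hcπ.le⟩
  have hloc : localAmp =ᶠ[𝓝 c₁] 0 := by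
    have h : ∀ᶠ θ in 𝓝 c₁, Real.cos θ < 0 :=
      Real.continuous_cos.continuousAt.eventually (gt_mem_nhds cos_two_pi_div_three_neg)
    filter_upwards [h] with θ hθ
    rw [localAmp, cutoff_eq_zero hθ.le, zero_mul, Pi.zero_apply]
  have hcut : ∫ θ in (0 : ℝ)..Real.pi, (localAmp θ : ℂ) * Complex.exp (psi a b θ) =
      ∫ θ in (0 : ℝ)..c₁, (localAmp θ : ℂ) * Complex.exp (psi a b θ) := by
    have hcont := continuousOn_mul_exp_psi continuousOn_localAmp a b
    rw [← intervalIntegral.integral_add_adjacent_intervals (b := c₁)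
      ((hcont.mono (Icc_subset_Icc_right hcπ.le)).intervalIntegrable_of_Icc hc0)
      ((hcont.mono (Icc_subset_Icc_left hc0)).intervalIntegrable_of_Icc hcπ.le), add_eq_left]
    refine intervalIntegral.integral_zero_ae (Eventually.of_forall fun θ hθ => ?_)
    rw [uIoc_of_le hcπ.le] at hθ
    have : Real.cos θ ≤ 0 := Real.cos_nonpos_of_pi_div_two_le_of_le
      (by linarith [hθ.1]) (by linarith [hθ.2])
    rw [localAmp, cutoff_eq_zero this]; simp
  have hkey : (∫ θ in (0 : ℝ)..Real.pi, (localAmp θ : ℂ) * Complex.exp (psi a b θ)) -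
      ∑ j ∈ Finset.range K, d (2 * j) a b = d (2 * K) a b +
        ∫ θ in (0 : ℝ)..c₁, ibpTerm localAmp a b (2 * (K + 1)) θ * Complex.exp (psi a b θ) := by
    have h1 : ∑ j ∈ Finset.range (2 * (K + 1)), (ibpTerm localAmp a b j c₁ / dpsi a b c₁ *
        Complex.exp (psi a b c₁) - ibpTerm localAmp a b j 0 / dpsi a b 0) =
        ∑ j ∈ Finset.range K, d (2 * j) a b + d (2 * K) a b := by
      rw [← Finset.sum_range_succ, ← sum_d_two_mul ha0]
      refine Finset.sum_congr rfl fun j _ => ?_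
      rw [ibpTerm_eq_zero_of_eventually hloc, ibpTerm_localAmp_zero, d_eq_neg_ibpTerm ha0]
      ring
    rw [hcut, integral_mul_exp_psi isOpen_Ioo contDiffOn_localAmp hc0 hcπ.le hsub hne
      (2 * (K + 1)), h1]
    ring
  rw [hkey, add_div]
  refine (norm_add_le _ _).trans (add_le_add (hD a b ha0 hb) ?_)
  have h2 := intervalIntegral.norm_integral_le_of_norm_le_const (a := 0) (b := c₁)
    (f := fun θ => ibpTerm localAmp a b (2 * (K + 1)) θ * Complex.exp (psi a b θ))
    (C := B / (a + b) ^ (2 * K + 1)) fun θ hθ => by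
      rw [uIoc_of_le hc0] at hθ
      rw [norm_mul]
      have h3 := hB a b θ ha0 hb ⟨hθ.1.le, hθ.2.trans hcπ.le⟩ (hψ a b θ ha0 hb hθ.1.le hθ.2)
      have h4 : B / (a + b) ^ (2 * (K + 1)) ≤ B / (a + b) ^ (2 * K + 1) :=
        div_le_div_of_nonneg_left hB0 (by positivity) (pow_le_pow_right₀ hab (by omega))
      calc _ ≤ ‖ibpTerm localAmp a b (2 * (K + 1)) θ‖ * 1 :=
            mul_le_mul_of_nonneg_left (norm_exp_psi_le_one ha0.le b θ) (norm_nonneg _)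
        _ ≤ _ := by rw [mul_one]; exact h3.trans h4
  rw [sub_zero, abs_of_nonneg hc0] at h2
  exact h2.trans (le_of_eq (by ring))

/-- The part of `amp θ / θ = cot (θ / 2) / 2` away from `0`. At `θ = 0` both factors are `0`,
the second one because of the convention for division by zero. -/
def tailAmp (θ : ℝ) : ℝ := (1 - cutoff θ) * (Real.cot (θ / 2) / 2)

theorem tailAmp_eventually_zero : tailAmp =ᶠ[𝓝 0] 0 := by
  filter_upwards [cutoff_eventually_one] with θ hθ
  simp [tailAmp, hθ]

theorem contDiffOn_tailAmp : ContDiffOn ℝ ∞ tailAmp (Ioo (-(2 * Real.pi)) (2 * Real.pi)) := by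
  intro θ hθ
  refine ContDiffAt.contDiffWithinAt ?_
  rcases eq_or_ne θ 0 with rfl | h0
  · exact (contDiffAt_const (c := (0 : ℝ))).congr_of_eventuallyEq tailAmp_eventually_zero
  · have hs : Real.sin (θ / 2) ≠ 0 := by
      have := sinc_half_pos hθ
      rw [Real.sinc_of_ne_zero (by simpa using h0)] at this
      intro h
      simp [h] at this
    have h1 : ContDiffAt ℝ ∞ (fun θ : ℝ => Real.cos (θ / 2) / Real.sin (θ / 2)) θ :=
      (Real.contDiff_cos.comp contDiff_half).contDiffAt.div
        (Real.contDiff_sin.comp contDiff_half).contDiffAt hs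
    have h2 : tailAmp = fun θ => (1 - cutoff θ) * (Real.cos (θ / 2) / Real.sin (θ / 2) / 2) := by
      funext θ; rw [tailAmp, Real.cot_eq_cos_div_sin]
    rw [h2]
    exact (contDiffAt_const.sub contDiff_cutoff.contDiffAt).mul (h1.div_const 2)

theorem continuousOn_tailAmp : ContinuousOn tailAmp (Icc 0 Real.pi) :=
  contDiffOn_tailAmp.continuousOn.mono Icc_zero_pi_subset

/-- The cutoff is even about `π`, the cotangent is odd. -/
theorem tailAmp_reflect (θ : ℝ) : tailAmp (2 * Real.pi - θ) = -tailAmp θ := by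
  have h : (2 * Real.pi - θ) / 2 = Real.pi - θ / 2 := by ring
  rw [tailAmp, tailAmp, cutoff, cutoff, Real.cos_two_pi_sub, h, Real.cot_eq_cos_div_sin,
    Real.cot_eq_cos_div_sin, Real.cos_pi_sub, Real.sin_pi_sub]
  ring

theorem sineInt_amp_eq {a : ℝ} (ha : 0 ≤ a) (b : ℝ) : sineInt amp a b = sineInt localAmp a b +
    (∫ θ in (0 : ℝ)..Real.pi, (tailAmp θ : ℂ) * Complex.exp (psi a b θ)).im := by
  have hint : IntervalIntegrable (fun θ => (tailAmp θ : ℂ) * Complex.exp (psi a b θ))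
      MeasureTheory.volume 0 Real.pi :=
    (continuousOn_mul_exp_psi continuousOn_tailAmp a b).intervalIntegrable_of_Icc Real.pi_pos.le
  have him := Complex.imCLM.intervalIntegral_comp_comm hint
  simp only [Complex.imCLM_apply] at him
  have hint' : IntervalIntegrable (fun θ => ((tailAmp θ : ℂ) * Complex.exp (psi a b θ)).im)
      MeasureTheory.volume 0 Real.pi :=
    (Complex.continuous_im.comp_continuousOn
      (continuousOn_mul_exp_psi continuousOn_tailAmp a b)).intervalIntegrable_of_Icc Real.pi_pos.le
  rw [← him, sineInt, sineInt, ← intervalIntegral.integral_add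
    (intervalIntegrable_sineInt continuousOn_localAmp ha b) hint']
  refine intervalIntegral.integral_congr_ae (Eventually.of_forall fun θ hθ => ?_)
  rw [uIoc_of_le Real.pi_pos.le] at hθ
  have h0 := hθ.1.ne'
  rw [Complex.im_ofReal_mul, exp_psi_im, tailAmp, localAmp, amp_eq h0]
  field_simp
  ring

theorem exp_neg_mul_le_div_pow {c : ℝ} (hc : 0 < c) (n : ℕ) :
    ∃ C, 0 ≤ C ∧ ∀ a : ℝ, 0 < a → Real.exp (-a * c) ≤ C / a ^ n := by
  refine ⟨n.factorial / c ^ n, by positivity, fun a ha => ?_⟩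
  have h := Real.pow_div_factorial_le_exp (a * c) (by positivity) n
  rw [neg_mul, Real.exp_neg, div_div, inv_le_comm₀ (Real.exp_pos _) (by positivity), inv_div]
  refine le_trans (le_of_eq ?_) h
  rw [mul_pow]; ring

/-- On the support of the tail amplitude `w` is at least `w (π / 3) > 1`. -/
theorem exists_norm_tail_le (n : ℕ) : ∃ C, 0 ≤ C ∧ ∀ a b : ℝ, 0 < a →
    ‖∫ θ in (0 : ℝ)..Real.pi, (tailAmp θ : ℂ) * Complex.exp (psi a b θ)‖ ≤ C / a ^ n := by
  have hπ := Real.pi_pos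
  obtain ⟨M, hM⟩ := isCompact_Icc.exists_bound_of_continuousOn continuousOn_tailAmp
  have hM0 : 0 ≤ M := (norm_nonneg _).trans (hM 0 ⟨le_rfl, hπ.le⟩)
  have hw : 0 < Real.log (w (Real.pi / 3)) :=
    Real.log_pos (one_lt_w (by positivity) (by linarith))
  obtain ⟨C, hC0, hC⟩ := exp_neg_mul_le_div_pow hw n
  refine ⟨M * C * Real.pi, by positivity, fun a b ha => ?_⟩
  have h := intervalIntegral.norm_integral_le_of_norm_le_const (a := 0) (b := Real.pi)
    (f := fun θ => (tailAmp θ : ℂ) * Complex.exp (psi a b θ)) (C := M * (C / a ^ n)) fun θ hθ => by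
      rw [uIoc_of_le hπ.le] at hθ
      rcases le_or_gt θ (Real.pi / 3) with h3 | h3
      · have : 1 / 2 ≤ Real.cos θ := by
          rw [← Real.cos_pi_div_three]
          exact Real.cos_le_cos_of_nonneg_of_le_pi hθ.1.le (by linarith) h3
        rw [tailAmp, cutoff_eq_one this]
        simp
        positivity
      · rw [norm_mul, Complex.norm_real, norm_exp_psi]
        exact mul_le_mul (hM θ ⟨hθ.1.le, hθ.2⟩)
          ((exp_neg_mul_log_w_le ha.le (by positivity) h3.le hθ.2).trans (hC a ha))
          (Real.exp_pos _).le hM0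
  rw [sub_zero, abs_of_pos hπ] at h
  exact h.trans (le_of_eq (by ring))

/-- For integer `b` the boundary terms at `π` of the integrations by parts of the tail are real:
`e^{ψ(π)}` is real, `ψ'(π) = i b`, and the coefficients of its odd powers vanish by parity. -/
theorem boundary_tail_im (a : ℝ) (n k : ℕ) :
    (ibpTerm tailAmp a n k Real.pi / dpsi a n Real.pi * Complex.exp (psi a n Real.pi)).im = 0 := by
  have h1 : (Complex.exp (psi a n Real.pi)).im = 0 := by
    rw [exp_psi_im, Real.sin_nat_mul_pi, zero_mul]
  have h2 : (ibpTerm tailAmp a n k Real.pi / dpsi a n Real.pi).im = 0 := by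
    rw [ibpTerm, Finset.sum_div, Complex.im_sum]
    refine Finset.sum_eq_zero fun m _ => ?_
    rw [div_div, ← pow_succ, dpsi_eq, phaseSlope_pi]
    have hr := ibpCoeff_reflect tailAmp_reflect k m Real.pi
    rw [show 2 * Real.pi - Real.pi = Real.pi by ring] at hr
    rcases Nat.even_or_odd (k + m) with he | ho
    · rw [pow_succ, he.neg_one_pow] at hr
      have : ibpCoeff tailAmp k m Real.pi = 0 := by linarith
      simp [this]
    · obtain ⟨j, hj⟩ := ho
      have hj' : m + k + 1 = 2 * (j + 1) := by omega
      rw [hj']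
      have : (Complex.I * ((n : ℝ) : ℂ) - (a : ℂ) * ((0 : ℝ) : ℂ)) ^ (2 * (j + 1))
          = (((-(n : ℝ) ^ 2) ^ (j + 1) : ℝ) : ℂ) := by
        rw [pow_mul]; push_cast; rw [mul_zero, sub_zero, mul_pow, Complex.I_sq]; ring
      rw [this, ← Complex.ofReal_pow, ← Complex.ofReal_mul, ← Complex.ofReal_div, Complex.ofReal_im]
  rw [Complex.mul_im, h1, h2]
  ring

/-- For `b ≤ a` the tail is small because it is exponentially small in `a`; for integer `b ≥ a` it
is integrated by parts over all of `[0, π]`, where `|ψ'| ≥ b`. -/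
theorem exists_im_tail_nat_le (K : ℕ) : ∃ C, 0 ≤ C ∧ ∀ (a : ℝ) (n : ℕ), 1 ≤ a →
    |(∫ θ in (0 : ℝ)..Real.pi, (tailAmp θ : ℂ) * Complex.exp (psi a n θ)).im|
      ≤ C / (a + n) ^ (2 * K) := by
  have hπ := Real.pi_pos
  obtain ⟨B, hB0, hB⟩ := exists_norm_ibpTerm_le isOpen_Ioo contDiffOn_tailAmp Icc_zero_pi_subset
    (2 * K) (c := 1 / 2) (by norm_num)
  obtain ⟨C, hC0, hC⟩ := exists_norm_tail_le (2 * K)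
  refine ⟨max (C * 2 ^ (2 * K)) (B * Real.pi), le_max_of_le_right (by positivity),
    fun a n ha => ?_⟩
  have ha0 : 0 < a := by linarith
  have hn0 : (0 : ℝ) ≤ n := Nat.cast_nonneg n
  rcases le_total (n : ℝ) a with hna | hna
  · refine (Complex.abs_im_le_norm _).trans ((hC a n ha0).trans ?_)
    refine le_trans ?_ (div_le_div_of_nonneg_right (le_max_left _ _) (by positivity))
    rw [div_le_div_iff₀ (by positivity) (by positivity), mul_assoc, ← mul_pow]
    exact mul_le_mul_of_nonneg_left (pow_le_pow_left₀ (by positivity) (by linarith) _) hC0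
  · have hlow : ∀ θ, 1 / 2 * (a + n) ≤ ‖dpsi a n θ‖ := fun θ =>
      le_trans (by linarith) (le_norm_dpsi a n θ)
    have hne : ∀ θ ∈ Icc 0 Real.pi, dpsi a n θ ≠ 0 := fun θ _ =>
      dpsi_ne_zero_of_le (by norm_num) ha0 hn0 (hlow θ)
    rw [integral_mul_exp_psi isOpen_Ioo contDiffOn_tailAmp hπ.le le_rfl Icc_zero_pi_subset hne
      (2 * K), Complex.add_im, Complex.im_sum, Finset.sum_eq_zero, zero_add]
    · refine (Complex.abs_im_le_norm _).trans ?_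
      have h := intervalIntegral.norm_integral_le_of_norm_le_const (a := 0) (b := Real.pi)
        (f := fun θ => ibpTerm tailAmp a n (2 * K) θ * Complex.exp (psi a n θ))
        (C := B / (a + n) ^ (2 * K)) fun θ hθ => by
          rw [uIoc_of_le hπ.le] at hθ
          rw [norm_mul]
          calc _ ≤ ‖ibpTerm tailAmp a n (2 * K) θ‖ * 1 :=
                mul_le_mul_of_nonneg_left (norm_exp_psi_le_one ha0.le n θ) (norm_nonneg _)
            _ ≤ _ := by rw [mul_one]; exact hB a n θ ha0 hn0 ⟨hθ.1.le, hθ.2⟩ (hlow θ)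
      rw [sub_zero, abs_of_pos hπ] at h
      refine h.trans (le_trans (le_of_eq ?_)
        (div_le_div_of_nonneg_right (le_max_right _ _) (by positivity)))
      ring
    · intro j _
      rw [ibpTerm_eq_zero_of_eventually tailAmp_eventually_zero, zero_div, sub_zero,
        boundary_tail_im]

/-! ### The asymptotic expansion -/

theorem tendsto_sineInt_localAmp {a : ℝ} (ha : 1 ≤ a) :
    Tendsto (fun n : ℕ => sineInt localAmp a n) atTop (𝓝 (Real.pi / 2)) := by
  obtain ⟨C, hC0, hC⟩ := exists_im_tail_nat_le 1
  have hsum : Tendsto (fun n : ℕ => (a + (n : ℝ)) ^ (2 * 1)) atTop atTop :=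
    (tendsto_pow_atTop (by norm_num)).comp
      (tendsto_atTop_add_const_left _ _ tendsto_natCast_atTop_atTop)
  have h0 : Tendsto (fun n : ℕ => (∫ θ in (0 : ℝ)..Real.pi,
      (tailAmp θ : ℂ) * Complex.exp (psi a n θ)).im) atTop (𝓝 0) :=
    squeeze_zero_norm (fun n => hC a n ha) (hsum.const_div_atTop C)
  have h := (tendsto_sineInt_amp (by linarith : 0 < a)).sub h0
  rw [sub_zero] at h
  refine h.congr fun n => ?_
  rw [sineInt_amp_eq (by linarith) n]
  ring

theorem tendsto_sum_e {a : ℝ} (ha : 0 < a) {K : ℕ} (hK : 1 ≤ K) :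
    Tendsto (fun b => ∑ k ∈ Finset.range K, e (2 * k) a b) atTop (𝓝 (Real.pi / 2)) := by
  obtain ⟨K, rfl⟩ : ∃ n, K = n + 1 := ⟨K - 1, by omega⟩
  simp only [Finset.sum_range_succ']
  have h1 : Tendsto (fun b => ∑ k ∈ Finset.range K, e (2 * (k + 1)) a b) atTop
      (𝓝 (∑ k ∈ Finset.range K, 0)) :=
    tendsto_finsetSum _ fun k _ => tendsto_e_two_mul ha (Nat.succ_pos k)
  have h2 : Tendsto (fun b => e (2 * 0) a b) atTop (𝓝 (Real.pi / 2)) := by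
    simp only [mul_zero, e_zero_eq ha]
    exact (Real.tendsto_arctan_atTop.mono_right nhdsWithin_le_nhds).comp
      (tendsto_id.atTop_div_const ha)
  have h := h1.add h2
  simpa using h

/-- The error of the expansion of the localised integral vanishes at infinity, so it is bounded
by the integral of its derivative over `[b, ∞)`. -/
theorem exists_abs_sineInt_localAmp_sub_le (K : ℕ) (hK : 1 ≤ K) : ∃ C, 0 ≤ C ∧ ∀ a b : ℝ, 1 ≤ a →
    0 ≤ b → |sineInt localAmp a b - ∑ k ∈ Finset.range K, e (2 * k) a b|
      ≤ C / (a + b) ^ (2 * K) := by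
  obtain ⟨C, hC0, hC⟩ := exists_norm_integral_localAmp_sub_le K
  refine ⟨C / (2 * K), by positivity, fun a b ha hb => ?_⟩
  have ha0 : 0 < a := by linarith
  set E : ℝ → ℝ := fun t => sineInt localAmp a t - ∑ k ∈ Finset.range K, e (2 * k) a t
  have hderiv : ∀ t, HasDerivAt E ((∫ θ in (0 : ℝ)..Real.pi,
      (localAmp θ : ℂ) * Complex.exp (psi a t θ)) -
      ∑ j ∈ Finset.range K, d (2 * j) a t).re t := by
    intro t
    rw [Complex.sub_re, Complex.re_sum]
    exact (hasDerivAt_sineInt continuousOn_localAmp ha0.le t).sub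
      (HasDerivAt.fun_sum fun k _ => hasDerivAt_e ha0 (2 * k) t)
  have hlim : Tendsto (fun n : ℕ => E n) atTop (𝓝 0) := by
    have h := (tendsto_sineInt_localAmp ha).sub
      ((tendsto_sum_e ha0 hK).comp tendsto_natCast_atTop_atTop)
    rwa [sub_self] at h
  have hK0 : (0 : ℝ) < 2 * K := by positivity
  have hB : ∀ t, 0 ≤ t → HasDerivAt
      (fun t => C / (2 * K) * (((a + b) ^ (2 * K))⁻¹ - ((a + t) ^ (2 * K))⁻¹))
      (C / (a + t) ^ (2 * K + 1)) t := by
    intro t ht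
    have hat : a + t ≠ 0 := by positivity
    have h1 : HasDerivAt (fun t => a + t) 1 t := (hasDerivAt_id t).const_add a
    have h2 := (((h1.pow (2 * K)).inv (pow_ne_zero _ hat)).const_sub
      (((a + b) ^ (2 * K))⁻¹)).const_mul (C / (2 * K))
    refine h2.congr_deriv ?_
    obtain ⟨j, hj⟩ : ∃ j, 2 * K = j + 1 := ⟨2 * K - 1, by omega⟩
    have hj' : (2 * (K : ℝ)) = j + 1 := by exact_mod_cast hj
    have hj0 : (j : ℝ) + 1 ≠ 0 := by positivity
    simp only [Pi.pow_apply]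
    push_cast
    rw [hj', hj, Nat.add_sub_cancel]
    field_simp
    ring
  -- the error is compared on `[b, n]` with the antiderivative of the bound for its derivative
  have hmain : ∀ n : ℕ, b ≤ n → |E n - E b| ≤ C / (2 * K) * ((a + b) ^ (2 * K))⁻¹ := by
    intro n hn
    have h := image_norm_le_of_norm_deriv_right_le_deriv_boundary' (a := b) (b := n)
      (f := fun t => E t - E b)
      (fun t _ => ((hderiv t).sub_const _).continuousAt.continuousWithinAt)
      (fun t _ => ((hderiv t).sub_const _).hasDerivWithinAt)
      (B := fun t => C / (2 * K) * (((a + b) ^ (2 * K))⁻¹ - ((a + t) ^ (2 * K))⁻¹)) (by simp)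
      (fun t ht => (hB t (hb.trans ht.1)).continuousAt.continuousWithinAt)
      (fun t ht => (hB t (hb.trans ht.1)).hasDerivWithinAt)
      (fun t ht => (Complex.abs_re_le_norm _).trans (hC a t ha (hb.trans ht.1)))
      (right_mem_Icc.2 hn)
    refine h.trans (mul_le_mul_of_nonneg_left ?_ (by positivity))
    have : (0 : ℝ) ≤ ((a + n) ^ (2 * K))⁻¹ := by positivity
    linarith
  have h := (hlim.sub_const (E b)).abs
  rw [zero_sub, abs_neg] at h
  have hE : |E b| ≤ C / (2 * K) * ((a + b) ^ (2 * K))⁻¹ := by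
    refine le_of_tendsto h ?_
    filter_upwards [eventually_ge_atTop ⌈b⌉₊] with n hn
    exact hmain n ((Nat.le_ceil b).trans (by exact_mod_cast hn))
  rwa [← div_eq_mul_inv] at hE

/-- For `K = 0` the claim is boundedness, which follows from the case `K = 1`. -/
theorem exists_abs_sineInt_localAmp_sub_le' (K : ℕ) : ∃ C, 0 ≤ C ∧ ∀ a b : ℝ, 1 ≤ a →
    0 ≤ b → |sineInt localAmp a b - ∑ k ∈ Finset.range K, e (2 * k) a b|
      ≤ C / (a + b) ^ (2 * K) := by
  rcases Nat.eq_zero_or_pos K with rfl | hK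
  · obtain ⟨C, hC0, hC⟩ := exists_abs_sineInt_localAmp_sub_le 1 le_rfl
    refine ⟨C + Real.pi / 2, by positivity, fun a b ha hb => ?_⟩
    have h := hC a b ha hb
    have ha0 : 0 < a := by linarith
    have hC' : C / (a + b) ^ (2 * 1) ≤ C := div_le_self hC0 (one_le_pow₀ (by linarith))
    simp only [Finset.sum_range_one, mul_zero, e_zero_eq ha0] at h
    simp only [Finset.range_zero, Finset.sum_empty, sub_zero, mul_zero, pow_zero, div_one]
    have h1 := Real.arctan_lt_pi_div_two (b / a)
    have h2 := Real.neg_pi_div_two_lt_arctan (b / a)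
    rw [abs_le] at h ⊢
    constructor <;> linarith
  · exact exists_abs_sineInt_localAmp_sub_le K hK

theorem exists_abs_PInt_nat_sub_le (K : ℕ) : ∃ C : ℝ, ∀ (a : ℝ) (n : ℕ), 1 ≤ a →
    |PInt a n - 2 / Real.pi * ∑ k ∈ Finset.range K, e (2 * k) a n| ≤ C / (a + n) ^ (2 * K) := by
  obtain ⟨C, hC0, hC⟩ := exists_abs_sineInt_localAmp_sub_le' K
  obtain ⟨D, hD0, hD⟩ := exists_im_tail_nat_le K
  have hπ : 0 < 2 / Real.pi := div_pos two_pos Real.pi_pos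
  refine ⟨2 / Real.pi * (C + D), fun a n ha => ?_⟩
  rw [PInt_eq_sineInt, ← mul_sub, abs_mul, abs_of_pos hπ, mul_div_assoc,
    sineInt_amp_eq (by linarith), add_sub_right_comm, add_div]
  exact mul_le_mul_of_nonneg_left ((abs_add_le _ _).trans
    (add_le_add (hC a n ha (Nat.cast_nonneg n)) (hD a n ha))) hπ.le

theorem exists_abs_PInt_sub_le (K : ℕ) : ∃ C : ℝ, ∀ a lam : ℝ, 1 ≤ a → 0 ≤ lam →
    |PInt a (lam * a) - 2 / Real.pi * ∑ k ∈ Finset.range K, e (2 * k) a (lam * a)|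
      ≤ C / a ^ (2 * K) := by
  obtain ⟨C, hC0, hC⟩ := exists_abs_sineInt_localAmp_sub_le' K
  obtain ⟨D, hD0, hD⟩ := exists_norm_tail_le (2 * K)
  have hπ : 0 < 2 / Real.pi := div_pos two_pos Real.pi_pos
  refine ⟨2 / Real.pi * (C + D), fun a lam ha hl => ?_⟩
  have ha0 : 0 < a := by linarith
  have hb : 0 ≤ lam * a := by positivity
  rw [PInt_eq_sineInt, ← mul_sub, abs_mul, abs_of_pos hπ, mul_div_assoc,
    sineInt_amp_eq ha0.le, add_sub_right_comm, add_div]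
  refine mul_le_mul_of_nonneg_left ((abs_add_le _ _).trans (add_le_add ?_ ?_)) hπ.le
  · exact (hC a _ ha hb).trans (div_le_div_of_nonneg_left hC0 (by positivity)
      (pow_le_pow_left₀ ha0.le (by linarith) _))
  · exact (Complex.abs_im_le_norm _).trans (hD a _ ha0)

/-! ### The integral representation of the Bessel function -/

theorem integral_exp_int_mul_I (j k : ℕ) :
    ∫ φ in (0 : ℝ)..2 * Real.pi, Complex.exp ((j - k : ℂ) * Complex.I * φ) =
      if j = k then 2 * (Real.pi : ℂ) else 0 := by
  split_ifs with h
  · subst h; simp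
  · have hne : ((j : ℂ) - k) * Complex.I ≠ 0 :=
      mul_ne_zero (sub_ne_zero.2 (by exact_mod_cast h)) Complex.I_ne_zero
    rw [integral_exp_mul_complex hne]
    have : Complex.exp ((j - k : ℂ) * Complex.I * (2 * Real.pi : ℝ)) = 1 := by
      rw [Complex.exp_eq_one_iff]
      exact ⟨(j : ℤ) - k, by push_cast; ring⟩
    rw [this]
    simp

/-- The terms of the exponential series at `t / 2`. -/
def expTerm (t : ℝ) (j : ℕ) : ℝ := (t / 2) ^ j / j.factorial

theorem summable_abs_expTerm (t : ℝ) : Summable fun j => |expTerm t j| := by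
  refine (Real.summable_pow_div_factorial |t / 2|).congr fun j => ?_
  rw [expTerm, abs_div ((t / 2) ^ j), abs_pow, Nat.abs_cast]

theorem hasSum_expTerm_mul_pow (t : ℝ) (z : ℂ) :
    HasSum (fun j => (expTerm t j : ℂ) * z ^ j) (Complex.exp ((t / 2 : ℝ) * z)) := by
  have h := NormedSpace.expSeries_div_hasSum_exp (((t / 2 : ℝ) : ℂ) * z)
  rw [← Complex.exp_eq_exp_ℂ] at h
  refine h.congr_fun fun j => ?_
  rw [expTerm, mul_pow]
  push_cast
  ring

/-- The term of index `x` of the double series of `exp (t/2 · e^{iφ}) · exp (t/2 · e^{-iφ})`,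
times `e^{-ilφ}`. -/
def besselTerm (l : ℕ) (t : ℝ) (x : ℕ × ℕ) (φ : ℝ) : ℂ :=
  (expTerm t x.1 : ℂ) * (expTerm t x.2 : ℂ) *
    Complex.exp ((x.1 - (x.2 + l : ℕ) : ℂ) * Complex.I * φ)

theorem norm_besselTerm (l : ℕ) (t : ℝ) (x : ℕ × ℕ) (φ : ℝ) :
    ‖besselTerm l t x φ‖ = |expTerm t x.1| * |expTerm t x.2| := by
  have : ((x.1 - (x.2 + l : ℕ) : ℂ) * Complex.I * φ)
      = (((x.1 - (x.2 + l : ℕ) : ℝ) * φ : ℝ) : ℂ) * Complex.I := by push_cast; ring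
  rw [besselTerm, this, norm_mul, Complex.norm_exp_ofReal_mul_I, mul_one, norm_mul,
    Complex.norm_real, Complex.norm_real, Real.norm_eq_abs, Real.norm_eq_abs]

theorem cexp_mul_cexp_eq_exp_mul_cos (t φ : ℝ) :
    Complex.exp ((t / 2 : ℝ) * Complex.exp (φ * Complex.I)) *
      Complex.exp ((t / 2 : ℝ) * Complex.exp (-φ * Complex.I)) =
      (Real.exp (t * Real.cos φ) : ℂ) := by
  rw [← Complex.exp_add, ← mul_add, ← Complex.two_cos, Complex.ofReal_exp, Complex.ofReal_mul,
    Complex.ofReal_cos]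
  congr 1
  push_cast
  ring

theorem besselTerm_eq (l : ℕ) (t : ℝ) (x : ℕ × ℕ) (φ : ℝ) : besselTerm l t x φ =
    ((expTerm t x.1 : ℂ) * Complex.exp (φ * Complex.I) ^ x.1) *
      ((expTerm t x.2 : ℂ) * Complex.exp (-φ * Complex.I) ^ x.2) *
        Complex.exp (-(l : ℂ) * Complex.I * φ) := by
  have h1 : Complex.exp ((x.1 - (x.2 + l : ℕ) : ℂ) * Complex.I * φ)
      = Complex.exp (φ * Complex.I) ^ x.1 * Complex.exp (-φ * Complex.I) ^ x.2 *
        Complex.exp (-(l : ℂ) * Complex.I * φ) := by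
    rw [← Complex.exp_nat_mul, ← Complex.exp_nat_mul, ← Complex.exp_add, ← Complex.exp_add]
    congr 1
    push_cast
    ring
  rw [besselTerm, h1]
  ring

theorem hasSum_besselTerm (l : ℕ) (t φ : ℝ) : HasSum (fun x => besselTerm l t x φ)
    ((Real.exp (t * Real.cos φ) : ℂ) * Complex.exp (-(l : ℂ) * Complex.I * φ)) := by
  simp only [besselTerm_eq]
  rw [← cexp_mul_cexp_eq_exp_mul_cos]
  have e1 := hasSum_expTerm_mul_pow t (Complex.exp (φ * Complex.I))
  have e2 := hasSum_expTerm_mul_pow t (Complex.exp (-φ * Complex.I))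
  have hs := summable_mul_of_summable_norm e1.summable.norm e2.summable.norm
  have h := e1.mul e2 hs
  exact h.mul_right _

/-- The generating function of the Bessel functions, read as a Fourier series. -/
theorem integral_exp_mul_cos_mul_cexp (l : ℕ) (t : ℝ) :
    ∫ φ in (0 : ℝ)..2 * Real.pi,
      (Real.exp (t * Real.cos φ) : ℂ) * Complex.exp (-(l : ℂ) * Complex.I * φ)
      = ((2 * Real.pi * besselI l t : ℝ) : ℂ) := by
  have hprod : Summable fun x : ℕ × ℕ => |expTerm t x.1| * |expTerm t x.2| :=
    (summable_abs_expTerm t).mul_of_nonneg (summable_abs_expTerm t) (fun _ => abs_nonneg _)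
      fun _ => abs_nonneg _
  have hint := intervalIntegral.hasSum_integral_of_dominated_convergence
    (μ := MeasureTheory.volume) (a := 0) (b := 2 * Real.pi) (F := besselTerm l t)
    (f := fun φ => (Real.exp (t * Real.cos φ) : ℂ) * Complex.exp (-(l : ℂ) * Complex.I * φ))
    (fun x _ => |expTerm t x.1| * |expTerm t x.2|)
    (fun x => by
      refine Continuous.aestronglyMeasurable ?_
      exact continuous_const.mul (Complex.continuous_exp.comp
        (continuous_const.mul Complex.continuous_ofReal)))
    (fun x => Eventually.of_forall fun φ _ => (norm_besselTerm l t x φ).le)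
    (Eventually.of_forall fun φ _ => hprod) intervalIntegrable_const
    (Eventually.of_forall fun φ _ => hasSum_besselTerm l t φ)
  have hterm : ∀ x : ℕ × ℕ, ∫ φ in (0 : ℝ)..2 * Real.pi, besselTerm l t x φ =
      (expTerm t x.1 : ℂ) * (expTerm t x.2 : ℂ) *
        if x.1 = x.2 + l then 2 * (Real.pi : ℂ) else 0 := by
    intro x
    simp only [besselTerm]
    rw [intervalIntegral.integral_const_mul, integral_exp_int_mul_I]
  simp only [hterm] at hint
  have hinj : Function.Injective fun m : ℕ => (m + l, m) := fun m n h => (Prod.mk.inj h).2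
  rw [← hinj.hasSum_iff] at hint
  · have h2 : ((fun x : ℕ × ℕ => (expTerm t x.1 : ℂ) * (expTerm t x.2 : ℂ) *
        if x.1 = x.2 + l then 2 * (Real.pi : ℂ) else 0) ∘ fun m : ℕ => (m + l, m)) =
        fun m => ((2 * Real.pi * ((t / 2) ^ (l + 2 * m) /
          ((m.factorial : ℝ) * ((l + m).factorial : ℝ))) : ℝ) : ℂ) := by
      funext m
      simp only [Function.comp, if_true, expTerm]
      rw [show l + 2 * m = (m + l) + m by ring, pow_add, add_comm l m]
      push_cast
      field_simp
      ring
    rw [h2] at hint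
    rw [← hint.tsum_eq, ← Complex.ofReal_tsum, tsum_mul_left, besselI]
  · rintro ⟨j, m⟩ hx
    have : j ≠ m + l := fun h => hx ⟨m, by rw [h]⟩
    simp [this]

theorem integral_exp_mul_cos (l : ℕ) (t : ℝ) :
    ∫ φ in (0 : ℝ)..2 * Real.pi, Real.exp (t * Real.cos φ) * Real.cos (l * φ)
      = 2 * Real.pi * besselI l t := by
  have h := congrArg Complex.re (integral_exp_mul_cos_mul_cexp l t)
  rw [Complex.ofReal_re] at h
  have hcont : Continuous fun φ : ℝ =>
      (Real.exp (t * Real.cos φ) : ℂ) * Complex.exp (-(l : ℂ) * Complex.I * φ) := by fun_prop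
  have hre := Complex.reCLM.intervalIntegral_comp_comm
    (hcont.intervalIntegrable (μ := MeasureTheory.volume) 0 (2 * Real.pi))
  simp only [Complex.reCLM_apply] at hre
  rw [← h, ← hre]
  refine intervalIntegral.integral_congr fun φ _ => ?_
  have : -(l : ℂ) * Complex.I * φ = ((-(l * φ) : ℝ) : ℂ) * Complex.I := by push_cast; ring
  rw [Complex.re_ofReal_mul, this, Complex.exp_ofReal_mul_I_re, Real.cos_neg]

/-- Integration by parts in `∫ e^{t cos φ} cos (l φ) dφ = 2 π I_l(t)` absorbs the factor `l / t` of
the density. -/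
theorem passageDensity_eq_integral (l : ℕ) {t : ℝ} (ht : 0 < t) : passageDensity l t =
    1 / Real.pi * ∫ φ in (0 : ℝ)..Real.pi,
      Real.exp (-(t * (1 - Real.cos φ))) * (Real.sin φ * Real.sin (l * φ)) := by
  set f : ℝ → ℝ := fun φ => Real.exp (t * Real.cos φ) * (Real.sin φ * Real.sin (l * φ)) with hf
  have hfc : Continuous f := by fun_prop
  -- integration by parts over a full period
  have hparts : t * ∫ φ in (0 : ℝ)..2 * Real.pi, f φ = l * (2 * Real.pi * besselI l t) := by
    have hder : ∀ φ ∈ uIcc 0 (2 * Real.pi), HasDerivAt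
        (fun φ => -(Real.exp (t * Real.cos φ) * Real.sin (l * φ)))
        (t * f φ - l * (Real.exp (t * Real.cos φ) * Real.cos (l * φ))) φ := by
      intro φ _
      have h1 : HasDerivAt (fun φ : ℝ => Real.exp (t * Real.cos φ))
          (Real.exp (t * Real.cos φ) * (t * -Real.sin φ)) φ :=
        ((Real.hasDerivAt_cos φ).const_mul t).exp
      have h2 : HasDerivAt (fun φ : ℝ => Real.sin (l * φ)) (Real.cos (l * φ) * l) φ := by
        simpa using ((hasDerivAt_id φ).const_mul (l : ℝ)).sin
      refine (h1.mul h2).neg.congr_deriv ?_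
      rw [hf]; ring
    have hc2 : Continuous fun φ : ℝ => Real.exp (t * Real.cos φ) * Real.cos (l * φ) := by fun_prop
    have h := intervalIntegral.integral_eq_sub_of_hasDerivAt hder
      (((continuous_const.mul hfc).sub (continuous_const.mul hc2)).intervalIntegrable _ _)
    rw [intervalIntegral.integral_sub ((hfc.intervalIntegrable _ _).const_mul t)
      ((hc2.intervalIntegrable _ _).const_mul (l : ℝ)), intervalIntegral.integral_const_mul,
      intervalIntegral.integral_const_mul, integral_exp_mul_cos] at h
    have hs : Real.sin (l * (2 * Real.pi)) = 0 := by
      have := Real.sin_nat_mul_pi (l * 2)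
      push_cast at this
      rwa [mul_assoc] at this
    rw [hs] at h
    simp at h
    linarith
  have hhalf : ∫ φ in (0 : ℝ)..2 * Real.pi, f φ = 2 * ∫ φ in (0 : ℝ)..Real.pi, f φ := by
    rw [← intervalIntegral.integral_add_adjacent_intervals (b := Real.pi)
      (hfc.intervalIntegrable _ _) (hfc.intervalIntegrable _ _)]
    have h1 := intervalIntegral.integral_comp_sub_left (a := 0) (b := Real.pi) f (2 * Real.pi)
    rw [sub_zero, show 2 * Real.pi - Real.pi = Real.pi by ring] at h1
    rw [← h1, two_mul (∫ φ in (0 : ℝ)..Real.pi, f φ), add_right_inj]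
    refine intervalIntegral.integral_congr fun φ _ => ?_
    have h3 : (l : ℝ) * (2 * Real.pi - φ) = l * (2 * Real.pi) - l * φ := by ring
    simp only [hf]
    rw [Real.cos_two_pi_sub, Real.sin_two_pi_sub, h3, Real.sin_nat_mul_two_pi_sub]
    ring
  have hexp : ∀ φ : ℝ, Real.exp (-(t * (1 - Real.cos φ))) * (Real.sin φ * Real.sin (l * φ)) =
      Real.exp (-t) * f φ := by
    intro φ
    rw [hf]
    simp only
    rw [← mul_assoc (Real.exp (-t)), ← Real.exp_add]
    congr 2
    ring
  simp only [hexp]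
  rw [intervalIntegral.integral_const_mul, passageDensity]
  rw [hhalf] at hparts
  have hπ := Real.pi_ne_zero
  field_simp
  linarith

/-! ### Laplace transforms of the first-passage density -/

theorem abs_sin_nat_mul_le (n : ℕ) (x : ℝ) : |Real.sin (n * x)| ≤ n * |Real.sin x| := by
  induction n with
  | zero => simp
  | succ n ih =>
    have h : ((n + 1 : ℕ) : ℝ) * x = n * x + x := by push_cast; ring
    rw [h, Real.sin_add]
    push_cast
    have h1 : |Real.sin (n * x) * Real.cos x| ≤ |Real.sin (n * x)| := by
      rw [abs_mul]; exact mul_le_of_le_one_right (abs_nonneg _) (Real.abs_cos_le_one _)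
    have h2 : |Real.cos (n * x) * Real.sin x| ≤ |Real.sin x| := by
      rw [abs_mul]; exact mul_le_of_le_one_left (abs_nonneg _) (Real.abs_cos_le_one _)
    linarith [abs_add_le (Real.sin (n * x) * Real.cos x) (Real.cos (n * x) * Real.sin x)]

theorem one_sub_cos_pos {φ : ℝ} (hφ : φ ∈ Ioc 0 Real.pi) : 0 < 1 - Real.cos φ := by
  have : Real.cos φ < Real.cos 0 := Real.cos_lt_cos_of_nonneg_of_le_pi le_rfl hφ.2 hφ.1
  rw [Real.cos_zero] at this
  linarith

/-- The numerator cancels the zero of `1 - cos φ` at `φ = 0`. -/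
theorem abs_sin_mul_sin_le (l : ℕ) (φ : ℝ) :
    |Real.sin φ * Real.sin (l * φ)| ≤ 2 * l * (1 - Real.cos φ) := by
  rw [abs_mul]
  have h1 := mul_le_mul_of_nonneg_left (abs_sin_nat_mul_le l φ) (abs_nonneg (Real.sin φ))
  have h2 : |Real.sin φ| * |Real.sin φ| = (1 + Real.cos φ) * (1 - Real.cos φ) := by
    rw [abs_mul_abs_self]; nlinarith [Real.sin_sq_add_cos_sq φ]
  have h3 : (1 + Real.cos φ) * (1 - Real.cos φ) ≤ 2 * (1 - Real.cos φ) :=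
    mul_le_mul_of_nonneg_right (by linarith [Real.cos_le_one φ]) (by linarith [Real.cos_le_one φ])
  have h4 : (0 : ℝ) ≤ l := Nat.cast_nonneg l
  nlinarith

/-- The integrand of the representation of the density, damped by `e^{-s t}`. -/
def dampedKernel (l : ℕ) (s t φ : ℝ) : ℝ :=
  Real.exp (-(1 - Real.cos φ + s) * t) * (Real.sin φ * Real.sin (l * φ))

theorem integrable_dampedKernel (l : ℕ) {s T : ℝ} (hs : 0 ≤ s) (hT : 0 ≤ T) :
    MeasureTheory.Integrable (Function.uncurry (dampedKernel l s))
      ((MeasureTheory.volume.restrict (Ioi T)).prod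
        (MeasureTheory.volume.restrict (Ioc 0 Real.pi))) := by
  have hmeas : Continuous (Function.uncurry (dampedKernel l s)) := by
    unfold dampedKernel Function.uncurry
    fun_prop
  have hneg : ∀ φ ∈ Ioc 0 Real.pi, -(1 - Real.cos φ + s) < 0 := fun φ hφ => by
    linarith [one_sub_cos_pos hφ]
  rw [MeasureTheory.integrable_prod_iff' hmeas.aestronglyMeasurable]
  constructor
  · refine (MeasureTheory.ae_restrict_iff' measurableSet_Ioc).2
      (Eventually.of_forall fun φ hφ => ?_)
    exact (integrableOn_exp_mul_Ioi (hneg φ hφ) T).mul_const (Real.sin φ * Real.sin (l * φ))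
  · have hval : ∀ φ ∈ Ioc 0 Real.pi,
        ∫ t in Ioi T, ‖Function.uncurry (dampedKernel l s) (t, φ)‖ =
        Real.exp (-(1 - Real.cos φ + s) * T) / (1 - Real.cos φ + s) *
          |Real.sin φ * Real.sin (l * φ)| := by
      intro φ hφ
      simp only [Function.uncurry, dampedKernel, norm_mul, Real.norm_eq_abs, Real.abs_exp]
      rw [MeasureTheory.integral_mul_const, integral_exp_mul_Ioi (hneg φ hφ), ← abs_mul,
        neg_div_neg_eq]
    have hcont : ContinuousOn (fun φ => Real.exp (-(1 - Real.cos φ + s) * T) /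
        (1 - Real.cos φ + s) * |Real.sin φ * Real.sin (l * φ)|) (Ioc 0 Real.pi) := by
      refine ContinuousOn.mul (ContinuousOn.div ?_ ?_ fun φ hφ => ?_) ?_
      · fun_prop
      · fun_prop
      · linarith [hneg φ hφ]
      · fun_prop
    refine MeasureTheory.Integrable.congr (f := fun φ => Real.exp (-(1 - Real.cos φ + s) * T) /
        (1 - Real.cos φ + s) * |Real.sin φ * Real.sin (l * φ)|) ?_
      ((MeasureTheory.ae_restrict_iff' measurableSet_Ioc).2
        (Eventually.of_forall fun φ hφ => (hval φ hφ).symm))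
    refine MeasureTheory.IntegrableOn.of_bound (by simp)
      (hcont.aestronglyMeasurable measurableSet_Ioc) (2 * l)
      ((MeasureTheory.ae_restrict_iff' measurableSet_Ioc).2 (Eventually.of_forall fun φ hφ => ?_))
    have hpos := one_sub_cos_pos hφ
    have hden : 0 < 1 - Real.cos φ + s := by linarith
    have h1 : Real.exp (-(1 - Real.cos φ + s) * T) ≤ 1 := by
      rw [Real.exp_le_one_iff]; nlinarith
    rw [norm_mul, norm_div, Real.norm_eq_abs, Real.abs_exp, Real.norm_eq_abs, abs_of_pos hden,
      Real.norm_eq_abs, abs_abs, div_mul_eq_mul_div, div_le_iff₀ hden]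
    have h2 := abs_sin_mul_sin_le l φ
    have h3 : 2 * (l : ℝ) * (1 - Real.cos φ) ≤ 2 * l * (1 - Real.cos φ + s) :=
      mul_le_mul_of_nonneg_left (by linarith) (by positivity)
    calc _ ≤ 1 * |Real.sin φ * Real.sin (l * φ)| := mul_le_mul_of_nonneg_right h1 (abs_nonneg _)
      _ ≤ _ := by linarith

theorem integral_dampedKernel (l : ℕ) {s T : ℝ} (hs : 0 ≤ s) (hT : 0 ≤ T) :
    ∫ t in Ioi T, ∫ φ in Ioc 0 Real.pi, dampedKernel l s t φ =
      ∫ φ in Ioc 0 Real.pi, Real.exp (-(1 - Real.cos φ + s) * T) / (1 - Real.cos φ + s) *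
        (Real.sin φ * Real.sin (l * φ)) := by
  rw [MeasureTheory.integral_integral_swap (integrable_dampedKernel l hs hT)]
  refine MeasureTheory.setIntegral_congr_fun measurableSet_Ioc fun φ hφ => ?_
  have hneg : -(1 - Real.cos φ + s) < 0 := by linarith [one_sub_cos_pos hφ]
  simp only [dampedKernel]
  rw [MeasureTheory.integral_mul_const, integral_exp_mul_Ioi hneg, neg_div_neg_eq]

theorem passageDensity_eq_dampedKernel (l : ℕ) {t : ℝ} (ht : 0 < t) : passageDensity l t =
    1 / Real.pi * ∫ φ in Ioc 0 Real.pi, dampedKernel l 0 t φ := by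
  rw [passageDensity_eq_integral l ht, intervalIntegral.integral_of_le Real.pi_pos.le]
  congr 1
  refine MeasureTheory.setIntegral_congr_fun measurableSet_Ioc fun φ _ => ?_
  simp only [dampedKernel]
  rw [add_zero, show -(t * (1 - Real.cos φ)) = -(1 - Real.cos φ) * t by ring]

theorem integrableOn_passageDensity (l : ℕ) :
    MeasureTheory.IntegrableOn (passageDensity l) (Ioi 0) := by
  have h := ((integrable_dampedKernel l le_rfl (T := 0) le_rfl).integral_prod_left).const_mul
    (1 / Real.pi)
  exact h.congr ((MeasureTheory.ae_restrict_iff' measurableSet_Ioi).2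
    (Eventually.of_forall fun t ht => (passageDensity_eq_dampedKernel l ht).symm))

/-- For `l ≥ 1` this is the probability that the walker that has to reach `l` has not done so by
the time `T`. -/
theorem integral_Ioi_passageDensity (l : ℕ) {T : ℝ} (hT : 0 ≤ T) :
    ∫ t in Ioi T, passageDensity l t = 1 / Real.pi * ∫ φ in Ioc 0 Real.pi,
      Real.exp (-(1 - Real.cos φ) * T) * (Real.cot (φ / 2) * Real.sin (l * φ)) := by
  rw [MeasureTheory.setIntegral_congr_fun measurableSet_Ioi
    (fun t ht => passageDensity_eq_dampedKernel l (lt_of_le_of_lt hT ht)),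
    MeasureTheory.integral_const_mul, integral_dampedKernel l le_rfl hT]
  congr 1
  refine MeasureTheory.setIntegral_congr_fun measurableSet_Ioc fun φ hφ => ?_
  have hs : Real.sin (φ / 2) ≠ 0 :=
    (Real.sin_pos_of_pos_of_lt_pi (by linarith [hφ.1]) (by linarith [hφ.2, Real.pi_pos])).ne'
  have h1 := one_sub_cos_pos hφ
  have h2 : Real.sin φ = 2 * Real.sin (φ / 2) * Real.cos (φ / 2) := by
    rw [← Real.sin_two_mul]; congr 1; ring
  have h3 : 1 - Real.cos φ = 2 * Real.sin (φ / 2) ^ 2 := by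
    have : Real.cos φ = 1 - 2 * Real.sin (φ / 2) ^ 2 := by
      rw [← Real.cos_two_mul_eq_one_sub]; congr 1; ring
    linarith
  have h4 : Real.sin φ / (1 - Real.cos φ) = Real.cot (φ / 2) := by
    rw [h2, h3, Real.cot_eq_cos_div_sin]; field_simp
  simp only [add_zero]
  rw [← h4]
  ring

/-- `∫_0^π sin φ sin (l φ) / (q - cos φ) dφ = π v^{-l}` for `2 q = v + v⁻¹`, `v > 1`: as a
sequence in `l`, the integral solves the three-term recurrence with the characteristic roots `v`
and `v⁻¹`, and it is bounded. -/
theorem integral_sin_mul_sin_div {q v : ℝ} (hq : 1 < q) (hv : 1 < v) (hqv : 2 * q = v + v⁻¹)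
    (l : ℕ) : ∫ φ in (0 : ℝ)..Real.pi, Real.sin φ * Real.sin ((l + 1 : ℕ) * φ) / (q - Real.cos φ) =
      Real.pi * v⁻¹ ^ (l + 1) := by
  have hden : ∀ φ : ℝ, q - Real.cos φ ≠ 0 := fun φ => by linarith [Real.cos_le_one φ]
  set J : ℕ → ℝ := fun n =>
    ∫ φ in (0 : ℝ)..Real.pi, Real.sin φ * Real.sin (n * φ) / (q - Real.cos φ) with hJ
  have hcont : ∀ n : ℕ, Continuous fun φ : ℝ =>
      Real.sin φ * Real.sin (n * φ) / (q - Real.cos φ) := fun n =>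
    Continuous.div (by fun_prop) (by fun_prop) hden
  have hint := fun n => (hcont n).intervalIntegrable (μ := MeasureTheory.volume) 0 Real.pi
  have hJ0 : J 0 = 0 := by simp [hJ]
  have hbdd : ∀ n, |J n| ≤ Real.pi / (q - 1) := by
    intro n
    have h := intervalIntegral.norm_integral_le_of_norm_le_const (a := 0) (b := Real.pi)
      (f := fun φ : ℝ => Real.sin φ * Real.sin (n * φ) / (q - Real.cos φ)) (C := 1 / (q - 1))
      fun φ _ => by
        rw [norm_div, norm_mul, Real.norm_of_nonneg (by linarith [Real.cos_le_one φ] :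
          0 ≤ q - Real.cos φ)]
        refine div_le_div₀ zero_le_one ?_ (by linarith) (by linarith [Real.cos_le_one φ])
        exact mul_le_one₀ (Real.abs_sin_le_one _) (norm_nonneg _) (Real.abs_sin_le_one _)
    rw [sub_zero, abs_of_pos Real.pi_pos] at h
    exact h.trans (le_of_eq (by ring))
  have hcosint : ∀ n : ℕ, IntervalIntegrable (fun φ => Real.cos (n * φ)) MeasureTheory.volume 0
      Real.pi := fun n =>
    (Real.continuous_cos.comp (continuous_const.mul continuous_id)).intervalIntegrable _ _
  -- the inhomogeneous terms vanish, except for `n = 0`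
  have hrec : ∀ n : ℕ, J (n + 2) + J n = 2 * q * J (n + 1) -
      ((∫ φ in (0 : ℝ)..Real.pi, Real.cos (n * φ)) -
        ∫ φ in (0 : ℝ)..Real.pi, Real.cos ((n + 2 : ℕ) * φ)) := by
    intro n
    simp only [hJ]
    rw [← intervalIntegral.integral_add (hint _) (hint _), ← intervalIntegral.integral_const_mul,
      ← intervalIntegral.integral_sub (hcosint _) (hcosint _),
      ← intervalIntegral.integral_sub ((hint _).const_mul _) ((hcosint _).sub (hcosint _))]
    refine intervalIntegral.integral_congr fun φ _ => ?_
    have e1 : ((n + 2 : ℕ) : ℝ) * φ = (n + 1 : ℕ) * φ + φ := by push_cast; ring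
    have e2 : (n : ℝ) * φ = (n + 1 : ℕ) * φ - φ := by push_cast; ring
    have := hden φ
    rw [e1, e2, Real.sin_add, Real.sin_sub, Real.cos_add, Real.cos_sub]
    field_simp
    ring
  have hv0 : v ≠ 0 := by positivity
  -- `D` removes the decaying solution; from index `1` on it is a bounded multiple of `v ^ n`,
  -- hence zero
  set D : ℕ → ℝ := fun n => J (n + 1) - v⁻¹ * J n with hD
  have hDrec : ∀ n, D (n + 2) = v * D (n + 1) := by
    intro n
    have h := hrec (n + 1)
    rw [integral_cos_nat_mul, show n + 1 + 2 = n + 2 + 1 by ring, integral_cos_nat_mul, hqv] at h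
    simp only [hD]
    have : v * v⁻¹ = 1 := mul_inv_cancel₀ hv0
    have e : n + 2 + 1 = n + 3 := rfl
    have e' : n + 1 + 1 = n + 2 := rfl
    rw [e] at h ⊢
    rw [e'] at h ⊢
    linear_combination h + J (n + 1) * this
  have hD1 : D 1 = v * D 0 - Real.pi := by
    have h := hrec 0
    rw [show (0 : ℕ) + 2 = 1 + 1 by rfl, integral_cos_nat_mul, hqv] at h
    simp at h
    simp only [hD]
    have : v * v⁻¹ = 1 := mul_inv_cancel₀ hv0
    norm_num at h ⊢
    rw [hJ0] at h ⊢
    linear_combination h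
  have hDpow : ∀ n, D (n + 1) = v ^ n * D 1 := by
    intro n
    induction n with
    | zero => simp
    | succ n ih => rw [hDrec, ih, pow_succ]; ring
  have hDbdd : ∀ n, |D n| ≤ Real.pi / (q - 1) + v⁻¹ * (Real.pi / (q - 1)) := by
    intro n
    refine (abs_sub _ _).trans (add_le_add (hbdd _) ?_)
    rw [abs_mul, abs_of_pos (by positivity : 0 < v⁻¹)]
    exact mul_le_mul_of_nonneg_left (hbdd n) (by positivity)
  have hD10 : D 1 = 0 := by
    by_contra hne
    have hlim : Tendsto (fun n : ℕ => v ^ n * |D 1|) atTop atTop :=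
      (tendsto_pow_atTop_atTop_of_one_lt hv).atTop_mul_const (abs_pos.2 hne)
    obtain ⟨n, hn⟩ := (hlim.eventually_gt_atTop
      (Real.pi / (q - 1) + v⁻¹ * (Real.pi / (q - 1)))).exists
    have h := hDbdd (n + 1)
    rw [hDpow, abs_mul, abs_of_pos (by positivity : 0 < v ^ n)] at h
    linarith
  have hJ1 : J 1 = Real.pi * v⁻¹ := by
    have h : v * D 0 = Real.pi := by linarith
    have h' : D 0 = J 1 := by simp [hD, hJ0]
    rw [h'] at h
    rw [← h]; field_simp
  change J (l + 1) = _
  induction l with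
  | zero => simpa using hJ1
  | succ l ih =>
    have h : D (l + 1) = 0 := by rw [hDpow, hD10, mul_zero]
    simp only [hD] at h
    rw [pow_succ, ← mul_assoc, ← ih]
    linarith

theorem w_add_inv (θ : ℝ) : 2 * p θ = w θ + (w θ)⁻¹ := by
  have h1 : 0 ≤ p θ ^ 2 - 1 := by nlinarith [one_le_p θ]
  have h2 := Real.mul_self_sqrt h1
  have h3 : (p θ - Real.sqrt (p θ ^ 2 - 1)) * w θ = 1 := by rw [w]; nlinarith
  have h4 : (w θ)⁻¹ = p θ - Real.sqrt (p θ ^ 2 - 1) := by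
    rw [inv_eq_iff_eq_inv, eq_comm]; exact inv_eq_of_mul_eq_one_right h3
  rw [h4, w]; ring

/-- The Laplace transform of the density of the walker that has to reach `l ≥ 1`. -/
theorem laplace_passageDensity {l : ℕ} (hl : 1 ≤ l) {θ : ℝ} (hθ : θ ∈ Ioc 0 Real.pi) :
    ∫ t in Ioi (0 : ℝ), passageDensity l t * Real.exp (-(1 - Real.cos θ) * t) =
      w θ ^ (-(l : ℝ)) := by
  have hs := one_sub_cos_pos hθ
  have h1 : ∀ t ∈ Ioi (0 : ℝ), passageDensity l t * Real.exp (-(1 - Real.cos θ) * t) =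
      1 / Real.pi * ∫ φ in Ioc 0 Real.pi, dampedKernel l (1 - Real.cos θ) t φ := by
    intro t ht
    rw [passageDensity_eq_dampedKernel l ht, mul_assoc, ← MeasureTheory.integral_mul_const]
    congr 1
    refine MeasureTheory.setIntegral_congr_fun measurableSet_Ioc fun φ _ => ?_
    simp only [dampedKernel]
    rw [show -(1 - Real.cos φ + (1 - Real.cos θ)) * t =
      -(1 - Real.cos φ + 0) * t + -(1 - Real.cos θ) * t by ring, Real.exp_add]
    ring
  rw [MeasureTheory.setIntegral_congr_fun measurableSet_Ioi h1, MeasureTheory.integral_const_mul,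
    integral_dampedKernel l hs.le le_rfl]
  obtain ⟨m, rfl⟩ : ∃ m, l = m + 1 := ⟨l - 1, by omega⟩
  have h2 := integral_sin_mul_sin_div (q := p θ) (v := w θ) (by rw [p]; linarith)
    (one_lt_w hθ.1 hθ.2) (w_add_inv θ) m
  rw [intervalIntegral.integral_of_le Real.pi_pos.le] at h2
  have h3 : ∀ φ : ℝ, Real.exp (-(1 - Real.cos φ + (1 - Real.cos θ)) * 0) /
      (1 - Real.cos φ + (1 - Real.cos θ)) * (Real.sin φ * Real.sin ((m + 1 : ℕ) * φ)) =
      Real.sin φ * Real.sin ((m + 1 : ℕ) * φ) / (p θ - Real.cos φ) := by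
    intro φ
    rw [mul_zero, Real.exp_zero, p, show 1 - Real.cos φ + (1 - Real.cos θ) =
      2 - Real.cos θ - Real.cos φ by ring]
    ring
  simp only [h3]
  rw [h2, Real.rpow_neg (w_pos θ).le, Real.rpow_natCast, inv_pow]
  have := Real.pi_ne_zero
  field_simp

/-- Inserting the survival integral of walker `B` and exchanging the integrals leaves the Laplace
transform of the density of walker `A`. -/
theorem P_eq_PInt (lA lB : ℕ) (hA : 1 ≤ lA) : P lA lB = PInt lA lB := by
  set G : ℝ → ℝ := fun φ => Real.cot (φ / 2) * Real.sin (lB * φ) with hG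
  have hGc : ContinuousOn G (Ioc 0 Real.pi) := by
    have : G = fun φ => Real.cos (φ / 2) / Real.sin (φ / 2) * Real.sin (lB * φ) := by
      funext φ; rw [hG]; simp only; rw [Real.cot_eq_cos_div_sin]
    rw [this]
    refine ContinuousOn.mul (ContinuousOn.div (by fun_prop) (by fun_prop) fun φ hφ => ?_)
      (by fun_prop)
    exact (Real.sin_pos_of_pos_of_lt_pi (by linarith [hφ.1])
      (by linarith [hφ.2, Real.pi_pos])).ne'
  have hGint : MeasureTheory.Integrable G (MeasureTheory.volume.restrict (Ioc 0 Real.pi)) := by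
    have h := intervalIntegrable_sineInt continuousOn_amp (a := 0) le_rfl lB
    rw [intervalIntegrable_iff_integrableOn_Ioc_of_le Real.pi_pos.le] at h
    refine (h.const_mul 2).congr ((MeasureTheory.ae_restrict_iff' measurableSet_Ioc).2
      (Eventually.of_forall fun φ hφ => ?_))
    have hφ0 := hφ.1.ne'
    simp only [hG, neg_zero, Real.rpow_zero, mul_one]
    rw [amp_eq hφ0]
    field_simp
  -- dominated by the product of the density with the integrable function `G`
  have hint : MeasureTheory.Integrable (Function.uncurry fun t φ =>
      Real.exp (-(1 - Real.cos φ) * t) * (passageDensity lA t * G φ))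
      ((MeasureTheory.volume.restrict (Ioi 0)).prod
        (MeasureTheory.volume.restrict (Ioc 0 Real.pi))) := by
    refine ((integrableOn_passageDensity lA).mul_prod hGint).bdd_mul (c := 1)
      (f := fun z : ℝ × ℝ => Real.exp (-(1 - Real.cos z.2) * z.1)) ?_ ?_
    · exact Continuous.aestronglyMeasurable (by fun_prop)
    · rw [MeasureTheory.Measure.prod_restrict]
      refine (MeasureTheory.ae_restrict_iff' (measurableSet_Ioi.prod measurableSet_Ioc)).2
        (Eventually.of_forall fun z hz => ?_)
      have h1 := one_sub_cos_pos hz.2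
      have h2 : 0 < z.1 := hz.1
      rw [Real.norm_eq_abs, Real.abs_exp, Real.exp_le_one_iff]
      nlinarith
  have h1 : P lA lB = 1 / Real.pi * ∫ t in Ioi (0 : ℝ), ∫ φ in Ioc 0 Real.pi,
      Real.exp (-(1 - Real.cos φ) * t) * (passageDensity lA t * G φ) := by
    rw [P, ← MeasureTheory.integral_const_mul]
    refine MeasureTheory.setIntegral_congr_fun measurableSet_Ioi fun t ht => ?_
    rw [integral_Ioi_passageDensity lB (le_of_lt ht), mul_left_comm,
      ← MeasureTheory.integral_const_mul]
    congr 2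
    funext φ
    simp only [hG]
    ring
  rw [h1, MeasureTheory.integral_integral_swap hint, PInt,
    intervalIntegral.integral_of_le Real.pi_pos.le]
  congr 1
  refine MeasureTheory.setIntegral_congr_fun measurableSet_Ioc fun φ hφ => ?_
  have h2 := laplace_passageDensity hA hφ
  rw [← h2, ← MeasureTheory.integral_const_mul]
  congr 1
  funext t
  simp only [hG]
  ring

end FirstPassage

end

theorem mainTheorem2 :
    -- the single-integral form of `P`, and its derivative in the second parameter
    (∀ lA lB : ℕ, 1 ≤ lA → FirstPassage.P lA lB = FirstPassage.PInt lA lB) ∧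
    (∀ a b : ℝ, 0 < a →
      HasDerivAt (fun t => FirstPassage.PInt a t) (2 / Real.pi * (FirstPassage.Q a b).re) b) ∧
    -- the expansion of `P` for large `ℓ_A + ℓ_B`
    (∀ K : ℕ, ∃ C : ℝ, ∀ lA lB : ℕ, 1 ≤ lA →
      |FirstPassage.P lA lB -
          2 / Real.pi * ∑ k ∈ Finset.range K, FirstPassage.e (2 * k) lA lB|
        ≤ C / ((lA : ℝ) + (lB : ℝ)) ^ (2 * K)) ∧
    -- for real parameters, uniformly in the ratio `lam = ℓ_B / ℓ_A ≥ 0`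
    (∀ K : ℕ, ∃ C : ℝ, ∀ a lam : ℝ, 1 ≤ a → 0 ≤ lam →
      |FirstPassage.PInt a (lam * a) -
          2 / Real.pi * ∑ k ∈ Finset.range K, FirstPassage.e (2 * k) a (lam * a)|
        ≤ C / a ^ (2 * K)) ∧
    -- the coefficients
    (∀ a b : ℝ, 0 < a → 0 ≤ b →
      FirstPassage.e 0 a b = Real.arctan (b / a) ∧
      FirstPassage.e 2 a b = a * b * (a ^ 2 - b ^ 2) / (3 * (a ^ 2 + b ^ 2) ^ 3) ∧
      FirstPassage.e 4 a b =
        a * b * (a ^ 2 - b ^ 2) * (23 * a ^ 4 - 354 * a ^ 2 * b ^ 2 + 23 * b ^ 4) /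
          (60 * (a ^ 2 + b ^ 2) ^ 6) ∧
      FirstPassage.e 6 a b =
        a * b * (a ^ 2 - b ^ 2) *
          (249 * a ^ 8 - 10796 * a ^ 6 * b ^ 2 + 40630 * b ^ 4 * a ^ 4
            - 10796 * b ^ 6 * a ^ 2 + 249 * b ^ 8) /
          (126 * (a ^ 2 + b ^ 2) ^ 9)) ∧
    (∀ k : ℕ, 1 ≤ k → ∃ N : MvPolynomial (Fin 2) ℚ, N.IsHomogeneous (4 * k) ∧
      ∀ a b : ℝ, 0 < a → 0 ≤ b →
        FirstPassage.e (2 * k) a b =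
          MvPolynomial.aeval ![a, b] N / (a ^ 2 + b ^ 2) ^ (3 * k)) ∧
    (∀ (k : ℕ) (a b : ℝ), 0 < a → 0 ≤ b → FirstPassage.d (2 * k + 1) a b = 0) ∧
    -- the bounds for the terms `d_{2k}` and for the remainders `f_{2k}`
    (∀ k : ℕ, ∃ C : ℝ, ∀ a lam : ℝ, 1 ≤ a → 0 ≤ lam →
      ‖FirstPassage.d (2 * k) a (lam * a)‖ ≤ C / a ^ (2 * k)) ∧
    (∀ (k : ℕ) (δ : ℝ), 0 < δ → ∃ C : ℝ, ∀ a lam θ : ℝ, 1 ≤ a → 0 ≤ lam →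
      0 ≤ θ → θ ≤ Real.pi → (θ ≤ Real.pi - δ ∨ δ ≤ lam) →
      ‖FirstPassage.fSeq a (lam * a) (2 * k) θ‖ ≤ C / a ^ (2 * k)) ∧
    -- `Q` with its remainder, up to exponentially small terms
    (∀ (k : ℕ) (θ₀ : ℝ), 0 < θ₀ → θ₀ < Real.pi → ∃ C : ℝ, ∀ a lam : ℝ, 1 ≤ a → 0 ≤ lam →
      ‖FirstPassage.Q a (lam * a) -
          ((∑ j ∈ Finset.range k, FirstPassage.d (2 * j) a (lam * a)) +
            ∫ θ in (0 : ℝ)..θ₀, FirstPassage.fSeq a (lam * a) (2 * k) θ *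
              Complex.exp (FirstPassage.psi a (lam * a) θ))‖
        ≤ C * Real.exp (-a * Real.log (FirstPassage.w θ₀))) := by
  refine ⟨FirstPassage.P_eq_PInt, fun a b ha => FirstPassage.hasDerivAt_PInt ha b, fun K => ?_,
    FirstPassage.exists_abs_PInt_sub_le, fun a b ha _ => ⟨FirstPassage.e_zero_eq ha b,
      FirstPassage.e_two_eq ha, FirstPassage.e_four_eq ha, FirstPassage.e_six_eq ha⟩,
    FirstPassage.exists_homogeneous_e, fun k a b ha _ => FirstPassage.d_odd ha b k,
    FirstPassage.exists_norm_d_two_mul_le, FirstPassage.exists_norm_fSeq_le,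
    FirstPassage.exists_norm_Q_sub_le⟩
  obtain ⟨C, hC⟩ := FirstPassage.exists_abs_PInt_nat_sub_le K
  refine ⟨C, fun lA lB hA => ?_⟩
  rw [FirstPassage.P_eq_PInt lA lB hA]
  exact hC lA lB (by exact_mod_cast hA)
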